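/- **Conventions.** Let $X$ be a smooth ($C^\infty$) manifold of dimension $n$ (Hausdorff, second countable) and $q\in\mathbb{N}$. Let $\Pi_q$ be the full jet groupoid of order $q$: the manifold of $q$-jets of local diffeomorphisms $X\to X$, with source $s$, target $t$ and the partial product $gh$ (composition of jets, defined if $s(g)=t(h)$). Write $\Pi_q(x,y)$ for the set of $g \in \Pi_q$ with $s(g)=x$, $t(g)=y$. For $y_0\in X$, the isotropy group $\Pi_q(y_0,y_0)$ is identified with $\mathrm{GL}_q$, the Lie group of $q$-jets of local diffeomorphisms of $\mathbb{R}^n$ at the origin which fix the origin, and $P_q=\Pi_q(-,y_0)$ is the set of jets with target $y_0$. A *jet groupoid* is a subset $\mathcal R_q\subseteq\Pi_q$ which is a smooth (locally trivial) subbundle of $s:\Pi_q\to X$ and is closed under units, products and inverses; it is *transitive* if $\mathcal R_q(x,y)=\mathcal R_q\cap\Pi_q(x,y)\neq\emptyset$ for all $x,y\in X$. A *natural bundle* of order $q$ is a smooth fibre bundle $\pi:\mathcal F\to X$ with a smooth right action $\mathcal F\times_X\Pi_q\to\mathcal F$, $(u,g)\mapsto ug$ for $\pi(u)=t(g)$,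 such that $\pi(ug)=s(g)$, $(ug)h=u(gh)$ and $u1_{\pi(u)}=u$. It *has homogeneous fibres* if $\Pi_q(x,x)$ acts transitively on $\mathcal F_x$ for every $x\in X$. For a smooth section $\omega$ of $\mathcal F$ put $$\mathrm{Stab}(\omega)=\{g\in\Pi_q \mid \omega(t(g))\,g=\omega(s(g))\}.$$ **Proposition.** 1. Let $\mathcal F$ be a natural bundle of order $q$ over $X$ with homogeneous fibres. For every smooth section $\omega$ of $\mathcal F$, $\mathcal R_q(\omega):=\mathrm{Stab}(\omega)$ is a transitive jet groupoid. 2. Conversely, let $\mathcal R_q\subseteq\Pi_q$ be a transitive jet groupoid. For every $y_0\in X$, with $G_q=\mathcal R_q(y_0,y_0)$, there are a natural bundle $\mathcal F$ of order $q$ over $X$ with homogeneous fibres and a smooth section $\omega_0$ of $\mathcal F$ such that $\mathcal R_q=\mathrm{Stab}(\omega_0)$, and $\mathcal F\cong P_q\times_{\mathrm{GL}_q}\mathrm{GL}_q/G_q$ as bundles over $X$ with right $\Pi_q$-action. Here $\mathrm{GL}_q/G_q$ is the space of cosets $G_qh$, $h\in\Pi_q(y_0,y_0)$, with the right action of $\Pi_q(y_0,y_0)$;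 the associated bundle is the quotient of $P_q\times \mathrm{GL}_q/G_q$ by $(p,v)\sim(cp,vc^{-1})$, $c\in\Pi_q(y_0,y_0)$, with $[p,v]\,g=[pg,v]$; and $\cong$ means an equivariant bijection over $X$ for which the induced map $P_q\times\Pi_q(y_0,y_0)\to\mathcal F$ is a smooth submersion. -/

import Mathlib

set_option linter.unusedSectionVars false

universe u v w

open Set Filter Topology Manifold
open scoped ContDiff

namespace JetGpd

section Calculus

variable {E F G V : Type*} [NormedAddCommGroup E] [NormedSpace ℝ E]
  [NormedAddCommGroup F] [NormedSpace ℝ F] [NormedAddCommGroup G] [NormedSpace ℝ G]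
  [NormedAddCommGroup V] [NormedSpace ℝ V]

theorem taylorComp_congr {q q' : FormalMultilinearSeries ℝ F G}
    {p p' : FormalMultilinearSeries ℝ E F} {k : ℕ} (hq : ∀ i ≤ k, q i = q' i)
    (hp : ∀ i ≤ k, p i = p' i) : q.taylorComp p k = q'.taylorComp p' k := by
  unfold FormalMultilinearSeries.taylorComp
  refine Finset.sum_congr rfl fun c _ => ?_
  unfold FormalMultilinearSeries.compAlongOrderedFinpartition
  have h : (fun m ↦ p (c.partSize m)) = fun m ↦ p' (c.partSize m) :=
    funext fun m => hp _ (c.partSize_le m)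
  rw [h, hq _ c.length_le]

theorem contDiffOn_taylorComp {q : V → FormalMultilinearSeries ℝ F G}
    {p : V → FormalMultilinearSeries ℝ E F} {s : Set V} {k : ℕ}
    (hq : ∀ i ≤ k, ContDiffOn ℝ ∞ (fun z => q z i) s)
    (hp : ∀ i ≤ k, ContDiffOn ℝ ∞ (fun z => p z i) s) :
    ContDiffOn ℝ ∞ (fun z => (q z).taylorComp (p z) k) s := by
  unfold FormalMultilinearSeries.taylorComp
  refine ContDiffOn.sum fun c _ => ?_
  let B := c.compAlongOrderedFinpartitionL ℝ E F G
  have hB : ContDiff ℝ ∞ (fun z : (F [×c.length]→L[ℝ] G) ×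
      (∀ i, E [×c.partSize i]→L[ℝ] F) => B z.1 z.2) := by
    have := B.analyticOnNhd_uncurry_of_multilinear (s := univ)
    exact contDiffOn_univ.1 (this.contDiffOn uniqueDiffOn_univ)
  refine hB.comp_contDiffOn (f := fun z => (q z c.length, fun m => p z (c.partSize m))) ?_
  refine (hq _ c.length_le).prodMk (contDiffOn_pi.2 fun m => hp _ (c.partSize_le m))

theorem iteratedFDeriv_congr_of_eventuallyEq {f g : E → F} {a : E} (h : f =ᶠ[𝓝 a] g) (k : ℕ) :
    iteratedFDeriv ℝ k f a = iteratedFDeriv ℝ k g a :=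
  (h.iteratedFDeriv ℝ k).eq_of_nhds

theorem iteratedFDeriv_comp_congr {g g' : F → G} {f f' : E → F} {a : E} {q : ℕ}
    (hf : ContDiffAt ℝ ∞ f a) (hf' : ContDiffAt ℝ ∞ f' a) (hff : f a = f' a)
    (hg : ContDiffAt ℝ ∞ g (f a)) (hg' : ContDiffAt ℝ ∞ g' (f a))
    (h1 : ∀ k ≤ q, iteratedFDeriv ℝ k f a = iteratedFDeriv ℝ k f' a)
    (h2 : ∀ k ≤ q, iteratedFDeriv ℝ k g (f a) = iteratedFDeriv ℝ k g' (f a)) :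
    ∀ k ≤ q, iteratedFDeriv ℝ k (g ∘ f) a = iteratedFDeriv ℝ k (g' ∘ f') a := by
  intro k hk
  have hk' : (k : WithTop ℕ∞) ≤ (∞ : WithTop ℕ∞) := by exact_mod_cast le_top
  rw [iteratedFDeriv_comp hg hf hk', iteratedFDeriv_comp (hff ▸ hg') hf' hk']
  refine taylorComp_congr (fun i hi => ?_) (fun i hi => h1 i (hi.trans hk))
  have := h2 i (hi.trans hk)
  simp only [ftaylorSeries, ← hff]
  exact this

theorem fderiv_clm_comp_aux {A B : Type*} [NormedAddCommGroup A] [NormedSpace ℝ A]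
    [NormedAddCommGroup B] [NormedSpace ℝ B] (L : A →L[ℝ] B) {g : E → A} {x : E}
    (hg : DifferentiableAt ℝ g x) : fderiv ℝ (fun y => L (g y)) x = L.comp (fderiv ℝ g x) :=
  (L.hasFDerivAt.comp x hg.hasFDerivAt).fderiv

/-- Iterated derivatives are symmetric: invariance under transpositions of neighbours. -/
theorem iteratedFDeriv_swap {f : E → F} (n : ℕ) : ∀ (i : Fin n) {x : E},
    ContDiffAt ℝ (n + 1 : ℕ) f x →
    ∀ v : Fin (n + 1) → E, iteratedFDeriv ℝ (n + 1) f x (v ∘ Equiv.swap i.castSucc i.succ) =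
      iteratedFDeriv ℝ (n + 1) f x v := by
  induction n with
  | zero => intro i; exact i.elim0
  | succ n ih =>
    intro i x hf v
    rcases Fin.eq_zero_or_eq_succ i with rfl | ⟨j, rfl⟩
    · have hg : ContDiffAt ℝ 2 (iteratedFDeriv ℝ n f) x := by
        refine hf.iteratedFDeriv_right ?_
        exact_mod_cast (by omega : 2 + n ≤ n + 1 + 1)
      have hd : DifferentiableAt ℝ (fderiv ℝ (iteratedFDeriv ℝ n f)) x :=
        (hg.fderiv_right (m := 1) (by norm_num [one_add_one_eq_two])).differentiableAt one_ne_zero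
      have key : ∀ w : Fin (n + 2) → E, iteratedFDeriv ℝ (n + 2) f x w =
          fderiv ℝ (fderiv ℝ (iteratedFDeriv ℝ n f)) x (w 0) (w 1) (fun t => w t.succ.succ) := by
        intro w
        rw [iteratedFDeriv_succ_apply_left, iteratedFDeriv_succ_eq_comp_left]
        let L : (E →L[ℝ] (E [×n]→L[ℝ] F)) →L[ℝ] (E [×(n + 1)]→L[ℝ] F) :=
          (continuousMultilinearCurryLeftEquiv ℝ (fun _ : Fin (n + 1) => E)
            F).symm.toContinuousLinearEquiv.toContinuousLinearMap
        have h1 := fderiv_clm_comp_aux (A := E →L[ℝ] (E [×n]→L[ℝ] F))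
          (B := E [×(n + 1)]→L[ℝ] F) L hd
        have h2 := congrArg (fun L => L (w 0) (Fin.tail w)) h1
        exact h2
      have hsym : IsSymmSndFDerivAt ℝ (iteratedFDeriv ℝ n f) x :=
        hg.isSymmSndFDerivAt (by simp)
      have e0 : Equiv.swap (0 : Fin (n+1)).castSucc (0 : Fin (n+1)).succ 0 = (1 : Fin (n+2)) := by
        simp
      have e1 : Equiv.swap (0 : Fin (n+1)).castSucc (0 : Fin (n+1)).succ 1 = (0 : Fin (n+2)) := by
        simp
      have e2 : ∀ t : Fin n, Equiv.swap (0 : Fin (n+1)).castSucc (0 : Fin (n+1)).succ t.succ.succ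
          = t.succ.succ := fun t => by
        refine Equiv.swap_apply_of_ne_of_ne ?_ ?_
        · simp [Fin.ext_iff]
        · simp [Fin.ext_iff]
      rw [key, key]
      simp only [Function.comp_apply, e0, e1, e2]
      rw [hsym.eq]
    · have hd : DifferentiableAt ℝ (iteratedFDeriv ℝ (n + 1) f) x :=
        (hf.iteratedFDeriv_right (m := 1) (by exact_mod_cast (by omega))).differentiableAt
          one_ne_zero
      have e0 : Equiv.swap j.succ.castSucc j.succ.succ 0 = (0 : Fin (n+2)) :=
        Equiv.swap_apply_of_ne_of_ne (by simp [Fin.ext_iff]) (by simp [Fin.ext_iff])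
      have et : Fin.tail (v ∘ Equiv.swap j.succ.castSucc j.succ.succ) =
          Fin.tail v ∘ Equiv.swap j.castSucc j.succ := by
        funext t
        simp only [Function.comp_apply, Fin.tail]
        congr 1
        rw [← Fin.succ_castSucc]
        exact ((Fin.succ_injective (n+1)).swap_apply _ _ _)
      have main : ∀ w : Fin (n+1) → E, ∀ u : E,
          fderiv ℝ (iteratedFDeriv ℝ (n + 1) f) x u w =
          fderiv ℝ (fun y => iteratedFDeriv ℝ (n + 1) f y w) x u := by
        intro w u
        have := (ContinuousMultilinearMap.apply ℝ (fun _ : Fin (n+1) => E) F w).hasFDerivAt.comp x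
          hd.hasFDerivAt
        exact (congrArg (fun L => L u) this.fderiv).symm
      have hev : ∀ᶠ y in 𝓝 x, ContDiffAt ℝ (n + 1 : ℕ) f y :=
        (hf.of_le (by exact_mod_cast (by omega))).eventually (by simp)
      rw [iteratedFDeriv_succ_apply_left, iteratedFDeriv_succ_apply_left, et, main, main,
        Function.comp_apply, e0]
      have : (fun y => iteratedFDeriv ℝ (n + 1) f y (Fin.tail v ∘ Equiv.swap j.castSucc j.succ))
          =ᶠ[𝓝 x] fun y => iteratedFDeriv ℝ (n + 1) f y (Fin.tail v) := by
        filter_upwards [hev] with y hy using ih j hy _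
      rw [this.fderiv_eq]

theorem iteratedFDeriv_comp_perm {f : E → F} {n : ℕ} {x : E} (hf : ContDiffAt ℝ n f x)
    (σ : Equiv.Perm (Fin n)) (v : Fin n → E) :
    iteratedFDeriv ℝ n f x (v ∘ σ) = iteratedFDeriv ℝ n f x v := by
  cases n with
  | zero => exact congrArg _ (Subsingleton.elim _ _)
  | succ n =>
    have hσ : σ ∈ Submonoid.closure
        (Set.range fun i : Fin n ↦ Equiv.swap i.castSucc i.succ) := by
      rw [Equiv.Perm.mclosure_swap_castSucc_succ]; trivial
    induction hσ using Submonoid.closure_induction generalizing v with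
    | mem τ hτ => obtain ⟨i, rfl⟩ := hτ; exact iteratedFDeriv_swap n i hf v
    | one => rfl
    | mul τ τ' _ _ h h' =>
      have : v ∘ (τ * τ' : Equiv.Perm _) = (v ∘ τ) ∘ τ' := rfl
      rw [this, h', h]

theorem exists_smooth_of_taylor (q : ℕ) (a : E) (p : ∀ k, E [×k]→L[ℝ] F) [CompleteSpace F]
    (hp : ∀ k ≤ q, ∀ (σ : Equiv.Perm (Fin k)) (v : Fin k → E), p k (v ∘ σ) = p k v) :
    ∃ P : E → F, ContDiff ℝ ∞ P ∧ ∀ k ≤ q, iteratedFDeriv ℝ k P a = p k := by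
  let s : FormalMultilinearSeries ℝ E F := fun k =>
    if k ≤ q then ((k.factorial : ℝ)⁻¹) • p k else 0
  have hs : ∀ m, q + 1 ≤ m → s m = 0 := fun m hm => if_neg (by omega)
  have h := (s.hasFiniteFPowerSeriesOnBall_of_finite hs).comp_sub a
  rw [zero_add] at h
  refine ⟨fun z => s.sum (z - a), ?_, fun k hk => ?_⟩
  · have : AnalyticOnNhd ℝ (fun z => s.sum (z - a)) univ := by
      have := h.cpolynomialOn.analyticOnNhd
      simpa using this
    exact contDiffOn_univ.1 (this.contDiffOn uniqueDiffOn_univ)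
  · ext v
    rw [h.toHasFPowerSeriesOnBall.iteratedFDeriv_eq_sum_of_completeSpace]
    have hsk : s k = ((k.factorial : ℝ)⁻¹) • p k := if_pos hk
    have : ∀ σ : Equiv.Perm (Fin k), s k (fun i => v (σ i)) = ((k.factorial : ℝ)⁻¹) • p k v := by
      intro σ
      rw [hsk, _root_.smul_apply]
      exact congrArg _ (hp k hk σ v)
    simp only [this, Finset.sum_const, Finset.card_univ, Fintype.card_perm, Fintype.card_fin]
    rw [← Nat.cast_smul_eq_nsmul ℝ, smul_smul, mul_inv_cancel₀ (by positivity), one_smul]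

end Calculus

section Jets

variable (E : Type*) [NormedAddCommGroup E] [NormedSpace ℝ E]
  (X : Type*) [TopologicalSpace X] [ChartedSpace E X]

/-- A pointed map `X → X` which is a smooth local diffeomorphism near its base point. -/
structure PreJet where
  pt : X
  map : X → X
  isLocalDiffeomorphAt : IsLocalDiffeomorphAt 𝓘(ℝ, E) 𝓘(ℝ, E) ∞ map pt

variable {E X}

/-- The `k`-th derivative at `x` of `f`, read in the charts `φ` (at `x`) and `ψ` (at `f x`). -/
noncomputable def jetDeriv (φ ψ : OpenPartialHomeomorph X E) (f : X → X) (x : X) (k : ℕ) :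
    E [×k]→L[ℝ] E :=
  iteratedFDeriv ℝ k (ψ ∘ f ∘ φ.symm) (φ x)

variable (E X) in
/-- Equality of `q`-jets: same source, same target, same derivatives of order `≤ q` in charts.
By `Jet.mk_eq_mk_iff` below, any smooth charts may be used. -/
def jetSetoid (q : ℕ) : Setoid (PreJet E X) where
  r a b := a.pt = b.pt ∧ a.map a.pt = b.map b.pt ∧ ∀ k ≤ q,
    jetDeriv (chartAt E a.pt) (chartAt E (a.map a.pt)) a.map a.pt k =
      jetDeriv (chartAt E b.pt) (chartAt E (b.map b.pt)) b.map b.pt k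
  iseqv :=
    { refl := fun _ => ⟨rfl, rfl, fun _ _ => rfl⟩
      symm := fun h => ⟨h.1.symm, h.2.1.symm, fun k hk => (h.2.2 k hk).symm⟩
      trans := fun h h' => ⟨h.1.trans h'.1, h.2.1.trans h'.2.1,
        fun k hk => (h.2.2 k hk).trans (h'.2.2 k hk)⟩ }

variable (E X) in
/-- The full jet groupoid of order `q` (as a set): the `q`-jets of local diffeomorphisms of `X`. -/
def Jet (q : ℕ) : Type _ := Quotient (jetSetoid E X q)

section Charts

variable {φ φ' ψ ψ' χ : OpenPartialHomeomorph X E}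

theorem contDiffAt_chart (hφ : φ ∈ IsManifold.maximalAtlas 𝓘(ℝ, E) ∞ X)
    (hψ : ψ ∈ IsManifold.maximalAtlas 𝓘(ℝ, E) ∞ X) {f : X → X} {x : X}
    (hf : ContMDiffAt 𝓘(ℝ, E) 𝓘(ℝ, E) ∞ f x) (hx : x ∈ φ.source) (hy : f x ∈ ψ.source) :
    ContDiffAt ℝ ∞ (ψ ∘ f ∘ φ.symm) (φ x) := by
  rw [← contMDiffAt_iff_contDiffAt]
  have h1 : ContMDiffAt 𝓘(ℝ, E) 𝓘(ℝ, E) ∞ φ.symm (φ x) :=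
    contMDiffAt_symm_of_mem_maximalAtlas hφ (φ.map_source hx)
  have h2 : ContMDiffAt 𝓘(ℝ, E) 𝓘(ℝ, E) ∞ ψ (f x) := contMDiffAt_of_mem_maximalAtlas hψ hy
  refine ContMDiffAt.comp (I' := 𝓘(ℝ, E)) (φ x) (g := ψ) (f := f ∘ φ.symm) ?_ ?_
  · simpa [φ.left_inv hx] using h2
  · refine ContMDiffAt.comp (I' := 𝓘(ℝ, E)) (φ x) (g := f) (f := φ.symm) ?_ h1
    simpa [φ.left_inv hx] using hf

theorem contDiffAt_transition (hφ : φ ∈ IsManifold.maximalAtlas 𝓘(ℝ, E) ∞ X)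
    (hψ : ψ ∈ IsManifold.maximalAtlas 𝓘(ℝ, E) ∞ X) {x : X}
    (hx : x ∈ φ.source) (hy : x ∈ ψ.source) :
    ContDiffAt ℝ ∞ (ψ ∘ φ.symm) (φ x) :=
  contDiffAt_chart (f := id) hφ hψ contMDiffAt_id hx hy

theorem jetDeriv_comp (hφ : φ ∈ IsManifold.maximalAtlas 𝓘(ℝ, E) ∞ X)
    (hψ : ψ ∈ IsManifold.maximalAtlas 𝓘(ℝ, E) ∞ X) (hχ : χ ∈ IsManifold.maximalAtlas 𝓘(ℝ, E) ∞ X)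
    {f g : X → X} {x : X}
    (hf : ContMDiffAt 𝓘(ℝ, E) 𝓘(ℝ, E) ∞ f x) (hg : ContMDiffAt 𝓘(ℝ, E) 𝓘(ℝ, E) ∞ g (f x))
    (hx : x ∈ φ.source) (hy : f x ∈ ψ.source) (hz : g (f x) ∈ χ.source) (k : ℕ) :
    jetDeriv φ χ (g ∘ f) x k = FormalMultilinearSeries.taylorComp
      (fun j => jetDeriv ψ χ g (f x) j) (fun j => jetDeriv φ ψ f x j) k := by
  have hF := contDiffAt_chart hφ hψ hf hx hy
  have hG := contDiffAt_chart hψ hχ hg hy hz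
  have e : (ψ ∘ f ∘ φ.symm) (φ x) = ψ (f x) := by simp [φ.left_inv hx]
  have hev : χ ∘ (g ∘ f) ∘ φ.symm =ᶠ[𝓝 (φ x)] (χ ∘ g ∘ ψ.symm) ∘ (ψ ∘ f ∘ φ.symm) := by
    have h1 : Tendsto (f ∘ φ.symm) (𝓝 (φ x)) (𝓝 (f x)) :=
      hf.continuousAt.tendsto.comp (by
        have := φ.continuousAt_symm (φ.map_source hx)
        rwa [ContinuousAt, φ.left_inv hx] at this)
    filter_upwards [h1 (ψ.open_source.mem_nhds hy)] with z hz
    simp only [Function.comp_apply] at hz ⊢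
    rw [ψ.left_inv (show f (φ.symm z) ∈ ψ.source from hz)]
  unfold jetDeriv
  rw [iteratedFDeriv_congr_of_eventuallyEq hev,
    iteratedFDeriv_comp (e ▸ hG) hF (by exact_mod_cast le_top : ((k : ℕ∞) : WithTop ℕ∞) ≤ ∞), e]
  rfl

theorem jetDeriv_change (f : X → X) {x : X}
    (hφ : φ ∈ IsManifold.maximalAtlas 𝓘(ℝ, E) ∞ X) (hφ' : φ' ∈ IsManifold.maximalAtlas 𝓘(ℝ, E) ∞ X)
    (hψ : ψ ∈ IsManifold.maximalAtlas 𝓘(ℝ, E) ∞ X) (hψ' : ψ' ∈ IsManifold.maximalAtlas 𝓘(ℝ, E) ∞ X)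
    (hf : ContMDiffAt 𝓘(ℝ, E) 𝓘(ℝ, E) ∞ f x)
    (hx : x ∈ φ.source) (hx' : x ∈ φ'.source) (hy : f x ∈ ψ.source) (hy' : f x ∈ ψ'.source)
    (k : ℕ) :
    jetDeriv φ' ψ' f x k = FormalMultilinearSeries.taylorComp
      (FormalMultilinearSeries.taylorComp (ftaylorSeries ℝ (ψ' ∘ ψ.symm) (ψ (f x)))
        (fun j => jetDeriv φ ψ f x j)) (ftaylorSeries ℝ (φ ∘ φ'.symm) (φ' x)) k := by
  have h1 := jetDeriv_comp hφ' hφ hψ' (f := id) (g := f) contMDiffAt_id hf hx' hx hy' k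
  have h2 := fun j => jetDeriv_comp hφ hψ hψ' (f := f) (g := id) hf contMDiffAt_id hx hy hy' j
  have h2' : (fun j => jetDeriv φ ψ' f x j) = FormalMultilinearSeries.taylorComp
      (fun j => jetDeriv ψ ψ' id (f x) j) (fun j => jetDeriv φ ψ f x j) := funext h2
  calc jetDeriv φ' ψ' f x k = _ := h1
    _ = _ := by simp only [id]; rw [h2']; rfl

/-- A smooth map with injective differential at a point, between open pieces of charts. -/
theorem isLocalDiffeomorphAt_of_chart [FiniteDimensional ℝ E]
    (hφ : φ ∈ IsManifold.maximalAtlas 𝓘(ℝ, E) ∞ X)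
    (hψ : ψ ∈ IsManifold.maximalAtlas 𝓘(ℝ, E) ∞ X) {P : E → E} (hP : ContDiff ℝ ∞ P) {x : X}
    (hx : x ∈ φ.source) (hy : P (φ x) ∈ ψ.target)
    (hinj : ∀ v, fderiv ℝ P (φ x) v = 0 → v = 0) :
    IsLocalDiffeomorphAt 𝓘(ℝ, E) 𝓘(ℝ, E) ∞ (ψ.symm ∘ P ∘ φ) x := by
  have : CompleteSpace E := FiniteDimensional.complete ℝ E
  have h1 : IsLocalDiffeomorphAt 𝓘(ℝ, E) 𝓘(ℝ, E) ∞ φ x :=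
    ⟨{ toPartialEquiv := φ.toPartialEquiv
       open_source := φ.open_source
       open_target := φ.open_target
       contMDiffOn_toFun := contMDiffOn_of_mem_maximalAtlas hφ
       contMDiffOn_invFun := contMDiffOn_symm_of_mem_maximalAtlas hφ }, hx, fun _ _ => rfl⟩
  have h3 : IsLocalDiffeomorphAt 𝓘(ℝ, E) 𝓘(ℝ, E) ∞ ψ.symm (P (φ x)) :=
    ⟨{ toPartialEquiv := ψ.symm.toPartialEquiv
       open_source := ψ.open_target
       open_target := ψ.open_source
       contMDiffOn_toFun := contMDiffOn_symm_of_mem_maximalAtlas hψ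
       contMDiffOn_invFun := contMDiffOn_of_mem_maximalAtlas hψ }, hy, fun _ _ => rfl⟩
  have h2 : IsLocalDiffeomorphAt 𝓘(ℝ, E) 𝓘(ℝ, E) ∞ P (φ x) := by
    let S : Set (E →L[ℝ] E) := range ContinuousLinearEquiv.toContinuousLinearMap
    have hS : IsOpen S := ContinuousLinearEquiv.isOpen
    have hO : IsOpen {z | fderiv ℝ P z ∈ S} :=
      hS.preimage (hP.continuous_fderiv (by simp))
    have ha : fderiv ℝ P (φ x) ∈ S := by
      have hi : Function.Injective (fderiv ℝ P (φ x) : E →ₗ[ℝ] E) :=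
        (injective_iff_map_eq_zero _).2 hinj
      refine ⟨(LinearEquiv.ofInjectiveEndo _ hi).toContinuousLinearEquiv, ?_⟩
      ext v
      rfl
    obtain ⟨A, hA⟩ := ha
    have hd : ∀ z, HasFDerivAt P (fderiv ℝ P z) z := fun z =>
      (hP.differentiable (by simp) z).hasFDerivAt
    have hdA : HasFDerivAt P (A : E →L[ℝ] E) (φ x) := by rw [hA]; exact hd _
    let e := (hP.contDiffAt.toOpenPartialHomeomorph P hdA (by simp)).restrOpen _ hO
    have heP : (e : E → E) = P := rfl
    refine ⟨{ toPartialEquiv := e.toPartialEquiv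
              open_source := e.open_source
              open_target := e.open_target
              contMDiffOn_toFun := (contMDiff_iff_contDiff.2 hP).contMDiffOn
              contMDiffOn_invFun := ?_ }, ?_, fun _ _ => rfl⟩
    · refine contMDiffOn_iff_contDiffOn.2 fun y hy => ContDiffAt.contDiffWithinAt ?_
      have hs : e.symm y ∈ e.source := e.map_target hy
      obtain ⟨B, hB⟩ : fderiv ℝ P (e.symm y) ∈ S := hs.2
      refine e.contDiffAt_symm (f₀' := B) hy ?_ hP.contDiffAt
      rw [hB]; exact hd _
    · exact ⟨hP.contDiffAt.mem_toOpenPartialHomeomorph_source hdA (by simp), ⟨A, hA⟩⟩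
  exact (h1.comp _ _ h2).comp _ _ h3

theorem injective_fderiv_chart (hφ : φ ∈ IsManifold.maximalAtlas 𝓘(ℝ, E) ∞ X)
    (hψ : ψ ∈ IsManifold.maximalAtlas 𝓘(ℝ, E) ∞ X) {f : X → X} {x : X}
    (hf : IsLocalDiffeomorphAt 𝓘(ℝ, E) 𝓘(ℝ, E) ∞ f x) (hx : x ∈ φ.source) (hy : f x ∈ ψ.source)
    (v : E) (hv : fderiv ℝ (ψ ∘ f ∘ φ.symm) (φ x) v = 0) : v = 0 := by
  have hF := contDiffAt_chart hφ hψ hf.contMDiffAt hx hy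
  have hgx : hf.localInverse (f x) = x := hf.localInverse_left_inv hf.localInverse_mem_target
  have hG := contDiffAt_chart hψ hφ hf.localInverse_contMDiffAt hy (by rwa [hgx])
  have e : (ψ ∘ f ∘ φ.symm) (φ x) = ψ (f x) := by simp [φ.left_inv hx]
  have hev : (φ ∘ hf.localInverse ∘ ψ.symm) ∘ (ψ ∘ f ∘ φ.symm) =ᶠ[𝓝 (φ x)] id := by
    have h0 : Tendsto φ.symm (𝓝 (φ x)) (𝓝 x) := by
      have := φ.continuousAt_symm (φ.map_source hx)
      rwa [ContinuousAt, φ.left_inv hx] at this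
    have h1 : Tendsto (f ∘ φ.symm) (𝓝 (φ x)) (𝓝 (f x)) :=
      hf.contMDiffAt.continuousAt.tendsto.comp h0
    filter_upwards [h1 (ψ.open_source.mem_nhds hy), h0 hf.localInverse_eventuallyEq_left,
      φ.open_target.mem_nhds (φ.map_source hx)] with z hz hz' hz''
    simp only [Function.comp_apply, id]
    rw [ψ.left_inv (show f (φ.symm z) ∈ ψ.source from hz)]
    have : hf.localInverse (f (φ.symm z)) = φ.symm z := hz'
    rw [this, φ.right_inv hz'']
  have h1 := ((e.symm ▸ hG).differentiableAt (by simp)).hasFDerivAt.comp (φ x)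
    (hF.differentiableAt (by simp)).hasFDerivAt
  have h2 := h1.unique ((hasFDerivAt_id (𝕜 := ℝ) (φ x)).congr_of_eventuallyEq hev)
  have h3 := congrArg (fun L => L v) h2
  simp only [ContinuousLinearMap.comp_apply, hv, map_zero] at h3
  exact h3.symm

theorem jetDeriv_of_chart {P : E → E} (hP : Continuous P) {x : X}
    (hx : x ∈ φ.source) (hy : P (φ x) ∈ ψ.target) (k : ℕ) :
    jetDeriv φ ψ (ψ.symm ∘ P ∘ φ) x k = iteratedFDeriv ℝ k P (φ x) := by
  refine iteratedFDeriv_congr_of_eventuallyEq ?_ k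
  filter_upwards [φ.open_target.mem_nhds (φ.map_source hx),
    hP.continuousAt.preimage_mem_nhds (ψ.open_target.mem_nhds hy)] with z hz hz'
  simp only [Function.comp_apply, φ.right_inv hz]
  exact ψ.right_inv hz'

end Charts

section Model

variable (E) in
/-- Symmetric `k`-linear maps on `E` with values in `E`. -/
def symForms (k : ℕ) : Submodule ℝ (E [×k]→L[ℝ] E) where
  carrier := {m | ∀ (σ : Equiv.Perm (Fin k)) (v : Fin k → E), m (v ∘ σ) = m v}
  add_mem' := fun {a b} ha hb σ v => by
    simp only [add_apply, ha σ v, hb σ v]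
  zero_mem' := fun _ _ => rfl
  smul_mem' := fun c a ha σ v => by
    simp only [smul_apply, ha σ v]

variable (E) in
/-- The averaging operator over permutations of the arguments. -/
noncomputable def symAux (k : ℕ) : (E [×k]→L[ℝ] E) →L[ℝ] (E [×k]→L[ℝ] E) :=
  (k.factorial : ℝ)⁻¹ • ∑ σ : Equiv.Perm (Fin k),
    ((ContinuousMultilinearMap.domDomCongrₗᵢ ℝ E E σ).toContinuousLinearEquiv :
      (E [×k]→L[ℝ] E) →L[ℝ] (E [×k]→L[ℝ] E))

theorem symAux_apply (k : ℕ) (m : E [×k]→L[ℝ] E) (v : Fin k → E) :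
    symAux E k m v = (k.factorial : ℝ)⁻¹ • ∑ σ : Equiv.Perm (Fin k), m (v ∘ σ) := by
  simp only [symAux, smul_apply, _root_.sum_apply]
  rfl

variable (E) in
/-- Symmetrisation, a projection onto the symmetric multilinear maps. -/
noncomputable def symProj (k : ℕ) : (E [×k]→L[ℝ] E) →L[ℝ] symForms E k :=
  (symAux E k).codRestrict (symForms E k) (fun m τ v => by
    rw [symAux_apply, symAux_apply]
    congr 1
    exact Fintype.sum_equiv (Equiv.mulLeft τ) _ _ fun σ => rfl)

theorem contDiff_symProj (k : ℕ) : ContDiff ℝ ∞ (symProj E k) := by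
  fun_prop

theorem symProj_of_mem {k : ℕ} {m : E [×k]→L[ℝ] E} (hm : m ∈ symForms E k) :
    (symProj E k m : E [×k]→L[ℝ] E) = m := by
  ext v
  have h : ∀ σ : Equiv.Perm (Fin k), m (v ∘ σ) = m v := fun σ => hm σ v
  change symAux E k m v = m v
  rw [symAux_apply]
  simp only [h, Finset.sum_const, Finset.card_univ, Fintype.card_perm, Fintype.card_fin]
  rw [← Nat.cast_smul_eq_nsmul ℝ, smul_smul, inv_mul_cancel₀ (by positivity), one_smul]

variable (E) in
/-- The vector space of coordinates `(x, y, y_1, ..., y_q)` of `q`-jets of maps `E → E`: the source,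
and the derivatives of order `0, ..., q`, which are symmetric multilinear maps. -/
abbrev JetModel (q : ℕ) : Type _ := E × ((k : Fin (q + 1)) → symForms E k)

noncomputable instance (q : ℕ) : NormedAddCommGroup ((k : Fin (q + 1)) → symForms E k) :=
  Pi.normedAddCommGroup

noncomputable instance (q : ℕ) : NormedSpace ℝ ((k : Fin (q + 1)) → symForms E k) :=
  Pi.normedSpace

noncomputable instance (q : ℕ) : NormedAddCommGroup (JetModel E q) := Prod.normedAddCommGroup

noncomputable instance (q : ℕ) : NormedSpace ℝ (JetModel E q) := Prod.normedSpace

end Model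

namespace Jet

variable {q : ℕ}

def source (g : Jet E X q) : X :=
  Quotient.lift (s := jetSetoid E X q) (fun a => a.pt) (fun _ _ h => h.1) g

def target (g : Jet E X q) : X :=
  Quotient.lift (s := jetSetoid E X q) (fun a => a.map a.pt) (fun _ _ h => h.2.1) g

def mk (q : ℕ) (a : PreJet E X) : Jet E X q := Quotient.mk (jetSetoid E X q) a

noncomputable def rep (g : Jet E X q) : PreJet E X := Quotient.out g

theorem mk_rep (g : Jet E X q) : mk q g.rep = g := Quotient.out_eq g

theorem pt_rep (g : Jet E X q) : g.rep.pt = g.source :=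
  congrArg source (mk_rep g)

theorem map_rep (g : Jet E X q) : g.rep.map g.rep.pt = g.target :=
  congrArg target (mk_rep g)

section

variable [IsManifold 𝓘(ℝ, E) ∞ X] {φ ψ : OpenPartialHomeomorph X E}

/-- Equality of jets can be tested in arbitrary charts. -/
theorem mk_eq_mk_iff (hφ : φ ∈ IsManifold.maximalAtlas 𝓘(ℝ, E) ∞ X)
    (hψ : ψ ∈ IsManifold.maximalAtlas 𝓘(ℝ, E) ∞ X) {a b : PreJet E X}
    (hx : a.pt ∈ φ.source) (hy : a.map a.pt ∈ ψ.source) :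
    mk q a = mk q b ↔ a.pt = b.pt ∧ a.map a.pt = b.map b.pt ∧
      ∀ k ≤ q, jetDeriv φ ψ a.map a.pt k = jetDeriv φ ψ b.map b.pt k := by
  obtain ⟨x, f, hf⟩ := a
  obtain ⟨x', g, hg⟩ := b
  have key : mk q ⟨x, f, hf⟩ = mk q ⟨x', g, hg⟩ ↔ x = x' ∧ f x = g x' ∧ ∀ k ≤ q,
      jetDeriv (chartAt E x) (chartAt E (f x)) f x k =
      jetDeriv (chartAt E x') (chartAt E (g x')) g x' k := Quotient.eq (r := jetSetoid E X q)
  rw [key]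
  dsimp only at hx hy ⊢
  refine and_congr_right fun h1 => ?_
  subst h1
  refine and_congr_right fun h2 => ?_
  have hc := fun z : X => IsManifold.chart_mem_maximalAtlas (I := 𝓘(ℝ, E)) (n := ∞) z
  rw [← h2]
  constructor
  · intro h k hk
    rw [jetDeriv_change f (hc x) hφ (hc (f x)) hψ hf.contMDiffAt (mem_chart_source E x) hx
        (mem_chart_source E (f x)) hy k,
      jetDeriv_change g (hc x) hφ (hc (f x)) hψ hg.contMDiffAt (mem_chart_source E x) hx
        (h2 ▸ mem_chart_source E (f x)) (h2 ▸ hy) k, ← h2]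
    refine taylorComp_congr (fun i hi => taylorComp_congr (fun _ _ => rfl) fun j hj => ?_)
      fun _ _ => rfl
    exact h j ((hj.trans hi).trans hk)
  · intro h k hk
    rw [jetDeriv_change f hφ (hc x) hψ (hc (f x)) hf.contMDiffAt hx (mem_chart_source E x)
        hy (mem_chart_source E (f x)) k,
      jetDeriv_change g hφ (hc x) hψ (hc (f x)) hg.contMDiffAt hx (mem_chart_source E x)
        (h2 ▸ hy) (h2 ▸ mem_chart_source E (f x)) k, ← h2]
    refine taylorComp_congr (fun i hi => taylorComp_congr (fun _ _ => rfl) fun j hj => ?_)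
      fun _ _ => rfl
    exact h j ((hj.trans hi).trans hk)

end

/-! ### Charts -/

/-- Coordinates of a jet in charts `φ`, `ψ` of source and target: source and derivatives. On the
chart domain the derivatives are symmetric and `symProj` does nothing, see `coord_snd`. -/
noncomputable def coord (φ ψ : OpenPartialHomeomorph X E) (g : Jet E X q) : JetModel E q :=
  (φ g.source, fun k => symProj E k (jetDeriv φ ψ g.rep.map g.rep.pt k))

def chartSource (q : ℕ) (φ ψ : OpenPartialHomeomorph X E) : Set (Jet E X q) :=
  {g | g.source ∈ φ.source ∧ g.target ∈ ψ.source}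

/-- The image of the coordinates: the first derivative has to be invertible. -/
def chartTarget (q : ℕ) (φ ψ : OpenPartialHomeomorph X E) : Set (JetModel E q) :=
  {z | z.1 ∈ φ.target ∧ (z.2 0 : E [×((0 : Fin (q + 1)) : ℕ)]→L[ℝ] E) (fun _ => 0) ∈ ψ.target ∧
    ∀ k : Fin (q + 1), (k : ℕ) = 1 → ∀ v : E, (z.2 k : E [×(k : ℕ)]→L[ℝ] E) (fun _ => v) = 0 → v = 0}

section

variable [IsManifold 𝓘(ℝ, E) ∞ X] {φ ψ φ' ψ' : OpenPartialHomeomorph X E}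

theorem coord_snd (hφ : φ ∈ IsManifold.maximalAtlas 𝓘(ℝ, E) ∞ X)
    (hψ : ψ ∈ IsManifold.maximalAtlas 𝓘(ℝ, E) ∞ X) {a : PreJet E X}
    (hx : a.pt ∈ φ.source) (hy : a.map a.pt ∈ ψ.source) (k : Fin (q + 1)) :
    ((coord φ ψ (mk q a)).2 k : E [×(k : ℕ)]→L[ℝ] E) = jetDeriv φ ψ a.map a.pt k := by
  have h := ((mk_eq_mk_iff hφ hψ (q := q) (b := (mk q a).rep) hx hy).1 (mk_rep _).symm).2.2 k
    (Nat.lt_succ_iff.1 k.2)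
  change (symProj E k (jetDeriv φ ψ (mk q a).rep.map (mk q a).rep.pt k) : E [×(k : ℕ)]→L[ℝ] E) = _
  rw [← h]
  refine symProj_of_mem fun σ v => iteratedFDeriv_comp_perm ?_ σ v
  exact (contDiffAt_chart hφ hψ a.isLocalDiffeomorphAt.contMDiffAt hx hy).of_le
    (by exact_mod_cast le_top)

theorem bijOn_coord [FiniteDimensional ℝ E] (hφ : φ ∈ IsManifold.maximalAtlas 𝓘(ℝ, E) ∞ X)
    (hψ : ψ ∈ IsManifold.maximalAtlas 𝓘(ℝ, E) ∞ X) :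
    BijOn (coord φ ψ) (chartSource q φ ψ) (chartTarget q φ ψ) := by
  have : CompleteSpace E := FiniteDimensional.complete ℝ E
  refine ⟨?_, ?_, ?_⟩
  · intro g hg
    obtain ⟨a, rfl⟩ := Quotient.exists_rep g
    change mk q a ∈ _ at hg
    change coord φ ψ (mk q a) ∈ _
    have hx : a.pt ∈ φ.source := hg.1
    have hy : a.map a.pt ∈ ψ.source := hg.2
    refine ⟨φ.map_source hx, ?_, ?_⟩
    · rw [coord_snd hφ hψ hx hy]
      have : jetDeriv φ ψ a.map a.pt ((0 : Fin (q + 1)) : ℕ) (fun _ => 0) = ψ (a.map a.pt) := by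
        change (ψ ∘ a.map ∘ φ.symm) (φ a.pt) = _
        simp [φ.left_inv hx]
      rw [this]
      exact ψ.map_source hy
    · intro k hk v hv
      rw [coord_snd hφ hψ hx hy] at hv
      obtain ⟨k, hk'⟩ := k
      dsimp only at hk
      subst hk
      refine injective_fderiv_chart hφ hψ a.isLocalDiffeomorphAt hx hy v ?_
      exact (iteratedFDeriv_one_apply (𝕜 := ℝ) (fun _ : Fin 1 => v)).symm.trans hv
  · intro g hg g' hg' h
    obtain ⟨a, rfl⟩ := Quotient.exists_rep g
    obtain ⟨b, rfl⟩ := Quotient.exists_rep g'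
    change mk q a ∈ _ at hg
    change mk q b ∈ _ at hg'
    change coord φ ψ (mk q a) = coord φ ψ (mk q b) at h
    change mk q a = mk q b
    have hx : a.pt ∈ φ.source := hg.1
    have hy : a.map a.pt ∈ ψ.source := hg.2
    have hx' : b.pt ∈ φ.source := hg'.1
    have hy' : b.map b.pt ∈ ψ.source := hg'.2
    have hk : ∀ k : Fin (q + 1), jetDeriv φ ψ a.map a.pt k = jetDeriv φ ψ b.map b.pt k := by
      intro k
      rw [← coord_snd hφ hψ hx hy, ← coord_snd hφ hψ hx' hy', h]
    refine (mk_eq_mk_iff hφ hψ hx hy).2 ⟨φ.injOn hx hx' (congrArg Prod.fst h), ?_, fun k hkq =>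
      hk ⟨k, Nat.lt_succ_iff.2 hkq⟩⟩
    have h0 := congrArg (fun m => m (fun _ => 0)) (hk 0)
    change (ψ ∘ a.map ∘ φ.symm) (φ a.pt) = (ψ ∘ b.map ∘ φ.symm) (φ b.pt) at h0
    simp only [Function.comp_apply, φ.left_inv hx, φ.left_inv hx'] at h0
    exact ψ.injOn hy hy' h0
  · intro z hz
    obtain ⟨hz1, hz2, hz3⟩ := hz
    obtain ⟨P, hP, hPk, hinj⟩ : ∃ P : E → E, ContDiff ℝ ∞ P ∧
        (∀ k : Fin (q + 1), iteratedFDeriv ℝ k P z.1 = z.2 k) ∧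
        ∀ v, fderiv ℝ P z.1 v = 0 → v = 0 := by
      rcases Nat.eq_zero_or_pos q with rfl | hq
      · let b : E := (z.2 0 : E [×((0 : Fin (0 + 1)) : ℕ)]→L[ℝ] E) (fun _ => 0)
        refine ⟨fun y => b + (y - z.1), by fun_prop, fun k => ?_, fun v hv => ?_⟩
        · obtain rfl : k = 0 := Subsingleton.elim (α := Fin 1) _ _
          ext v
          change b + (z.1 - z.1) = _
          rw [sub_self, add_zero]
          exact congrArg _ (Subsingleton.elim (α := Fin 0 → E) _ _)
        · have : HasFDerivAt (fun y => b + (y - z.1)) (ContinuousLinearMap.id ℝ E) z.1 :=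
            ((hasFDerivAt_id z.1).sub_const z.1).const_add b
          rw [this.fderiv] at hv
          exact hv
      · let p : ∀ k, E [×k]→L[ℝ] E := fun k => if h : k < q + 1 then z.2 ⟨k, h⟩ else 0
        obtain ⟨P, hP, hPk⟩ := exists_smooth_of_taylor q z.1 p (by
          intro k hk σ v
          have : p k = z.2 ⟨k, Nat.lt_succ_iff.2 hk⟩ := dif_pos _
          rw [this]
          exact (z.2 ⟨k, Nat.lt_succ_iff.2 hk⟩).2 σ v)
        have hPk' : ∀ k : Fin (q + 1), iteratedFDeriv ℝ k P z.1 = z.2 k := fun k =>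
          (hPk k (Nat.lt_succ_iff.1 k.2)).trans (dif_pos k.2)
        refine ⟨P, hP, hPk', fun v hv => ?_⟩
        refine hz3 ⟨1, by omega⟩ rfl v ?_
        rw [← hPk']
        exact (iteratedFDeriv_one_apply _).trans hv
    have hx : φ.symm z.1 ∈ φ.source := φ.map_target hz1
    have hφz : φ (φ.symm z.1) = z.1 := φ.right_inv hz1
    have hPy : P (φ (φ.symm z.1)) ∈ ψ.target := by
      rw [hφz]
      have := hPk 0
      have h0 : P z.1 = (z.2 0 : E [×((0 : Fin (q + 1)) : ℕ)]→L[ℝ] E) (fun _ => 0) := by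
        rw [← this]; rfl
      rwa [h0]
    let a : PreJet E X := ⟨φ.symm z.1, ψ.symm ∘ P ∘ φ,
      isLocalDiffeomorphAt_of_chart hφ hψ hP hx hPy (by rwa [hφz])⟩
    have hay : a.map a.pt ∈ ψ.source := ψ.map_target hPy
    refine ⟨mk q a, ⟨hx, hay⟩, ?_⟩
    refine Prod.ext hφz (funext fun k => Subtype.ext ?_)
    rw [coord_snd hφ hψ hx hay]
    change jetDeriv φ ψ (ψ.symm ∘ P ∘ φ) (φ.symm z.1) k = _
    rw [jetDeriv_of_chart hP.continuous hx hPy, hφz, hPk]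

/-- The value `y` of a jet in coordinates. -/
noncomputable def value (z : JetModel E q) : E :=
  (z.2 0 : E [×((0 : Fin (q + 1)) : ℕ)]→L[ℝ] E) (fun _ => 0)

noncomputable def series (z : JetModel E q) : FormalMultilinearSeries ℝ E E :=
  fun j => if h : j < q + 1 then z.2 ⟨j, h⟩ else 0

theorem contDiff_form (k : Fin (q + 1)) : ContDiff ℝ ∞ (fun z : JetModel E q =>
    (z.2 k : E [×(k : ℕ)]→L[ℝ] E)) :=
  ((symForms E k).subtypeL.comp ((ContinuousLinearMap.proj (R := ℝ)
    (φ := fun k : Fin (q + 1) => symForms E k) k).comp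
      (ContinuousLinearMap.snd ℝ E ((k : Fin (q + 1)) → symForms E k)))).contDiff

theorem contDiff_value : ContDiff ℝ ∞ (value : JetModel E q → E) :=
  (ContinuousMultilinearMap.apply ℝ (fun _ : Fin ((0 : Fin (q + 1)) : ℕ) => E) E
    (fun _ => 0)).contDiff.comp (contDiff_form 0)

theorem contDiff_series (k : ℕ) : ContDiff ℝ ∞ (fun z : JetModel E q => series z k) := by
  by_cases h : k < q + 1
  · simp only [series, dif_pos h]
    exact contDiff_form ⟨k, h⟩
  · simp only [series, dif_neg h]
    exact contDiff_const

theorem isOpen_chartTarget [FiniteDimensional ℝ E] (φ ψ : OpenPartialHomeomorph X E) :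
    IsOpen (chartTarget q φ ψ) := by
  refine (φ.open_target.preimage continuous_fst).inter
    ((ψ.open_target.preimage contDiff_value.continuous).inter ?_)
  change IsOpen {z : JetModel E q | _}
  simp only [ofPred_forall]
  refine isOpen_iInter_of_finite fun k => ?_
  obtain ⟨k, hk⟩ := k
  by_cases h : k = 1
  · subst h
    simp only [iInter_true]
    have hc : Continuous (fun z : JetModel E q => continuousMultilinearCurryFin1 ℝ E E
        (z.2 ⟨1, hk⟩ : E [×1]→L[ℝ] E)) :=
      (continuousMultilinearCurryFin1 ℝ E E).continuous.comp (contDiff_form ⟨1, hk⟩).continuous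
    convert! (ContinuousLinearMap.isOpen_injective (𝕜 := ℝ) (E := E) (F := E)).preimage hc using 1
    ext z
    simp only [mem_iInter, mem_ofPred_eq, mem_preimage, injective_iff_map_eq_zero]
    rfl
  · simp [h]

/-- The coordinates as a bijection from the chart domain onto an open subset of the model. -/
noncomputable def chart [FiniteDimensional ℝ E] [Nonempty (Jet E X q)]
    (hφ : φ ∈ atlas E X) (hψ : ψ ∈ atlas E X) : PartialEquiv (Jet E X q) (JetModel E q) :=
  (bijOn_coord (IsManifold.subset_maximalAtlas hφ)
    (IsManifold.subset_maximalAtlas hψ)).toPartialEquiv (coord φ ψ) _ _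

variable (E X q) in
def chartAtlas [FiniteDimensional ℝ E] : Set (PartialEquiv (Jet E X q) (JetModel E q)) :=
  {e | ∃ (_ : Nonempty (Jet E X q)) (φ ψ : OpenPartialHomeomorph X E) (hφ : φ ∈ atlas E X)
    (hψ : ψ ∈ atlas E X), e = chart hφ hψ}

/-- Change of jet coordinates, by the formula for higher derivatives of compositions. -/
noncomputable def transition (φ ψ φ' ψ' : OpenPartialHomeomorph X E) (z : JetModel E q) :
    JetModel E q :=
  (φ' (φ.symm z.1), fun k => symProj E k (FormalMultilinearSeries.taylorComp
    (FormalMultilinearSeries.taylorComp (ftaylorSeries ℝ (ψ' ∘ ψ.symm) (value z)) (series z))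
    (ftaylorSeries ℝ (φ ∘ φ'.symm) (φ' (φ.symm z.1))) k))

def overlap (q : ℕ) (φ ψ φ' ψ' : OpenPartialHomeomorph X E) : Set (JetModel E q) :=
  chartTarget q φ ψ ∩
    {z | z.1 ∈ (φ.symm.trans φ').source ∧ value z ∈ (ψ.symm.trans ψ').source}

theorem isOpen_overlap [FiniteDimensional ℝ E] (φ ψ φ' ψ' : OpenPartialHomeomorph X E) :
    IsOpen (overlap q φ ψ φ' ψ') :=
  (isOpen_chartTarget φ ψ).inter (((φ.symm.trans φ').open_source.preimage continuous_fst).inter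
    ((ψ.symm.trans ψ').open_source.preimage contDiff_value.continuous))

theorem contDiffOn_ftaylorSeries {f : E → E} {s : Set E} (hf : ∀ y ∈ s, ContDiffAt ℝ ∞ f y)
    {g : JetModel E q → E} {t : Set (JetModel E q)} (hg : ContDiffOn ℝ ∞ g t) (hst : MapsTo g t s)
    (k : ℕ) : ContDiffOn ℝ ∞ (fun z => ftaylorSeries ℝ f (g z) k) t := by
  intro z hz
  have : ContDiffAt ℝ ∞ (iteratedFDeriv ℝ k f) (g z) :=
    (hf _ (hst hz)).iteratedFDeriv_right (by norm_cast)
  exact this.comp_contDiffWithinAt z (hg z hz)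

theorem contDiffOn_transition (hφ : φ ∈ IsManifold.maximalAtlas 𝓘(ℝ, E) ∞ X)
    (hψ : ψ ∈ IsManifold.maximalAtlas 𝓘(ℝ, E) ∞ X)
    (hφ' : φ' ∈ IsManifold.maximalAtlas 𝓘(ℝ, E) ∞ X)
    (hψ' : ψ' ∈ IsManifold.maximalAtlas 𝓘(ℝ, E) ∞ X) :
    ContDiffOn ℝ ∞ (transition (q := q) φ ψ φ' ψ') (overlap q φ ψ φ' ψ') := by
  have trans : ∀ {α β : OpenPartialHomeomorph X E}, α ∈ IsManifold.maximalAtlas 𝓘(ℝ, E) ∞ X →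
      β ∈ IsManifold.maximalAtlas 𝓘(ℝ, E) ∞ X → ∀ y ∈ (α.symm.trans β).source,
      ContDiffAt ℝ ∞ (β ∘ α.symm) y := by
    intro α β hα hβ y hy
    have := contDiffAt_transition hα hβ (α.map_target hy.1) hy.2
    rwa [α.right_inv hy.1] at this
  have h1 : ContDiffOn ℝ ∞ (fun z : JetModel E q => φ' (φ.symm z.1)) (overlap q φ ψ φ' ψ') :=
    fun z hz => (trans hφ hφ' z.1 hz.2.1).comp_contDiffWithinAt z contDiffWithinAt_fst
  refine h1.prodMk (contDiffOn_pi.2 fun k => ?_)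
  have hS : ContDiff ℝ ∞ (symProj E (k : ℕ)) := contDiff_symProj k
  refine hS.comp_contDiffOn ?_
  refine contDiffOn_taylorComp (fun i _ => ?_) (fun i _ => ?_)
  · refine contDiffOn_taylorComp (fun j _ => ?_) (fun j _ => (contDiff_series j).contDiffOn)
    exact contDiffOn_ftaylorSeries (trans hψ hψ') contDiff_value.contDiffOn
      (fun z hz => hz.2.2) j
  · refine contDiffOn_ftaylorSeries (trans hφ' hφ) h1 (fun z hz => ?_) i
    exact (φ.symm.trans φ').map_source hz.2.1

variable [FiniteDimensional ℝ E] [Nonempty (Jet E X q)]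

theorem source_target_chart_symm (hφ : φ ∈ atlas E X) (hψ : ψ ∈ atlas E X) {z : JetModel E q}
    (hz : z ∈ chartTarget q φ ψ) : ((chart hφ hψ).symm z).source = φ.symm z.1 ∧
      ((chart hφ hψ).symm z).target = ψ.symm (value z) := by
  have mφ := IsManifold.subset_maximalAtlas (I := 𝓘(ℝ, E)) (n := ∞) hφ
  have mψ := IsManifold.subset_maximalAtlas (I := 𝓘(ℝ, E)) (n := ∞) hψ
  have h1 : (chart (q := q) hφ hψ).symm z ∈ chartSource q φ ψ := (chart hφ hψ).map_target hz
  have h2 : coord φ ψ ((chart (q := q) hφ hψ).symm z) = z := (chart hφ hψ).right_inv hz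
  set g := (chart (q := q) hφ hψ).symm z with hg
  constructor
  · rw [← φ.left_inv h1.1]; exact congrArg (fun w => φ.symm w.1) h2
  · rw [← ψ.left_inv h1.2]
    congr 1
    have hx : g.rep.pt ∈ φ.source := by rw [pt_rep]; exact h1.1
    have hy : g.rep.map g.rep.pt ∈ ψ.source := by rw [map_rep]; exact h1.2
    have h3 := congrArg (fun m => m (fun _ => 0)) (coord_snd mφ mψ hx hy (0 : Fin (q + 1)) (q := q))
    rw [mk_rep, h2] at h3
    change value z = (ψ ∘ g.rep.map ∘ φ.symm) (φ g.rep.pt) at h3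
    rw [h3]
    simp [φ.left_inv hx, map_rep]

theorem chart_trans_source (hφ : φ ∈ atlas E X) (hψ : ψ ∈ atlas E X)
    (hφ' : φ' ∈ atlas E X) (hψ' : ψ' ∈ atlas E X) :
    ((chart (q := q) hφ hψ).symm.trans (chart hφ' hψ')).source = overlap q φ ψ φ' ψ' := by
  ext z
  change (z ∈ chartTarget q φ ψ ∧ (chart hφ hψ).symm z ∈ chartSource q φ' ψ') ↔ _
  refine and_congr_right fun hz => ?_
  have hz' : z ∈ (chart (q := q) hφ hψ).target := hz
  obtain ⟨h1, h2⟩ := source_target_chart_symm hφ hψ hz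
  have h3 := (chart (q := q) hφ hψ).map_target hz'
  change _ ∈ chartSource q φ ψ at h3
  simp only [chartSource, mem_ofPred_eq, h1, h2, OpenPartialHomeomorph.trans_source,
    OpenPartialHomeomorph.symm_source, mem_inter_iff, mem_preimage]
  exact ⟨fun h => ⟨⟨hz.1, h.1⟩, ⟨hz.2.1, h.2⟩⟩, fun h => ⟨h.1.2, h.2.2⟩⟩

theorem chart_trans_eqOn (hφ : φ ∈ atlas E X) (hψ : ψ ∈ atlas E X)
    (hφ' : φ' ∈ atlas E X) (hψ' : ψ' ∈ atlas E X) :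
    EqOn ((chart (q := q) hφ hψ).symm.trans (chart hφ' hψ')) (transition φ ψ φ' ψ')
      (overlap q φ ψ φ' ψ') := by
  intro z hz
  have mφ := IsManifold.subset_maximalAtlas (I := 𝓘(ℝ, E)) (n := ∞) hφ
  have mψ := IsManifold.subset_maximalAtlas (I := 𝓘(ℝ, E)) (n := ∞) hψ
  have mφ' := IsManifold.subset_maximalAtlas (I := 𝓘(ℝ, E)) (n := ∞) hφ'
  have mψ' := IsManifold.subset_maximalAtlas (I := 𝓘(ℝ, E)) (n := ∞) hψ'
  obtain ⟨h1, h2⟩ := source_target_chart_symm hφ hψ hz.1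
  have h3 : coord φ ψ ((chart (q := q) hφ hψ).symm z) = z :=
    (chart (q := q) hφ hψ).right_inv hz.1
  change coord φ' ψ' ((chart (q := q) hφ hψ).symm z) = _
  set g := (chart (q := q) hφ hψ).symm z with hg
  have hx : g.rep.pt ∈ φ.source := by rw [pt_rep, h1]; exact φ.map_target hz.1.1
  have hx' : g.rep.pt ∈ φ'.source := by rw [pt_rep, h1]; exact hz.2.1.2
  have hy : g.rep.map g.rep.pt ∈ ψ.source := by
    rw [map_rep, h2]; exact ψ.map_target hz.1.2.1
  have hy' : g.rep.map g.rep.pt ∈ ψ'.source := by rw [map_rep, h2]; exact hz.2.2.2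
  have hv : ψ (g.rep.map g.rep.pt) = value z := by
    rw [map_rep, h2]; exact ψ.right_inv hz.1.2.1
  have hxx : φ' g.rep.pt = φ' (φ.symm z.1) := by rw [pt_rep, h1]
  refine Prod.ext (congrArg φ' h1) (funext fun k => ?_)
  change symProj E k (jetDeriv φ' ψ' g.rep.map g.rep.pt k) = symProj E k _
  congr 1
  rw [jetDeriv_change g.rep.map mφ mφ' mψ mψ' g.rep.isLocalDiffeomorphAt.contMDiffAt hx hx' hy hy' k,
    hv, hxx]
  refine taylorComp_congr (fun i hi => taylorComp_congr (fun _ _ => rfl) fun j hj => ?_)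
    fun _ _ => rfl
  have hjq : j < q + 1 := lt_of_le_of_lt (hj.trans hi) k.2
  have := coord_snd mφ mψ hx hy ⟨j, hjq⟩ (q := q)
  rw [mk_rep, h3] at this
  rw [← this, series, dif_pos hjq]

end

section Manifold

variable [IsManifold 𝓘(ℝ, E) ∞ X] [FiniteDimensional ℝ E]

variable (E X q) in
/-- The charts of the jet manifold. -/
noncomputable def chartedSpaceCore : ChartedSpaceCore (JetModel E q) (Jet E X q) where
  atlas := chartAtlas E X q
  chartAt g := have : Nonempty (Jet E X q) := ⟨g⟩
    chart (chart_mem_atlas E g.source) (chart_mem_atlas E g.target)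
  mem_chart_source g := ⟨mem_chart_source E g.source, mem_chart_source E g.target⟩
  chart_mem_atlas g := ⟨⟨g⟩, _, _, _, _, rfl⟩
  open_source := by
    rintro _ _ ⟨_, φ, ψ, hφ, hψ, rfl⟩ ⟨_, φ', ψ', hφ', hψ', rfl⟩
    rw [chart_trans_source]
    exact isOpen_overlap φ ψ φ' ψ'
  continuousOn_toFun := by
    rintro _ _ ⟨_, φ, ψ, hφ, hψ, rfl⟩ ⟨_, φ', ψ', hφ', hψ', rfl⟩
    rw [chart_trans_source]
    exact (contDiffOn_transition (IsManifold.subset_maximalAtlas hφ)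
      (IsManifold.subset_maximalAtlas hψ) (IsManifold.subset_maximalAtlas hφ')
      (IsManifold.subset_maximalAtlas hψ')).continuousOn.congr (chart_trans_eqOn hφ hψ hφ' hψ')

noncomputable instance : TopologicalSpace (Jet E X q) :=
  (chartedSpaceCore E X q).toTopologicalSpace

noncomputable instance : ChartedSpace (JetModel E q) (Jet E X q) :=
  (chartedSpaceCore E X q).toChartedSpace

instance : IsManifold 𝓘(ℝ, JetModel E q) ∞ (Jet E X q) := by
  refine isManifold_of_contDiffOn _ _ _ fun e e' he he' => ?_
  obtain ⟨f, hf⟩ := mem_iUnion.1 he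
  obtain ⟨⟨_, φ, ψ, hφ, hψ, rfl⟩, rfl⟩ := mem_iUnion.1 hf
  obtain ⟨f', hf'⟩ := mem_iUnion.1 he'
  obtain ⟨⟨_, φ', ψ', hφ', hψ', rfl⟩, rfl⟩ := mem_iUnion.1 hf'
  have hs := chart_trans_source (q := q) hφ hψ hφ' hψ'
  have hc := (contDiffOn_transition (q := q) (IsManifold.subset_maximalAtlas hφ)
    (IsManifold.subset_maximalAtlas hψ) (IsManifold.subset_maximalAtlas hφ')
    (IsManifold.subset_maximalAtlas hψ')).congr (chart_trans_eqOn hφ hψ hφ' hψ')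
  rw [← hs] at hc
  have : (𝓘(ℝ, JetModel E q).symm ⁻¹'
      ((chart (q := q) hφ hψ).symm.trans (chart hφ' hψ')).source ∩ range 𝓘(ℝ, JetModel E q)) =
      ((chart (q := q) hφ hψ).symm.trans (chart hφ' hψ')).source := by
    simp
  rw [← this] at hc
  exact hc

end Manifold

/-! ### Groupoid operations -/

section Operations

variable [IsManifold 𝓘(ℝ, E) ∞ X]

variable (E q) in
/-- The unit at `x`. -/
def unit (x : X) : Jet E X q :=
  mk q ⟨x, id, ⟨(Diffeomorph.refl 𝓘(ℝ, E) X ∞).toPartialDiffeomorph, trivial, fun _ _ => rfl⟩⟩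

open Classical in
/-- The product `g h`, for `source g = target h`: the jet of `(rep of g) ∘ (rep of h)`. -/
noncomputable def comp (g h : Jet E X q) : Jet E X q :=
  if H : g.source = h.target then
    mk q ⟨h.rep.pt, g.rep.map ∘ h.rep.map, h.rep.isLocalDiffeomorphAt.comp _ _ (by
      rw [map_rep, ← H, ← pt_rep]; exact g.rep.isLocalDiffeomorphAt)⟩
  else g

/-- The inverse of `g`: the jet of a local inverse. -/
noncomputable def inv (g : Jet E X q) : Jet E X q :=
  mk q ⟨g.rep.map g.rep.pt, g.rep.isLocalDiffeomorphAt.localInverse,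
    g.rep.isLocalDiffeomorphAt.localInverse_isLocalDiffeomorphAt⟩

theorem mk_eq_mk_iff_chartAt {a b : PreJet E X} :
    mk q a = mk q b ↔ a.pt = b.pt ∧ a.map a.pt = b.map b.pt ∧ ∀ k ≤ q,
      jetDeriv (chartAt E a.pt) (chartAt E (a.map a.pt)) a.map a.pt k =
        jetDeriv (chartAt E a.pt) (chartAt E (a.map a.pt)) b.map b.pt k :=
  mk_eq_mk_iff (IsManifold.chart_mem_maximalAtlas a.pt) (IsManifold.chart_mem_maximalAtlas _)
    (mem_chart_source E _) (mem_chart_source E _)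

theorem mk_eq_of_eventuallyEq {x : X} {f g : X → X} (h : f =ᶠ[𝓝 x] g)
    (hf : IsLocalDiffeomorphAt 𝓘(ℝ, E) 𝓘(ℝ, E) ∞ f x)
    (hg : IsLocalDiffeomorphAt 𝓘(ℝ, E) 𝓘(ℝ, E) ∞ g x) :
    mk q ⟨x, f, hf⟩ = mk q ⟨x, g, hg⟩ := by
  refine mk_eq_mk_iff_chartAt.2 ⟨rfl, h.eq_of_nhds, fun k _ => ?_⟩
  refine iteratedFDeriv_congr_of_eventuallyEq ?_ k
  have h0 : Tendsto (chartAt E x).symm (𝓝 (chartAt E x x)) (𝓝 x) := by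
    have := (chartAt E x).continuousAt_symm ((chartAt E x).map_source (mem_chart_source E x))
    rwa [ContinuousAt, (chartAt E x).left_inv (mem_chart_source E x)] at this
  filter_upwards [h0 h] with z hz
  exact congrArg (chartAt E (f x)) hz

theorem mk_comp_congr {a a' b b' : PreJet E X} (h : a.pt = b.map b.pt) (ha : mk q a = mk q a')
    (hb : mk q b = mk q b') (hab : IsLocalDiffeomorphAt 𝓘(ℝ, E) 𝓘(ℝ, E) ∞ (a.map ∘ b.map) b.pt)
    (hab' : IsLocalDiffeomorphAt 𝓘(ℝ, E) 𝓘(ℝ, E) ∞ (a'.map ∘ b'.map) b'.pt) :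
    mk q ⟨b.pt, a.map ∘ b.map, hab⟩ = mk q ⟨b'.pt, a'.map ∘ b'.map, hab'⟩ := by
  obtain ⟨h1, h2, h3⟩ := mk_eq_mk_iff_chartAt.1 ha
  obtain ⟨k1, k2, k3⟩ := mk_eq_mk_iff_chartAt.1 hb
  obtain ⟨x, f, hf⟩ := b
  obtain ⟨x', f', hf'⟩ := b'
  obtain ⟨y, g, hg⟩ := a
  obtain ⟨y', g', hg'⟩ := a'
  dsimp only at *
  subst k1 h1 h
  refine mk_eq_mk_iff_chartAt.2 ⟨rfl, by simp only [Function.comp_apply, ← k2, h2], fun k hk => ?_⟩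
  have hc := fun z : X => IsManifold.chart_mem_maximalAtlas (I := 𝓘(ℝ, E)) (n := ∞) z
  have hs := fun z : X => mem_chart_source E z
  change jetDeriv (chartAt E x) (chartAt E (g (f x))) _ x k =
    jetDeriv (chartAt E x) (chartAt E (g (f x))) _ x k
  rw [jetDeriv_comp (hc x) (hc (f x)) (hc (g (f x))) hf.contMDiffAt hg.contMDiffAt (hs _) (hs _)
      (hs _),
    jetDeriv_comp (hc x) (hc (f x)) (hc (g (f x))) hf'.contMDiffAt (k2 ▸ hg'.contMDiffAt) (hs _)
      (k2 ▸ hs _) (by rw [← k2, ← h2]; exact hs _)]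
  refine taylorComp_congr (fun i hi => ?_) (fun i hi => k3 i (hi.trans hk))
  rw [← k2]
  exact h3 i (hi.trans hk)

/-- The product does not depend on the choice of representatives. -/
theorem comp_mk {a b : PreJet E X} (h : a.pt = b.map b.pt)
    (hab : IsLocalDiffeomorphAt 𝓘(ℝ, E) 𝓘(ℝ, E) ∞ (a.map ∘ b.map) b.pt) :
    comp (mk q a) (mk q b) = mk q ⟨b.pt, a.map ∘ b.map, hab⟩ := by
  have H : (mk q a).source = (mk q b).target := h
  rw [comp, dif_pos H]
  exact mk_comp_congr (by rw [map_rep, pt_rep, H]) (mk_rep _) (mk_rep _) _ _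

/-- The inverse does not depend on the choice of a representative. -/
theorem inv_mk {a b : PreJet E X} (h : b.pt = a.map a.pt) (h' : b.map b.pt = a.pt)
    (hab : a.map ∘ b.map =ᶠ[𝓝 b.pt] id) : inv (mk q a) = mk q b := by
  obtain ⟨y, g, hg⟩ := b
  dsimp only at h h' hab
  subst h
  set r := (mk q a).rep with hr
  have hra : mk q r = mk q a := mk_rep _
  obtain ⟨h1, h2, -⟩ := mk_eq_mk_iff_chartAt.1 hra
  have hG := r.isLocalDiffeomorphAt.localInverse_isLocalDiffeomorphAt
  set G := r.isLocalDiffeomorphAt.localInverse with hGdef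
  have hag : IsLocalDiffeomorphAt 𝓘(ℝ, E) 𝓘(ℝ, E) ∞ (a.map ∘ g) (a.map a.pt) :=
    hg.comp _ _ (h'.symm ▸ a.isLocalDiffeomorphAt)
  have hrg : IsLocalDiffeomorphAt 𝓘(ℝ, E) 𝓘(ℝ, E) ∞ (r.map ∘ g) (a.map a.pt) :=
    hg.comp _ _ (by rw [h', ← h1]; exact r.isLocalDiffeomorphAt)
  have e0 : mk q ⟨a.map a.pt, a.map ∘ g, hag⟩ = mk q ⟨a.map a.pt, r.map ∘ g, hrg⟩ :=
    mk_comp_congr (a := a) (a' := r) (b := ⟨_, g, hg⟩) (b' := ⟨_, g, hg⟩) h'.symm hra.symm rfl _ _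
  have hGa : IsLocalDiffeomorphAt 𝓘(ℝ, E) 𝓘(ℝ, E) ∞ G (a.map a.pt) := h2 ▸ hG
  have hag' : (a.map ∘ g) (a.map a.pt) = a.map a.pt := hab.eq_of_nhds
  have hrg' : (r.map ∘ g) (a.map a.pt) = a.map a.pt := by
    change r.map (g (a.map a.pt)) = a.map a.pt
    rw [h', ← h2, h1]
  have e1 : mk q ⟨a.map a.pt, G ∘ (a.map ∘ g), hag.comp _ _ (hag'.symm ▸ hGa)⟩ =
      mk q ⟨a.map a.pt, G ∘ (r.map ∘ g), hrg.comp _ _ (hrg'.symm ▸ hGa)⟩ :=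
    mk_comp_congr (a := ⟨_, G, hGa⟩) (a' := ⟨_, G, hGa⟩) (b := ⟨_, _, hag⟩) (b' := ⟨_, _, hrg⟩)
      hag'.symm rfl e0 _ _
  have e2 : inv (mk q a) = mk q ⟨a.map a.pt, G, hGa⟩ := by
    change mk q ⟨r.map r.pt, G, hG⟩ = _
    congr 2
  rw [e2]
  calc mk q ⟨a.map a.pt, G, hGa⟩ = _ := mk_eq_of_eventuallyEq ?_ _ _
    _ = _ := e1
    _ = _ := mk_eq_of_eventuallyEq ?_ _ _
  · filter_upwards [hab] with z hz
    exact congrArg G hz.symm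
  · have ht : Tendsto g (𝓝 (a.map a.pt)) (𝓝 r.pt) := by
      have := hg.contMDiffAt.continuousAt
      rw [ContinuousAt, h'] at this
      rwa [h1]
    filter_upwards [ht r.isLocalDiffeomorphAt.localInverse_eventuallyEq_left] with z hz
    exact hz

end Operations

end Jet

end Jets

/-! ### Fibre bundles, jet groupoids, natural bundles -/

section Bundles

variable {E : Type*} [NormedAddCommGroup E] [NormedSpace ℝ E]
  {X : Type*} [TopologicalSpace X] [ChartedSpace E X]

/-- The subset `S` of the manifold `M` is a smooth fibre bundle over `X` with projection `p`:
it is locally diffeomorphic, over open sets `U` of `X`, to `U × Φ` for a manifold `Φ`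
(the typical fibre). Smoothness on `S ∩ p ⁻¹' U` is smoothness in the ambient manifold `M`.
Since the inverse trivialisations `U × Φ → M` are smooth and have smooth left inverses on their
images, they are embeddings; so such an `S` is in particular an embedded submanifold of `M`.
For `S = univ` this says that `p : M → X` is a smooth fibre bundle; in general it says that `S`
is a subbundle. -/
def IsSmoothBundle {V : Type*} [NormedAddCommGroup V] [NormedSpace ℝ V] {M : Type w}
    [TopologicalSpace M] [ChartedSpace V M] (S : Set M) (p : M → X) : Prop :=
  ∃ (d : ℕ) (Φ : Type w) (_ : TopologicalSpace Φ)
    (_ : ChartedSpace (EuclideanSpace ℝ (Fin d)) Φ)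
    (_ : IsManifold 𝓘(ℝ, EuclideanSpace ℝ (Fin d)) ∞ Φ) (_ : T2Space Φ)
    (_ : SecondCountableTopology Φ), ∀ x : X, ∃ (U : Set X) (e : PartialEquiv M (X × Φ)),
      IsOpen U ∧ x ∈ U ∧ e.source = S ∩ p ⁻¹' U ∧ e.target = U ×ˢ univ ∧
      (∀ u ∈ e.source, (e u).1 = p u) ∧
      ContMDiffOn 𝓘(ℝ, V) (𝓘(ℝ, E).prod 𝓘(ℝ, EuclideanSpace ℝ (Fin d))) ∞ e e.source ∧
      ContMDiffOn (𝓘(ℝ, E).prod 𝓘(ℝ, EuclideanSpace ℝ (Fin d))) 𝓘(ℝ, V) ∞ e.symm e.target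

/-- `f` restricts to a smooth submersion on the submanifold `S` of `M`: it is smooth on `S`, and
through every point of `S` there is a smooth local section of `f` with values in `S`. -/
def IsSubmersionOn {V W : Type*} [NormedAddCommGroup V] [NormedSpace ℝ V] [NormedAddCommGroup W]
    [NormedSpace ℝ W] {H : Type*} [TopologicalSpace H] (I : ModelWithCorners ℝ V H)
    {M N : Type*} [TopologicalSpace M] [ChartedSpace H M]
    [TopologicalSpace N] [ChartedSpace W N] (f : M → N) (S : Set M) : Prop :=
  ContMDiffOn I 𝓘(ℝ, W) ∞ f S ∧
    ∀ z ∈ S, ∃ (O : Set N) (σ : N → M), IsOpen O ∧ f z ∈ O ∧ ContMDiffOn 𝓘(ℝ, W) I ∞ σ O ∧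
      MapsTo σ O S ∧ σ (f z) = z ∧ ∀ u ∈ O, f (σ u) = u

variable [FiniteDimensional ℝ E] [IsManifold 𝓘(ℝ, E) ∞ X] {q : ℕ}

/-- A jet groupoid: a subbundle (over `X`, via the source) of the full jet groupoid which is closed
under all groupoid operations. -/
structure IsJetGroupoid (R : Set (Jet E X q)) : Prop where
  isSmoothBundle : IsSmoothBundle (E := E) (V := JetModel E q) R (Jet.source : Jet E X q → X)
  unit_mem : ∀ x : X, Jet.unit E q x ∈ R
  comp_mem : ∀ g ∈ R, ∀ h ∈ R, g.source = h.target → g.comp h ∈ R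
  inv_mem : ∀ g ∈ R, g.inv ∈ R

/-- Any two points are joined by an element of `R`. -/
def IsTransitive (R : Set (Jet E X q)) : Prop :=
  ∀ x y : X, ∃ g ∈ R, g.source = x ∧ g.target = y

variable (E X q) in
/-- A natural bundle of order `q` over `X` with total space the manifold `F`: a smooth fibre bundle
with a smooth right action of the full jet groupoid of order `q`. The value `act u g` is
meaningful for `proj u = target g` only; smoothness is smoothness on the fibre product. -/
structure NaturalBundle (m : ℕ) (F : Type*) [TopologicalSpace F]
    [ChartedSpace (EuclideanSpace ℝ (Fin m)) F] where
  proj : F → X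
  contMDiff_proj : ContMDiff 𝓘(ℝ, EuclideanSpace ℝ (Fin m)) 𝓘(ℝ, E) ∞ proj
  isSmoothBundle : IsSmoothBundle (E := E) (V := EuclideanSpace ℝ (Fin m)) univ proj
  act : F → Jet E X q → F
  contMDiffOn_act : ContMDiffOn
    (𝓘(ℝ, EuclideanSpace ℝ (Fin m)).prod 𝓘(ℝ, JetModel E q)) 𝓘(ℝ, EuclideanSpace ℝ (Fin m)) ∞
    (fun z : F × Jet E X q => act z.1 z.2) {z | proj z.1 = z.2.target}
  proj_act : ∀ u g, proj u = g.target → proj (act u g) = g.source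
  act_comp : ∀ u g h, proj u = g.target → g.source = h.target →
    act u (g.comp h) = act (act u g) h
  act_unit : ∀ u, act u (Jet.unit E q (proj u)) = u

/-- The isotropy group of the full jet groupoid at `y₀`; it is a copy of the jet group `GL_q`. -/
def Isotropy (q : ℕ) (y₀ : X) : Type _ := {h : Jet E X q // h.source = y₀ ∧ h.target = y₀}

/-- The principal bundle `P_q` of all jets with target `y₀`. -/
def Principal (q : ℕ) (y₀ : X) : Type _ := {p : Jet E X q // p.target = y₀}

/-- The homogeneous space of cosets `G h` in the isotropy group at `y₀` modulo the isotropy group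
`G` of `R` at `y₀`. The isotropy group acts on it from the right. -/
def CosetSpace (R : Set (Jet E X q)) (y₀ : X) : Type _ :=
  Quot fun h h' : Isotropy (E := E) q y₀ =>
    ∃ r ∈ R, r.source = y₀ ∧ r.target = y₀ ∧ h'.1 = r.comp h.1

/-- The bundle associated to `P_q` with fibre the homogeneous space `CosetSpace R y₀`:
the quotient of the product by the relations `(p, v) ∼ (c p, v c⁻¹)`, where `v = [h' c]` and
`v c⁻¹ = [h']`. -/
def AssociatedBundle (R : Set (Jet E X q)) (y₀ : X) : Type _ :=
  Quot fun a b : Principal (E := E) q y₀ × CosetSpace R y₀ =>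
    ∃ c h h' : Isotropy (E := E) q y₀, h.1 = h'.1.comp c.1 ∧ a.2 = Quot.mk _ h ∧
      b.1.1 = c.1.comp a.1.1 ∧ b.2 = Quot.mk _ h'

namespace NaturalBundle

variable {m : ℕ} {F : Type*} [TopologicalSpace F] [ChartedSpace (EuclideanSpace ℝ (Fin m)) F]
  (B : NaturalBundle E X q m F)

/-- The fibres are homogeneous under the isotropy groups of the full jet groupoid. -/
def IsHomogeneous : Prop :=
  ∀ u v : F, B.proj u = B.proj v →
    ∃ g : Jet E X q, g.source = B.proj u ∧ g.target = B.proj u ∧ B.act u g = v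

/-- Smooth sections of `B`, the geometric objects. -/
def IsSection (ξ : X → F) : Prop :=
  ContMDiff 𝓘(ℝ, E) 𝓘(ℝ, EuclideanSpace ℝ (Fin m)) ∞ ξ ∧ ∀ x, B.proj (ξ x) = x

/-- The symmetry groupoid of `ξ`. -/
def stab (ξ : X → F) : Set (Jet E X q) :=
  {g | B.act (ξ g.target) g = ξ g.source}

/-- `B` is isomorphic, as a natural bundle, to the associated bundle: there is an equivariant
bijection over `X`, which is a diffeomorphism for the quotient manifold structure on the associated
bundle, i.e. the induced map from the product of `P_q` and the isotropy group to `F`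
is a submersion. -/
def IsAssociated (R : Set (Jet E X q)) (y₀ : X) : Prop :=
  ∃ (e : AssociatedBundle R y₀ ≃ F) (θ : Jet E X q × Jet E X q → F),
    (∀ (p : Principal (E := E) q y₀) (h : Isotropy (E := E) q y₀),
      θ (p.1, h.1) = e (Quot.mk _ (p, Quot.mk _ h))) ∧
    IsSubmersionOn (W := EuclideanSpace ℝ (Fin m)) (𝓘(ℝ, JetModel E q).prod 𝓘(ℝ, JetModel E q)) θ
      {z | z.1.target = y₀ ∧ z.2.source = y₀ ∧ z.2.target = y₀} ∧
    (∀ (p : Principal (E := E) q y₀) (v : CosetSpace R y₀),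
      B.proj (e (Quot.mk _ (p, v))) = p.1.source) ∧
    ∀ (p p' : Principal (E := E) q y₀) (v : CosetSpace R y₀) (g : Jet E X q),
      p.1.source = g.target → p'.1 = p.1.comp g →
        B.act (e (Quot.mk _ (p, v))) g = e (Quot.mk _ (p', v))

end NaturalBundle

end Bundles

end JetGpd

set_option linter.unusedSectionVars false

/-! Both halves hold for transitive Lie groupoids in which smooth local families of arrows with
prescribed source and target pass through every arrow (`LieGpd`). The jets form one (`jetLieGpd`):
the higher chain rule makes products smooth in jet coordinates, and the derivatives of an inverse
function `H` of `F` come recursively from `DH = (DF ∘ H)⁻¹`.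

Stabilisers. The central fact is `IsHomogeneous.exists_orbit_section`: for a homogeneous action, the
orbit map `p ↦ u₀ p` on the arrows with target `π(u₀)` has a smooth local section through every
point. This map is onto the total space `F`, and translations by local bisections make it look the
same everywhere. At a point of maximal rank it factors through a space whose dimension is the rank.
Were this less than `dim F`, second countability would cover an open set of `F` by countably many
images of smaller Hausdorff dimension. So the rank is full somewhere, a local section exists there,
and bisections move it everywhere. Composed with a section `ω`, these local sections become smooth
families of arrows of `Stab(ω)` from a variable point to a fixed one; right multiplication by them
trivialises `Stab(ω)` over `X`. They also yield a smooth retraction of a neighbourhood of a unit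
onto `Stab(ω) ∩ s⁻¹(x₀)`. The image of a retraction is a submanifold, and left translations spread
this from the unit over the whole fibre.

Converse. Let `F` be the set of jets modulo left multiplication by `R`, acted on by right
multiplication, and let `ω₀(x) = [1_x]`. Then `ω₀(t g) g = [g]` equals `[1_{s g}]` exactly when `g ∈
R`, so the stabiliser is `R`; transitivity of `R` makes the fibres homogeneous. Charts of `F` are
slices transverse to the classes (`exists_hasCrossSection`): a small slice meets each class at most
once because `R` is embedded in the jets. Hausdorffness of `F` follows from the orbit sections,
local triviality from acting by smooth families of arrows. Finally `[p, [h]] ↦ [h p]` identifies the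
associated bundle with `F`, since every class has a representative with target `y₀`. -/

namespace JetGpd

namespace Jet

/-! ### Groupoid laws for jets. -/

section Algebra

variable {E : Type*} [NormedAddCommGroup E] [NormedSpace ℝ E]
  {X : Type*} [TopologicalSpace X] [ChartedSpace E X] [IsManifold 𝓘(ℝ, E) ∞ X] {q : ℕ}

@[simp] theorem source_mk (a : PreJet E X) : (mk q a).source = a.pt := rfl

@[simp] theorem target_mk (a : PreJet E X) : (mk q a).target = a.map a.pt := rfl

@[simp] theorem source_unit (x : X) : (unit E q x).source = x := rfl

@[simp] theorem target_unit (x : X) : (unit E q x).target = x := rfl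

@[simp] theorem source_inv (g : Jet E X q) : g.inv.source = g.target := g.map_rep

@[simp] theorem target_inv (g : Jet E X q) : g.inv.target = g.source := by
  have h := g.rep.isLocalDiffeomorphAt
  exact (h.localInverse_left_inv h.localInverse_mem_target).trans g.pt_rep

theorem source_comp {g h : Jet E X q} (H : g.source = h.target) :
    (g.comp h).source = h.source := by
  rw [comp, dif_pos H]; exact h.pt_rep

theorem target_comp {g h : Jet E X q} (H : g.source = h.target) :
    (g.comp h).target = g.target := by
  rw [comp, dif_pos H]
  change g.rep.map (h.rep.map h.rep.pt) = _
  rw [map_rep, ← H, ← pt_rep, map_rep]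

theorem comp_assoc {f g h : Jet E X q} (H : f.source = g.target) (H' : g.source = h.target) :
    (f.comp g).comp h = f.comp (g.comp h) := by
  obtain ⟨a, rfl⟩ : ∃ a, mk q a = f := ⟨_, f.mk_rep⟩
  obtain ⟨b, rfl⟩ : ∃ a, mk q a = g := ⟨_, g.mk_rep⟩
  obtain ⟨c, rfl⟩ : ∃ a, mk q a = h := ⟨_, h.mk_rep⟩
  simp only [source_mk, target_mk] at H H'
  have hab : IsLocalDiffeomorphAt 𝓘(ℝ, E) 𝓘(ℝ, E) ∞ (a.map ∘ b.map) b.pt :=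
    b.isLocalDiffeomorphAt.comp _ _ (H ▸ a.isLocalDiffeomorphAt)
  have hbc : IsLocalDiffeomorphAt 𝓘(ℝ, E) 𝓘(ℝ, E) ∞ (b.map ∘ c.map) c.pt :=
    c.isLocalDiffeomorphAt.comp _ _ (H' ▸ b.isLocalDiffeomorphAt)
  have habc : IsLocalDiffeomorphAt 𝓘(ℝ, E) 𝓘(ℝ, E) ∞ (a.map ∘ (b.map ∘ c.map)) c.pt :=
    hbc.comp _ _ (by rw [Function.comp_apply, ← H', ← H]; exact a.isLocalDiffeomorphAt)
  rw [comp_mk H hab, comp_mk H' hbc]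
  refine (comp_mk (a := ⟨_, _, hab⟩) H' habc).trans (comp_mk (b := ⟨_, _, hbc⟩) ?_ habc).symm
  rw [H, H']; rfl

theorem comp_unit (g : Jet E X q) : g.comp (unit E q g.source) = g := by
  obtain ⟨a, rfl⟩ : ∃ a, mk q a = g := ⟨_, g.mk_rep⟩
  exact comp_mk (b := ⟨a.pt, id, _⟩) rfl a.isLocalDiffeomorphAt

theorem unit_comp (g : Jet E X q) : (unit E q g.target).comp g = g := by
  obtain ⟨a, rfl⟩ : ∃ a, mk q a = g := ⟨_, g.mk_rep⟩
  exact comp_mk (a := ⟨a.map a.pt, id, _⟩) rfl a.isLocalDiffeomorphAt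

theorem inv_comp (g : Jet E X q) : g.inv.comp g = unit E q g.source := by
  have h := g.rep.isLocalDiffeomorphAt
  have hG := h.localInverse_isLocalDiffeomorphAt
  have hab : IsLocalDiffeomorphAt 𝓘(ℝ, E) 𝓘(ℝ, E) ∞ (h.localInverse ∘ g.rep.map) g.rep.pt :=
    h.comp _ _ hG
  have h1 := comp_mk (q := q) (a := ⟨_, _, hG⟩) (b := g.rep) rfl hab
  rw [mk_rep] at h1
  refine h1.trans ?_
  rw [← pt_rep]
  exact mk_eq_of_eventuallyEq h.localInverse_eventuallyEq_left _ _

theorem comp_inv (g : Jet E X q) : g.comp g.inv = unit E q g.target := by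
  have h := g.rep.isLocalDiffeomorphAt
  have hG := h.localInverse_isLocalDiffeomorphAt
  have e : h.localInverse (g.rep.map g.rep.pt) = g.rep.pt :=
    h.localInverse_left_inv h.localInverse_mem_target
  have hab : IsLocalDiffeomorphAt 𝓘(ℝ, E) 𝓘(ℝ, E) ∞ (g.rep.map ∘ h.localInverse)
      (g.rep.map g.rep.pt) := hG.comp _ _ (by rw [e]; exact h)
  have h1 := comp_mk (q := q) (a := g.rep) (b := ⟨_, _, hG⟩) e.symm hab
  rw [mk_rep] at h1
  refine h1.trans ?_
  rw [← map_rep]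
  exact mk_eq_of_eventuallyEq h.localInverse_eventuallyEq_right _ _

/-- In charts, the translation carrying `x` to `y` has identity differential, hence is a local
diffeomorphism. -/
theorem exists_source_target [FiniteDimensional ℝ E] (q : ℕ) (x y : X) :
    ∃ g : Jet E X q, g.source = x ∧ g.target = y := by
  have hc := fun z : X => IsManifold.chart_mem_maximalAtlas (I := 𝓘(ℝ, E)) (n := ∞) z
  let P : E → E := fun z => z + (chartAt E y y - chartAt E x x)
  have hP : ContDiff ℝ ∞ P := by fun_prop
  have e : P (chartAt E x x) = chartAt E y y := by simp [P]
  have hd : HasFDerivAt P (ContinuousLinearMap.id ℝ E) (chartAt E x x) :=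
    (hasFDerivAt_id _).add_const _
  refine ⟨mk q ⟨x, _, isLocalDiffeomorphAt_of_chart (hc x) (hc y) hP (mem_chart_source E x)
    (by rw [e]; exact mem_chart_target E y) (fun v hv => ?_)⟩, rfl, ?_⟩
  · rwa [hd.fderiv] at hv
  · change (chartAt E y).symm (P (chartAt E x x)) = y
    rw [e]
    exact (chartAt E y).left_inv (mem_chart_source E y)

end Algebra

end Jet

end JetGpd

/-! ### Smoothness of source, target, units and products of jets. -/

namespace JetGpd

namespace Jet

/-- The pair of maps has to be read in the model of the vector space `V × W`, where `f` is smooth,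
rather than in the product of two models; `prodMk_space` does this. -/
theorem _root_.ContDiff.comp_contMDiffOn₂ {E' H' M V W Z : Type*} [NormedAddCommGroup E']
    [NormedSpace ℝ E'] [TopologicalSpace H'] {I : ModelWithCorners ℝ E' H'} [TopologicalSpace M]
    [ChartedSpace H' M] [NormedAddCommGroup V] [NormedSpace ℝ V] [NormedAddCommGroup W]
    [NormedSpace ℝ W] [NormedAddCommGroup Z] [NormedSpace ℝ Z] {f : V × W → Z}
    (hf : ContDiff ℝ ∞ f) {a : M → V} {b : M → W} {s : Set M} (ha : ContMDiffOn I 𝓘(ℝ, V) ∞ a s)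
    (hb : ContMDiffOn I 𝓘(ℝ, W) ∞ b s) : ContMDiffOn I 𝓘(ℝ, Z) ∞ (fun z => f (a z, b z)) s :=
  hf.contMDiff.comp_contMDiffOn (ha.prodMk_space hb)

section Smooth

variable {E : Type*} [NormedAddCommGroup E] [NormedSpace ℝ E]
  {X : Type*} [TopologicalSpace X] [ChartedSpace E X] [IsManifold 𝓘(ℝ, E) ∞ X] {q : ℕ}
  {φ ψ χ : OpenPartialHomeomorph X E}

theorem series_coord (hφ : φ ∈ IsManifold.maximalAtlas 𝓘(ℝ, E) ∞ X)
    (hψ : ψ ∈ IsManifold.maximalAtlas 𝓘(ℝ, E) ∞ X) {a : PreJet E X}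
    (hx : a.pt ∈ φ.source) (hy : a.map a.pt ∈ ψ.source) {j : ℕ} (hj : j ≤ q) :
    series (coord φ ψ (mk q a)) j = jetDeriv φ ψ a.map a.pt j := by
  rw [series, dif_pos (Nat.lt_succ_iff.2 hj)]
  exact coord_snd hφ hψ hx hy ⟨j, Nat.lt_succ_iff.2 hj⟩

theorem value_coord (hφ : φ ∈ IsManifold.maximalAtlas 𝓘(ℝ, E) ∞ X)
    (hψ : ψ ∈ IsManifold.maximalAtlas 𝓘(ℝ, E) ∞ X) {g : Jet E X q}
    (hg : g ∈ chartSource q φ ψ) : value (coord φ ψ g) = ψ g.target := by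
  obtain ⟨a, rfl⟩ : ∃ a, mk q a = g := ⟨_, g.mk_rep⟩
  have h := congrArg (fun m => m (fun _ => 0))
    (coord_snd hφ hψ hg.1 hg.2 (0 : Fin (q + 1)) (q := q))
  refine h.trans ?_
  change (ψ ∘ a.map ∘ φ.symm) (φ a.pt) = _
  have hx : a.pt ∈ φ.source := hg.1
  simp [φ.left_inv hx]

/-- The composition of jets in coordinates. -/
noncomputable def coordComp (z w : JetModel E q) : JetModel E q :=
  (w.1, fun k => symProj E k ((series z).taylorComp (series w) k))

/-- By the higher chain rule, order `k ≤ q` of a composite involves only orders at most `k` of the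
factors, so it is harmless that `series` vanishes beyond order `q`. The result is symmetric already,
so `symProj` leaves it unchanged. -/
theorem coord_comp (hφ : φ ∈ IsManifold.maximalAtlas 𝓘(ℝ, E) ∞ X)
    (hψ : ψ ∈ IsManifold.maximalAtlas 𝓘(ℝ, E) ∞ X)
    (hχ : χ ∈ IsManifold.maximalAtlas 𝓘(ℝ, E) ∞ X) {g h : Jet E X q}
    (H : g.source = h.target) (hg : g ∈ chartSource q ψ χ) (hh : h ∈ chartSource q φ ψ) :
    coord φ χ (g.comp h) = coordComp (coord ψ χ g) (coord φ ψ h) := by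
  obtain ⟨a, rfl⟩ : ∃ a, mk q a = g := ⟨_, g.mk_rep⟩
  obtain ⟨b, rfl⟩ : ∃ a, mk q a = h := ⟨_, h.mk_rep⟩
  have H' : a.pt = b.map b.pt := H
  have ha : IsLocalDiffeomorphAt 𝓘(ℝ, E) 𝓘(ℝ, E) ∞ a.map (b.map b.pt) :=
    H' ▸ a.isLocalDiffeomorphAt
  have hab := b.isLocalDiffeomorphAt.comp _ _ ha
  have hz : a.map (b.map b.pt) ∈ χ.source := H' ▸ hg.2
  rw [comp_mk H' hab]
  refine Prod.ext rfl (funext fun k => ?_)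
  have h1 := coord_snd (q := q) hφ hχ (a := ⟨b.pt, a.map ∘ b.map, hab⟩) hh.1 hz k
  have h2 := symProj_of_mem (coord φ χ (mk q ⟨b.pt, a.map ∘ b.map, hab⟩) |>.2 k).2
  refine (Subtype.ext h2.symm).trans ?_
  change symProj E k _ = symProj E k _
  rw [h1, jetDeriv_comp hφ hψ hχ b.isLocalDiffeomorphAt.contMDiffAt ha.contMDiffAt hh.1 hh.2 hz k]
  refine congrArg _ (taylorComp_congr (fun i hi => ?_) (fun i hi => ?_))
  · rw [series_coord hψ hχ hg.1 hg.2 (hi.trans (Nat.lt_succ_iff.1 k.2)), H']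
  · rw [series_coord hφ hψ hh.1 hh.2 (hi.trans (Nat.lt_succ_iff.1 k.2))]

theorem contDiff_coordComp : ContDiff ℝ ∞
    (fun z : JetModel E q × JetModel E q => coordComp z.1 z.2) := by
  refine ContDiff.prodMk (contDiff_fst.comp contDiff_snd) (contDiff_pi.2 fun k => ?_)
  refine (contDiff_symProj (k : ℕ)).comp (contDiffOn_univ.1 (contDiffOn_taylorComp
    (q := fun z : JetModel E q × JetModel E q => series z.1) (p := fun z => series z.2)
    (fun i _ => ?_) (fun i _ => ?_)))
  · exact ((contDiff_series (E := E) (q := q) i).comp contDiff_fst).contDiffOn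
  · exact ((contDiff_series (E := E) (q := q) i).comp contDiff_snd).contDiffOn

variable [FiniteDimensional ℝ E]

/-- The preferred chart at a jet depends only on its source and target. Some jet runs from `x` to
`y`, so its chart can be indexed by the pair `x`, `y` instead, with all its properties bundled. -/
theorem exists_ofCoord (q : ℕ) (x y : X) : ∃ σ : JetModel E q → Jet E X q,
    ContMDiffOn 𝓘(ℝ, JetModel E q) 𝓘(ℝ, JetModel E q) ∞ σ
      (chartTarget q (chartAt E x) (chartAt E y)) ∧
    ContMDiffOn 𝓘(ℝ, JetModel E q) 𝓘(ℝ, JetModel E q) ∞ (coord (chartAt E x) (chartAt E y))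
      (chartSource q (chartAt E x) (chartAt E y)) ∧
    IsOpen (chartSource q (chartAt E x) (chartAt E y)) ∧
    MapsTo σ (chartTarget q (chartAt E x) (chartAt E y))
      (chartSource q (chartAt E x) (chartAt E y)) ∧
    (∀ z ∈ chartTarget q (chartAt E x) (chartAt E y),
      coord (chartAt E x) (chartAt E y) (σ z) = z) ∧
    ∀ g ∈ chartSource q (chartAt E x) (chartAt E y),
      σ (coord (chartAt E x) (chartAt E y) g) = g := by
  obtain ⟨g, rfl, rfl⟩ := exists_source_target (E := E) q x y
  let c := chartAt (JetModel E q) g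
  exact ⟨c.symm, contMDiffOn_chart_symm (x := g), contMDiffOn_chart (x := g), c.open_source,
    fun z hz => c.map_target hz, fun z hz => c.right_inv hz, fun z hz => c.left_inv hz⟩

/-- The jet with given coordinates in the preferred charts at `x` and `y`. -/
noncomputable def ofCoord (x y : X) : JetModel E q → Jet E X q := (exists_ofCoord q x y).choose

theorem contMDiffOn_ofCoord (x y : X) :
    ContMDiffOn 𝓘(ℝ, JetModel E q) 𝓘(ℝ, JetModel E q) ∞ (ofCoord x y)
      (chartTarget q (chartAt E x) (chartAt E y)) :=
  (exists_ofCoord q x y).choose_spec.1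

theorem contMDiffOn_coord (x y : X) :
    ContMDiffOn 𝓘(ℝ, JetModel E q) 𝓘(ℝ, JetModel E q) ∞ (coord (chartAt E x) (chartAt E y))
      (chartSource q (chartAt E x) (chartAt E y)) :=
  (exists_ofCoord q x y).choose_spec.2.1

theorem isOpen_chartSource (x y : X) :
    IsOpen (chartSource q (chartAt E x) (chartAt E y)) :=
  (exists_ofCoord q x y).choose_spec.2.2.1

theorem mapsTo_ofCoord (x y : X) : MapsTo (ofCoord x y)
    (chartTarget q (chartAt E x) (chartAt E y)) (chartSource q (chartAt E x) (chartAt E y)) :=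
  (exists_ofCoord q x y).choose_spec.2.2.2.1

theorem coord_ofCoord {x y : X} {z : JetModel E q}
    (hz : z ∈ chartTarget q (chartAt E x) (chartAt E y)) :
    coord (chartAt E x) (chartAt E y) (ofCoord x y z) = z :=
  (exists_ofCoord q x y).choose_spec.2.2.2.2.1 z hz

theorem ofCoord_coord {x y : X} {g : Jet E X q}
    (hg : g ∈ chartSource q (chartAt E x) (chartAt E y)) :
    ofCoord x y (coord (chartAt E x) (chartAt E y) g) = g :=
  (exists_ofCoord q x y).choose_spec.2.2.2.2.2 g hg

theorem chart_mem (x : X) : chartAt E x ∈ IsManifold.maximalAtlas 𝓘(ℝ, E) ∞ X :=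
  IsManifold.chart_mem_maximalAtlas x

theorem mapsTo_coord (x y : X) : MapsTo (coord (chartAt E x) (chartAt E y))
    (chartSource q (chartAt E x) (chartAt E y)) (chartTarget q (chartAt E x) (chartAt E y)) :=
  (bijOn_coord (chart_mem x) (chart_mem y)).mapsTo

theorem mem_chartSource (g : Jet E X q) :
    g ∈ chartSource q (chartAt E g.source) (chartAt E g.target) :=
  ⟨mem_chart_source E _, mem_chart_source E _⟩

theorem chartSource_mem_nhds (g : Jet E X q) :
    chartSource q (chartAt E g.source) (chartAt E g.target) ∈ 𝓝 g :=
  (isOpen_chartSource _ _).mem_nhds g.mem_chartSource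

theorem source_ofCoord {x y : X} {z : JetModel E q}
    (hz : z ∈ chartTarget q (chartAt E x) (chartAt E y)) :
    (ofCoord x y z).source = (chartAt E x).symm z.1 := by
  conv_rhs => rw [← coord_ofCoord hz]
  exact ((chartAt E x).left_inv (mapsTo_ofCoord x y hz).1).symm

theorem target_ofCoord {x y : X} {z : JetModel E q}
    (hz : z ∈ chartTarget q (chartAt E x) (chartAt E y)) :
    (ofCoord x y z).target = (chartAt E y).symm (value z) := by
  conv_rhs => rw [← coord_ofCoord hz]
  rw [value_coord (chart_mem x) (chart_mem y) (mapsTo_ofCoord x y hz)]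
  exact ((chartAt E y).left_inv (mapsTo_ofCoord x y hz).2).symm

theorem contMDiff_source :
    ContMDiff 𝓘(ℝ, JetModel E q) 𝓘(ℝ, E) ∞ (source : Jet E X q → X) := by
  intro g
  have h1 : ContMDiffOn 𝓘(ℝ, JetModel E q) 𝓘(ℝ, E) ∞
      (fun h : Jet E X q => (coord (chartAt E g.source) (chartAt E g.target) h).1) _ :=
    contDiff_fst.contMDiff.comp_contMDiffOn (contMDiffOn_coord (E := E) (q := q) g.source g.target)
  have h2 : ContMDiffOn 𝓘(ℝ, JetModel E q) 𝓘(ℝ, E) ∞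
      (fun h : Jet E X q => (chartAt E g.source).symm
        (coord (chartAt E g.source) (chartAt E g.target) h).1) _ :=
    (contMDiffOn_chart_symm (x := g.source)).comp h1 fun h hh => (mapsTo_coord _ _ hh).1
  refine (h2.contMDiffAt g.chartSource_mem_nhds).congr_of_eventuallyEq ?_
  filter_upwards [g.chartSource_mem_nhds] with h hh
  exact ((chartAt E g.source).left_inv hh.1).symm

theorem contMDiff_target :
    ContMDiff 𝓘(ℝ, JetModel E q) 𝓘(ℝ, E) ∞ (target : Jet E X q → X) := by
  intro g
  have h1 : ContMDiffOn 𝓘(ℝ, JetModel E q) 𝓘(ℝ, E) ∞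
      (fun h : Jet E X q => value (coord (chartAt E g.source) (chartAt E g.target) h)) _ :=
    (contDiff_value (E := E) (q := q)).contMDiff.comp_contMDiffOn (contMDiffOn_coord (E := E) (q := q) g.source g.target)
  have h2 : ContMDiffOn 𝓘(ℝ, JetModel E q) 𝓘(ℝ, E) ∞
      (fun h : Jet E X q => (chartAt E g.target).symm
        (value (coord (chartAt E g.source) (chartAt E g.target) h))) _ :=
    (contMDiffOn_chart_symm (x := g.target)).comp h1 fun h hh => (mapsTo_coord _ _ hh).2.1
  refine (h2.contMDiffAt g.chartSource_mem_nhds).congr_of_eventuallyEq ?_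
  filter_upwards [g.chartSource_mem_nhds] with h hh
  rw [value_coord (chart_mem _) (chart_mem _) hh]
  exact ((chartAt E g.target).left_inv hh.2).symm

theorem continuous_source : Continuous (source : Jet E X q → X) := contMDiff_source.continuous

theorem continuous_target : Continuous (target : Jet E X q → X) := contMDiff_target.continuous

theorem contMDiff_unit : ContMDiff 𝓘(ℝ, E) 𝓘(ℝ, JetModel E q) ∞ (unit E q : X → Jet E X q) := by
  intro x
  -- The coordinates of a unit are the derivatives of the identity of `E`, since both charts agree.
  let u : E → JetModel E q := fun z => (z, fun k => symProj E k (iteratedFDeriv ℝ k id z))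
  have hu : ContDiff ℝ ∞ u := by
    refine contDiff_id.prodMk (contDiff_pi.2 fun k => (contDiff_symProj (k : ℕ)).comp ?_)
    exact contDiff_id.iteratedFDeriv_right (m := ∞) (by norm_cast)
  have key : ∀ y ∈ (chartAt E x).source,
      coord (chartAt E x) (chartAt E x) (unit E q y) = u (chartAt E x y) := by
    intro y hy
    refine Prod.ext rfl (funext fun k => Subtype.ext ?_)
    have h1 := coord_snd (q := q) (chart_mem x) (chart_mem x) (a := (⟨y, id, (unit E q y :
      Jet E X q) |> fun _ => ⟨(Diffeomorph.refl 𝓘(ℝ, E) X ∞).toPartialDiffeomorph, trivial,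
        fun _ _ => rfl⟩⟩ : PreJet E X)) hy hy k
    refine h1.trans ?_
    have h2 : iteratedFDeriv ℝ k id (chartAt E x y) ∈ symForms E k := fun σ v =>
      iteratedFDeriv_comp_perm contDiff_id.contDiffAt σ v
    change _ = (symProj E k (iteratedFDeriv ℝ k id (chartAt E x y)) : E [×(k : ℕ)]→L[ℝ] E)
    rw [symProj_of_mem h2]
    refine iteratedFDeriv_congr_of_eventuallyEq ?_ k
    filter_upwards [(chartAt E x).open_target.mem_nhds ((chartAt E x).map_source hy)] with z hz
    exact (chartAt E x).right_inv hz
  have h1 : ContMDiffOn 𝓘(ℝ, E) 𝓘(ℝ, JetModel E q) ∞ (fun y => u (chartAt E x y))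
      (chartAt E x).source := hu.contMDiff.comp_contMDiffOn (contMDiffOn_chart (x := x))
  have hm : ∀ y ∈ (chartAt E x).source, (unit E q y : Jet E X q) ∈
    chartSource q (chartAt E x) (chartAt E x) := fun y hy => ⟨hy, hy⟩
  have h2 := (contMDiffOn_ofCoord (E := E) (q := q) x x).comp h1 fun y hy => by
    have := mapsTo_coord x x (hm y hy)
    rw [key y hy] at this
    exact this
  have hn := (chartAt E x).open_source.mem_nhds (mem_chart_source E x)
  refine (h2.contMDiffAt hn).congr_of_eventuallyEq ?_
  filter_upwards [hn] with y hy
  rw [Function.comp_apply, ← key y hy, ofCoord_coord (hm y hy)]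

theorem contMDiffOn_comp : ContMDiffOn (𝓘(ℝ, JetModel E q).prod 𝓘(ℝ, JetModel E q))
    𝓘(ℝ, JetModel E q) ∞ (fun z : Jet E X q × Jet E X q => z.1.comp z.2)
    {z | z.1.source = z.2.target} := by
  rintro ⟨g, h⟩ (H : g.source = h.target)
  let A := chartSource q (chartAt E h.target) (chartAt E g.target)
  let B := chartSource q (chartAt E h.source) (chartAt E h.target)
  have hA : IsOpen A := isOpen_chartSource _ _
  have hB : IsOpen B := isOpen_chartSource _ _
  let S : Set (Jet E X q × Jet E X q) := {z | z.1.source = z.2.target}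
  have hgA : g ∈ A := ⟨by rw [H]; exact mem_chart_source E _, mem_chart_source E _⟩
  have hgB : h ∈ B := h.mem_chartSource
  have hn : A ×ˢ B ∈ 𝓝 (g, h) := (hA.prod hB).mem_nhds ⟨hgA, hgB⟩
  have h2 : ContMDiffOn (𝓘(ℝ, JetModel E q).prod 𝓘(ℝ, JetModel E q)) 𝓘(ℝ, JetModel E q) ∞
      (fun z : Jet E X q × Jet E X q => coordComp
        (coord (chartAt E h.target) (chartAt E g.target) z.1)
        (coord (chartAt E h.source) (chartAt E h.target) z.2)) (A ×ˢ B) :=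
    (contDiff_coordComp (E := E) (q := q)).comp_contMDiffOn₂
      ((contMDiffOn_coord (E := E) (q := q) _ _).comp contMDiffOn_fst fun z hz => hz.1)
      ((contMDiffOn_coord (E := E) (q := q) _ _).comp contMDiffOn_snd fun z hz => hz.2)
  have key : ∀ z ∈ S ∩ A ×ˢ B, coord (chartAt E h.source) (chartAt E g.target) (z.1.comp z.2) =
      coordComp (coord (chartAt E h.target) (chartAt E g.target) z.1)
        (coord (chartAt E h.source) (chartAt E h.target) z.2) :=
    fun z hz => coord_comp (chart_mem _) (chart_mem _) (chart_mem _) hz.1 hz.2.1 hz.2.2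
  have hm : ∀ z ∈ S ∩ A ×ˢ B, z.1.comp z.2 ∈
      chartSource q (chartAt E h.source) (chartAt E g.target) := fun z hz =>
    ⟨by rw [source_comp hz.1]; exact hz.2.2.1, by rw [target_comp hz.1]; exact hz.2.1.2⟩
  have h3 := (contMDiffOn_ofCoord (E := E) (q := q) h.source g.target).comp
    (h2.mono (s := A ×ˢ B) (t := S ∩ A ×ˢ B) inter_subset_right) fun z hz => by
      have := mapsTo_coord _ _ (hm z hz)
      rw [key z hz] at this
      exact this
  have h4 : ContMDiffOn (𝓘(ℝ, JetModel E q).prod 𝓘(ℝ, JetModel E q)) 𝓘(ℝ, JetModel E q) ∞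
      (fun z : Jet E X q × Jet E X q => z.1.comp z.2) (S ∩ A ×ˢ B) := by
    exact h3.congr fun z hz => (ofCoord_coord (hm z hz)).symm.trans (congrArg _ (key z hz))
  exact (h4 (g, h) ⟨H, hgA, hgB⟩).mono_of_mem_nhdsWithin
    (inter_mem self_mem_nhdsWithin (mem_nhdsWithin_of_mem_nhds hn))

end Smooth

end Jet

end JetGpd

/-! ### Smoothness of inversion of jets. -/

namespace JetGpd

section InverseSeries

variable {E : Type*} [NormedAddCommGroup E] [NormedSpace ℝ E]

theorem iteratedFDeriv_fderiv {F : E → E} {x : E} (j : ℕ) :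
    iteratedFDeriv ℝ j (fderiv ℝ F) x =
      continuousMultilinearCurryRightEquiv' ℝ j E E (iteratedFDeriv ℝ (j + 1) F x) := by
  rw [iteratedFDeriv_succ_eq_comp_right, Function.comp_apply, LinearIsometryEquiv.apply_symm_apply]

/-- The chain rule is applied to both germ identities at all nearby points, because the resulting
formula for the derivative of `H` is to be differentiated again. -/
theorem eventually_inverse_fderiv {F H : E → E} {x y : E} (hF : ContDiffAt ℝ ∞ F x)
    (hH : ContDiffAt ℝ ∞ H y) (hx : H y = x) (hHF : H ∘ F =ᶠ[𝓝 x] id)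
    (hFH : F ∘ H =ᶠ[𝓝 y] id) :
    ∀ᶠ z in 𝓝 y, (fderiv ℝ F (H z)).comp (fderiv ℝ H z) = .id ℝ E ∧
      (fderiv ℝ H z).comp (fderiv ℝ F (H z)) = .id ℝ E := by
  have hc : Tendsto H (𝓝 y) (𝓝 x) := hx ▸ hH.continuousAt.tendsto
  filter_upwards [hFH.eventually_nhds, hc.eventually hHF.eventually_nhds,
    (hH.of_le (m := 1) (by simp)).eventually (by simp),
    hc.eventually ((hF.of_le (m := 1) (by simp)).eventually (by simp))] with z h1 h2 h3 h4
  have d3 := (h3.differentiableAt one_ne_zero).hasFDerivAt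
  have d4 := (h4.differentiableAt one_ne_zero).hasFDerivAt
  refine ⟨(d4.comp z d3).unique ((hasFDerivAt_id z).congr_of_eventuallyEq h1), ?_⟩
  have h1 : F ∘ H =ᶠ[𝓝 z] id := h1
  have e : F (H z) = z := h1.eq_of_nhds
  exact ((e.symm ▸ d3 : HasFDerivAt H (fderiv ℝ H z) (F (H z))).comp (H z) d4).unique
    ((hasFDerivAt_id _).congr_of_eventuallyEq h2)

/-- The derivatives of an inverse function, recursively. -/
theorem iteratedFDeriv_succ_of_inverse [CompleteSpace E] {F H : E → E} {x y : E}
    (hF : ContDiffAt ℝ ∞ F x)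
    (hH : ContDiffAt ℝ ∞ H y) (hx : H y = x) (hHF : H ∘ F =ᶠ[𝓝 x] id)
    (hFH : F ∘ H =ᶠ[𝓝 y] id) (k : ℕ) :
    iteratedFDeriv ℝ (k + 1) H y = (continuousMultilinearCurryRightEquiv' ℝ k E E).symm
      (FormalMultilinearSeries.taylorComp (FormalMultilinearSeries.taylorComp
        (ftaylorSeries ℝ (ContinuousLinearMap.inverse (M := E) (M₂ := E)) (fderiv ℝ F x))
        (fun j => continuousMultilinearCurryRightEquiv' ℝ j E E (iteratedFDeriv ℝ (j + 1) F x)))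
        (ftaylorSeries ℝ H y) k) := by
  have hev := eventually_inverse_fderiv hF hH hx hHF hFH
  -- Differentiating `DH = (DF)⁻¹ ∘ H` a further `k` times expresses order `k + 1` of `H` through
  -- orders at most `k` of `H` and at most `k + 1` of `F`.
  have h1 : (fun z => fderiv ℝ H z) =ᶠ[𝓝 y]
      ((ContinuousLinearMap.inverse (M := E) (M₂ := E)) ∘ fderiv ℝ F) ∘ H := by
    filter_upwards [hev] with z hz
    exact (ContinuousLinearMap.inverse_eq hz.1 hz.2).symm
  have hle : ((k : ℕ∞) : WithTop ℕ∞) ≤ ∞ := by exact_mod_cast le_top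
  have hD : ContDiffAt ℝ ∞ (fderiv ℝ F) x := hF.fderiv_right (by simp)
  have hI : ContDiffAt ℝ ∞ (ContinuousLinearMap.inverse (M := E) (M₂ := E)) (fderiv ℝ F x) := by
    obtain ⟨h2, h3⟩ := hev.self_of_nhds
    rw [hx] at h2 h3
    exact contDiffAt_map_inverse (ContinuousLinearEquiv.equivOfInverse' _ _ h2 h3)
  rw [iteratedFDeriv_succ_eq_comp_right, Function.comp_apply,
    iteratedFDeriv_congr_of_eventuallyEq h1,
    iteratedFDeriv_comp (by rw [hx]; exact hI.comp x hD) hH hle, hx]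
  refine congrArg _ (taylorComp_congr (fun i hi => ?_) fun _ _ => rfl)
  have hle' : ((i : ℕ∞) : WithTop ℕ∞) ≤ ∞ := by exact_mod_cast le_top
  refine (iteratedFDeriv_comp hI hD hle').trans ?_
  exact taylorComp_congr (fun _ _ => rfl) fun j _ => iteratedFDeriv_fderiv j

theorem contDiffOn_ftaylorSeries_inverse [CompleteSpace E] {V : Type*} [NormedAddCommGroup V]
    [NormedSpace ℝ V] {A : V → E →L[ℝ] E} {t : Set V} (hA : ContDiffOn ℝ ∞ A t)
    (hi : ∀ z ∈ t, ∃ e : E ≃L[ℝ] E, (e : E →L[ℝ] E) = A z) (k : ℕ) :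
    ContDiffOn ℝ ∞ (fun z => ftaylorSeries ℝ
      (ContinuousLinearMap.inverse (M := E) (M₂ := E)) (A z) k) t := by
  intro z hz
  obtain ⟨e, he⟩ := hi z hz
  have : ContDiffAt ℝ ∞ (iteratedFDeriv ℝ k
      (ContinuousLinearMap.inverse (M := E) (M₂ := E))) (A z) := by
    rw [← he]
    exact (contDiffAt_map_inverse (n := ∞) e).iteratedFDeriv_right (by norm_cast)
  exact this.comp_contDiffWithinAt z (hA z hz)

end InverseSeries

namespace Jet

section Smooth

variable {E : Type*} [NormedAddCommGroup E] [NormedSpace ℝ E]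
  {X : Type*} [TopologicalSpace X] [ChartedSpace E X] [IsManifold 𝓘(ℝ, E) ∞ X] {q : ℕ}
  {φ ψ χ : OpenPartialHomeomorph X E}

theorem comp_chart_eventuallyEq {f g : X → X} {x : X} (hf : ContinuousAt f x)
    (hx : x ∈ φ.source) (hy : f x ∈ ψ.source) (hgf : g ∘ f =ᶠ[𝓝 x] id) :
    (φ ∘ g ∘ ψ.symm) ∘ (ψ ∘ f ∘ φ.symm) =ᶠ[𝓝 (φ x)] id := by
  have h0 : Tendsto φ.symm (𝓝 (φ x)) (𝓝 x) := by
    have := φ.continuousAt_symm (φ.map_source hx)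
    rwa [ContinuousAt, φ.left_inv hx] at this
  filter_upwards [(hf.tendsto.comp h0) (ψ.open_source.mem_nhds hy), h0.eventually hgf,
    φ.open_target.mem_nhds (φ.map_source hx)] with z h1 h2 h3
  simp only [Function.comp_apply, id] at h1 h2 ⊢
  rw [ψ.left_inv (show f (φ.symm z) ∈ ψ.source from h1), h2, φ.right_inv h3]

/-- Recursion for the coordinates of the inverse of a jet. -/
noncomputable def invStep (z w : JetModel E q) (k : ℕ) : E [×(k + 1)]→L[ℝ] E :=
  (continuousMultilinearCurryRightEquiv' ℝ k E E).symm
    (FormalMultilinearSeries.taylorComp (FormalMultilinearSeries.taylorComp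
      (ftaylorSeries ℝ (ContinuousLinearMap.inverse (M := E) (M₂ := E))
        (continuousMultilinearCurryFin1 ℝ E E (series z 1)))
      (fun j => continuousMultilinearCurryRightEquiv' ℝ j E E (series z (j + 1)))) (series w) k)

/-- The recursion for inverse functions, read in charts. Step `k` uses order `k + 1` of `g`, whence
`k < q`. Invertibility of the first derivative is recorded because inversion of linear maps is
smooth only at invertible ones; for `q = 0` the jet has no first derivative. -/
theorem series_coord_inv [CompleteSpace E] (hφ : φ ∈ IsManifold.maximalAtlas 𝓘(ℝ, E) ∞ X)
    (hψ : ψ ∈ IsManifold.maximalAtlas 𝓘(ℝ, E) ∞ X) {g : Jet E X q} (hg : g ∈ chartSource q φ ψ) :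
    (∀ k < q, series (coord ψ φ g.inv) (k + 1) = invStep (coord φ ψ g) (coord ψ φ g.inv) k) ∧
    (1 ≤ q → ∃ e : E ≃L[ℝ] E, (e : E →L[ℝ] E) =
      continuousMultilinearCurryFin1 ℝ E E (series (coord φ ψ g) 1)) := by
  obtain ⟨a, rfl⟩ : ∃ a, mk q a = g := ⟨_, g.mk_rep⟩
  have hx : a.pt ∈ φ.source := hg.1
  have hy : a.map a.pt ∈ ψ.source := hg.2
  have h := a.isLocalDiffeomorphAt
  have hG := h.localInverse_isLocalDiffeomorphAt
  let b : PreJet E X := ⟨a.map a.pt, h.localInverse, hG⟩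
  have hbx : b.map b.pt = a.pt := h.localInverse_left_inv h.localInverse_mem_target
  have hinv : inv (mk q a) = mk q b := inv_mk rfl hbx h.localInverse_eventuallyEq_right
  have hbx' : b.map b.pt ∈ φ.source := hbx ▸ hx
  have hF := contDiffAt_chart hφ hψ h.contMDiffAt hx hy
  have hH := contDiffAt_chart hψ hφ (f := b.map) hG.contMDiffAt (x := b.pt) hy hbx'
  have e1 : (φ ∘ b.map ∘ ψ.symm) (ψ b.pt) = φ a.pt := by
    simp only [Function.comp_apply]
    rw [ψ.left_inv (show b.pt ∈ ψ.source from hy), hbx]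
  have hHF : (φ ∘ b.map ∘ ψ.symm) ∘ (ψ ∘ a.map ∘ φ.symm) =ᶠ[𝓝 (φ a.pt)] id :=
    comp_chart_eventuallyEq h.contMDiffAt.continuousAt hx hy h.localInverse_eventuallyEq_left
  have hFH : (ψ ∘ a.map ∘ φ.symm) ∘ (φ ∘ b.map ∘ ψ.symm) =ᶠ[𝓝 (ψ b.pt)] id :=
    comp_chart_eventuallyEq hG.contMDiffAt.continuousAt hy hbx' h.localInverse_eventuallyEq_right
  have s1 : ∀ j ≤ q, series (coord φ ψ (mk q a)) j =
      iteratedFDeriv ℝ j (ψ ∘ a.map ∘ φ.symm) (φ a.pt) := fun j hj => series_coord hφ hψ hx hy hj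
  have s2 : ∀ j ≤ q, series (coord ψ φ (mk q a).inv) j =
      iteratedFDeriv ℝ j (φ ∘ b.map ∘ ψ.symm) (ψ b.pt) := fun j hj => by
    rw [hinv]; exact series_coord hψ hφ (a := b) hy hbx' hj
  have s3 : 1 ≤ q → continuousMultilinearCurryFin1 ℝ E E (series (coord φ ψ (mk q a)) 1) =
      fderiv ℝ (ψ ∘ a.map ∘ φ.symm) (φ a.pt) := fun hq => by
    rw [s1 1 hq]
    ext v
    exact (iteratedFDeriv_one_apply (𝕜 := ℝ) (fun _ : Fin 1 => v))
  refine ⟨fun k hk => ?_, fun hq => ?_⟩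
  · rw [s2 (k + 1) hk, iteratedFDeriv_succ_of_inverse hF hH e1 hHF hFH, invStep,
      s3 (Nat.one_le_of_lt hk)]
    refine congrArg _ (taylorComp_congr (fun i hi => taylorComp_congr (fun _ _ => rfl)
      fun j hj => ?_) fun i hi => (s2 i (hi.trans hk.le)).symm)
    rw [s1 (j + 1) (by omega)]
  · rw [s3 hq]
    obtain ⟨h2, h3⟩ := (eventually_inverse_fderiv hF hH e1 hHF hFH).self_of_nhds
    rw [e1] at h2 h3
    exact ⟨ContinuousLinearEquiv.equivOfInverse' _ _ h2 h3, rfl⟩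

variable [FiniteDimensional ℝ E]

/-- Strong induction on the order: order zero of the inverse is the source coordinate of the jet,
and `invStep` produces each further order smoothly from the lower ones. -/
theorem contDiffOn_coord_inv (x y : X) : ContDiffOn ℝ ∞
    (fun z : JetModel E q => coord (chartAt E y) (chartAt E x) (ofCoord x y z).inv)
    (chartTarget q (chartAt E x) (chartAt E y)) := by
  have : CompleteSpace E := FiniteDimensional.complete ℝ E
  set T := chartTarget q (chartAt E x) (chartAt E y)
  set w : JetModel E q → JetModel E q :=
    fun z => coord (chartAt E y) (chartAt E x) (ofCoord x y z).inv with hw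
  have hm : ∀ z ∈ T, ofCoord x y z ∈ chartSource q (chartAt E x) (chartAt E y) :=
    fun z hz => mapsTo_ofCoord x y hz
  have hm' : ∀ z ∈ T, (ofCoord x y z).inv ∈ chartSource q (chartAt E y) (chartAt E x) :=
    fun z hz => ⟨by rw [source_inv]; exact (hm z hz).2, by rw [target_inv]; exact (hm z hz).1⟩
  have hstep := fun z hz => series_coord_inv (chart_mem x) (chart_mem y) (hm z hz)
  have h0 : ∀ z ∈ T, series (w z) 0 = ContinuousMultilinearMap.constOfIsEmpty ℝ
      (fun _ : Fin 0 => E) z.1 := by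
    intro z hz
    have h1 := value_coord (chart_mem y) (chart_mem x) (hm' z hz)
    rw [target_inv, source_ofCoord hz, (chartAt E x).right_inv hz.1] at h1
    ext v
    rw [ContinuousMultilinearMap.constOfIsEmpty_apply, ← h1, series, dif_pos (Nat.succ_pos q)]
    exact congrArg _ (Subsingleton.elim (α := Fin 0 → E) _ _)
  have hs : ∀ k ≤ q, ContDiffOn ℝ ∞ (fun z => series (w z) k) T := by
    intro k
    induction k using Nat.strong_induction_on with
    | _ k ih =>
      intro hk
      cases k with
      | zero =>
        have hc : ContDiff ℝ ∞ (fun z : JetModel E q =>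
            ContinuousMultilinearMap.constOfIsEmpty ℝ (fun _ : Fin 0 => E) z.1) :=
          (continuousMultilinearCurryFin0 ℝ E E).symm.contDiff.comp contDiff_fst
        exact hc.contDiffOn.congr h0
      | succ k =>
        have h1 : ContDiffOn ℝ ∞ (fun z => invStep z (w z) k) T := by
          refine (continuousMultilinearCurryRightEquiv' ℝ k E E).symm.contDiff.comp_contDiffOn ?_
          refine contDiffOn_taylorComp (fun i hi => ?_) fun i hi => ih i (by omega) (by omega)
          refine contDiffOn_taylorComp (fun j hj => ?_) fun j hj => ?_
          · refine contDiffOn_ftaylorSeries_inverse ?_ (fun z hz => ?_) j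
            · exact ((continuousMultilinearCurryFin1 ℝ E E).contDiff.comp
                (contDiff_series (E := E) (q := q) 1)).contDiffOn
            · have := (hstep z hz).2 (by omega)
              rwa [coord_ofCoord hz] at this
          · exact ((continuousMultilinearCurryRightEquiv' ℝ j E E).contDiff.comp
              (contDiff_series (E := E) (q := q) (j + 1))).contDiffOn
        refine h1.congr fun z hz => ?_
        have := (hstep z hz).1 k (by omega)
        rwa [coord_ofCoord hz] at this
  have h1 : ContDiffOn ℝ ∞ (fun z => (value z, fun k : Fin (q + 1) =>
      symProj E k (series (w z) k)) : JetModel E q → JetModel E q) T :=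
    (contDiff_value (E := E) (q := q)).contDiffOn.prodMk (contDiffOn_pi.2 fun k =>
      (contDiff_symProj (k : ℕ)).comp_contDiffOn (hs k (Nat.lt_succ_iff.1 k.2)))
  refine h1.congr fun z hz => Prod.ext ?_ (funext fun k => Subtype.ext ?_)
  · change chartAt E y (ofCoord x y z).inv.source = value z
    rw [source_inv, target_ofCoord hz]
    exact (chartAt E y).right_inv hz.2.1
  · have h2 : series (w z) k = (w z).2 k := dif_pos k.2
    change ((w z).2 k : E [×(k : ℕ)]→L[ℝ] E) = symProj E k (series (w z) k)
    rw [h2, symProj_of_mem ((w z).2 k).2]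

theorem contMDiff_inv : ContMDiff 𝓘(ℝ, JetModel E q) 𝓘(ℝ, JetModel E q) ∞
    (inv : Jet E X q → Jet E X q) := by
  intro g
  set x := g.source
  set y := g.target
  have hm' : ∀ h ∈ chartSource q (chartAt E x) (chartAt E y),
      h.inv ∈ chartSource q (chartAt E y) (chartAt E x) :=
    fun h hh => ⟨by rw [source_inv]; exact hh.2, by rw [target_inv]; exact hh.1⟩
  have h1 := (contDiffOn_coord_inv (E := E) (q := q) x y).contMDiffOn.comp
    (contMDiffOn_coord (E := E) (q := q) x y) (mapsTo_coord x y)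
  have h2 := (contMDiffOn_ofCoord (E := E) (q := q) y x).comp h1 fun h hh => by
    have := mapsTo_coord _ _ (hm' h hh)
    rw [← ofCoord_coord hh] at this
    exact this
  have hn := g.chartSource_mem_nhds
  refine (h2.contMDiffAt hn).congr_of_eventuallyEq ?_
  filter_upwards [hn] with h hh
  simp only [Function.comp_apply]
  rw [ofCoord_coord hh, ofCoord_coord (hm' h hh)]

end Smooth

end Jet

end JetGpd

/-! ### Topology of the jet manifold and sections of (source, target). -/

namespace JetGpd

theorem _root_.ContinuousMultilinearMap.finiteDimensional (E F : Type*) [NormedAddCommGroup E]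
    [NormedSpace ℝ E] [NormedAddCommGroup F] [NormedSpace ℝ F] [FiniteDimensional ℝ E]
    [FiniteDimensional ℝ F] (k : ℕ) : FiniteDimensional ℝ (E [×k]→L[ℝ] F) := by
  let f : (E [×k]→L[ℝ] F) →ₗ[ℝ] MultilinearMap ℝ (fun _ : Fin k => E) F :=
    { toFun := ContinuousMultilinearMap.toMultilinearMap
      map_add' := fun _ _ => rfl
      map_smul' := fun _ _ => rfl }
  exact FiniteDimensional.of_injective f ContinuousMultilinearMap.toMultilinearMap_injective

theorem _root_.FiniteDimensional.secondCountableTopology (V : Type*) [NormedAddCommGroup V]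
    [NormedSpace ℝ V] [FiniteDimensional ℝ V] : SecondCountableTopology V :=
  have := FiniteDimensional.proper_real V
  inferInstance

namespace Jet

section Topology

variable {E : Type*} [NormedAddCommGroup E] [NormedSpace ℝ E] [FiniteDimensional ℝ E]
  {X : Type*} [TopologicalSpace X] [ChartedSpace E X] [IsManifold 𝓘(ℝ, E) ∞ X] {q : ℕ}

instance finiteDimensional_jetModel : FiniteDimensional ℝ (JetModel E q) := by
  have h : ∀ k : Fin (q + 1), FiniteDimensional ℝ (symForms E k) := fun k => by
    have := ContinuousMultilinearMap.finiteDimensional E E k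
    infer_instance
  have : FiniteDimensional ℝ ((k : Fin (q + 1)) → symForms E k) :=
    FiniteDimensional.finiteDimensional_pi' ℝ _
  exact Module.Finite.prod (R := ℝ) (M := E)

/-- Jets with equal source and target share a preferred chart; all others are separated by their
sources or targets in `X`. -/
instance t2Space [T2Space X] : T2Space (Jet E X q) := by
  refine ⟨fun g h hgh => ?_⟩
  by_cases hs : g.source = h.source
  · by_cases ht : g.target = h.target
    · let c := chartAt (JetModel E q) g
      have hg : g ∈ c.source := mem_chart_source _ g
      have hh : h ∈ c.source := by
        change h ∈ chartSource q (chartAt E g.source) (chartAt E g.target)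
        rw [hs, ht]
        exact h.mem_chartSource
      obtain ⟨u, v, hu, hv, hgu, hhv, huv⟩ := t2_separation (c.injOn.ne hg hh hgh)
      exact ⟨c.source ∩ c ⁻¹' u, c.source ∩ c ⁻¹' v, c.isOpen_inter_preimage hu,
        c.isOpen_inter_preimage hv, ⟨hg, hgu⟩, ⟨hh, hhv⟩,
        (huv.preimage c).mono inter_subset_right inter_subset_right⟩
    · exact separated_by_continuous continuous_target ht
  · exact separated_by_continuous continuous_source hs

/-- Countably many charts cover `X`, and each pair of them accounts for one chart of jets. -/
instance secondCountableTopology [SecondCountableTopology X] :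
    SecondCountableTopology (Jet E X q) := by
  have : SecondCountableTopology (JetModel E q) :=
    FiniteDimensional.secondCountableTopology (JetModel E q)
  obtain ⟨s, hs, hsu⟩ := TopologicalSpace.countable_cover_nhds
    fun x : X => (chartAt E x).open_source.mem_nhds (mem_chart_source E x)
  have hcov : ∀ x : X, ∃ y ∈ s, x ∈ (chartAt E y).source := fun x => by
    have : x ∈ ⋃ y ∈ s, (chartAt E y).source := hsu ▸ mem_univ x
    simpa using this
  choose j hj using fun p : X × X => exists_source_target (E := E) q p.1 p.2
  refine ChartedSpace.secondCountable_of_countable_cover (JetModel E q) (s := j '' (s ×ˢ s)) ?_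
    ((hs.prod hs).image j)
  refine eq_univ_of_forall fun g => ?_
  obtain ⟨y, hy, hgy⟩ := hcov g.source
  obtain ⟨z, hz, hgz⟩ := hcov g.target
  refine mem_biUnion (mem_image_of_mem j (mk_mem_prod hy hz)) ?_
  change g ∈ chartSource q (chartAt E (j (y, z)).source) (chartAt E (j (y, z)).target)
  rw [(hj _).1, (hj _).2]
  exact ⟨hgy, hgz⟩

/-- Through every jet there is a smooth local section of the map (source, target). -/
theorem exists_section (g : Jet E X q) : ∃ (O : Set (X × X)) (b : X × X → Jet E X q),
    IsOpen O ∧ (g.source, g.target) ∈ O ∧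
    ContMDiffOn (𝓘(ℝ, E).prod 𝓘(ℝ, E)) 𝓘(ℝ, JetModel E q) ∞ b O ∧
    b (g.source, g.target) = g ∧ ∀ p ∈ O, (b p).source = p.1 ∧ (b p).target = p.2 := by
  set x := g.source
  set y := g.target
  set z₀ := coord (chartAt E x) (chartAt E y) g with hz₀
  have hg0 : g ∈ chartSource q (chartAt E x) (chartAt E y) := g.mem_chartSource
  have hz : z₀ ∈ chartTarget q (chartAt E x) (chartAt E y) := mapsTo_coord x y hg0
  let c : E → symForms E ((0 : Fin (q + 1)) : ℕ) := fun e =>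
    symProj E 0 ((continuousMultilinearCurryFin0 ℝ E E).symm e)
  have hc : ContDiff ℝ ∞ c :=
    (contDiff_symProj 0).comp (continuousMultilinearCurryFin0 ℝ E E).symm.contDiff
  have hcv : ∀ e, (c e : E [×((0 : Fin (q + 1)) : ℕ)]→L[ℝ] E) =
      (continuousMultilinearCurryFin0 ℝ E E).symm e := fun e =>
    symProj_of_mem fun σ v => congrArg _ (Subsingleton.elim (α := Fin 0 → E) _ _)
  -- Only the source and the value vary; the derivatives of positive order are frozen at those of
  -- `g`, so the first one stays invertible.
  let Z : E × E → JetModel E q := fun p => (p.1, Function.update z₀.2 0 (c p.2))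
  have hZ : ContDiff ℝ ∞ Z := by
    refine contDiff_fst.prodMk (contDiff_pi.2 fun k => ?_)
    by_cases hk : k = 0
    · subst hk
      simp only [Function.update_self]
      exact hc.comp contDiff_snd
    · simp only [Function.update_of_ne hk]
      exact contDiff_const
  have hval : ∀ p, value (Z p) = p.2 := fun p => by
    simp only [value, Z, Function.update_self]
    exact congrArg (fun m : E [×0]→L[ℝ] E => m fun _ => 0) (hcv p.2)
  have hmem : ∀ p : E × E, p.1 ∈ (chartAt E x).target → p.2 ∈ (chartAt E y).target →
      Z p ∈ chartTarget q (chartAt E x) (chartAt E y) := by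
    refine fun p h1 h2 => ⟨h1, ?_, fun k hk => ?_⟩
    · have := hval p
      rw [value] at this
      rwa [this]
    · have hk0 : k ≠ 0 := by
        rintro rfl
        simp at hk
      have : (Z p).2 k = z₀.2 k := Function.update_of_ne hk0 _ _
      rw [this]
      exact hz.2.2 k hk
  let O := (chartAt E x).source ×ˢ (chartAt E y).source
  have h1 : ContMDiffOn (𝓘(ℝ, E).prod 𝓘(ℝ, E)) 𝓘(ℝ, JetModel E q) ∞
      (fun p : X × X => Z (chartAt E x p.1, chartAt E y p.2)) O :=
    hZ.comp_contMDiffOn₂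
      ((contMDiffOn_chart (I := 𝓘(ℝ, E)) (x := x)).comp contMDiffOn_fst fun p hp => hp.1)
      ((contMDiffOn_chart (I := 𝓘(ℝ, E)) (x := y)).comp contMDiffOn_snd fun p hp => hp.2)
  have hm : ∀ p ∈ O, Z (chartAt E x p.1, chartAt E y p.2) ∈
      chartTarget q (chartAt E x) (chartAt E y) := fun p hp =>
    hmem _ ((chartAt E x).map_source hp.1) ((chartAt E y).map_source hp.2)
  refine ⟨O, fun p => ofCoord x y (Z (chartAt E x p.1, chartAt E y p.2)),
    (chartAt E x).open_source.prod (chartAt E y).open_source,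
    ⟨mem_chart_source E x, mem_chart_source E y⟩,
    (contMDiffOn_ofCoord (E := E) (q := q) x y).comp h1 hm, ?_, fun p hp => ⟨?_, ?_⟩⟩
  · have e : Z (chartAt E x x, chartAt E y y) = z₀ := by
      refine Prod.ext rfl ?_
      have e0 : c (chartAt E y y) = z₀.2 0 := by
        have h2 := value_coord (chart_mem x) (chart_mem y) hg0
        refine Subtype.ext (ContinuousMultilinearMap.ext fun v => ?_)
        refine (congrArg (fun m : E [×0]→L[ℝ] E => m v) (hcv (chartAt E y y))).trans ?_
        change chartAt E y y = _
        rw [← h2]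
        exact congrArg _ (Subsingleton.elim (α := Fin 0 → E) _ _)
      change Function.update z₀.2 0 (c (chartAt E y y)) = z₀.2
      rw [e0, Function.update_eq_self]
    change ofCoord x y (Z (chartAt E x x, chartAt E y y)) = g
    rw [e, hz₀, ofCoord_coord hg0]
  · rw [source_ofCoord (hm p hp)]
    exact (chartAt E x).left_inv hp.1
  · rw [target_ofCoord (hm p hp), hval]
    exact (chartAt E y).left_inv hp.2

end Topology

end Jet

end JetGpd

/-! ### Inverse function theorem and maps at points of maximal rank. -/

namespace JetGpd

section LocalInverse

variable {V W : Type*} [NormedAddCommGroup V] [NormedSpace ℝ V] [FiniteDimensional ℝ V]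
  [NormedAddCommGroup W] [NormedSpace ℝ W] [FiniteDimensional ℝ W]

/-- Invertibility of the derivative is an open condition, so the inverse is smooth on a
neighbourhood and not merely at `f a`. -/
theorem exists_local_inverse {f : V → W} {a : V} (hf : ∀ᶠ x in 𝓝 a, ContDiffAt ℝ ∞ f x)
    (hinj : ∀ v, fderiv ℝ f a v = 0 → v = 0) (hdim : Module.finrank ℝ V = Module.finrank ℝ W) :
    ∃ g : W → V, (∀ᶠ y in 𝓝 (f a), ContDiffAt ℝ ∞ g y) ∧ g (f a) = a ∧
      (∀ᶠ x in 𝓝 a, g (f x) = x) ∧ ∀ᶠ y in 𝓝 (f a), f (g y) = y := by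
  have : CompleteSpace V := FiniteDimensional.complete ℝ V
  have hfa := hf.self_of_nhds
  have hd := (hfa.differentiableAt (by simp)).hasFDerivAt
  let A : V ≃L[ℝ] W := (LinearMap.linearEquivOfInjective (fderiv ℝ f a : V →ₗ[ℝ] W)
    ((injective_iff_map_eq_zero _).2 hinj) hdim).toContinuousLinearEquiv
  have hA : (A : V →L[ℝ] W) = fderiv ℝ f a := by ext v; rfl
  have hdA : HasFDerivAt f (A : V →L[ℝ] W) a := hA ▸ hd
  let h := hfa.toOpenPartialHomeomorph f hdA (by simp)
  have hh : (h : V → W) = f := rfl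
  have has : a ∈ h.source := hfa.mem_toOpenPartialHomeomorph_source hdA (by simp)
  have hat : f a ∈ h.target := hfa.image_mem_toOpenPartialHomeomorph_target hdA (by simp)
  have hsa : h.symm (f a) = a := h.left_inv has
  refine ⟨h.symm, ?_, hsa, ?_, ?_⟩
  · have hO : ∀ᶠ x in 𝓝 a, fderiv ℝ f x ∈
        range (fun e : V ≃L[ℝ] W => (e : V →L[ℝ] W)) := by
      have hc : ContinuousAt (fderiv ℝ f) a :=
        (hfa.fderiv_right (m := 0) (by simp)).continuousAt
      exact hc.preimage_mem_nhds (ContinuousLinearEquiv.isOpen.mem_nhds ⟨A, hA⟩)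
    have hc : Tendsto h.symm (𝓝 (f a)) (𝓝 a) := by
      have := h.continuousAt_symm hat
      rwa [ContinuousAt, hsa] at this
    filter_upwards [hc.eventually hO, hc.eventually hf, h.open_target.mem_nhds hat]
      with y h1 h2 h3
    obtain ⟨B, hB⟩ := h1
    refine h.contDiffAt_symm (f₀' := B) h3 ?_ h2
    have hB : (B : V →L[ℝ] W) = _ := hB
    rw [hB]
    exact (h2.differentiableAt (by simp)).hasFDerivAt
  · filter_upwards [h.open_source.mem_nhds has] with x hx using h.left_inv hx
  · filter_upwards [h.open_target.mem_nhds hat] with y hy using h.right_inv hy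

/-- At a point of maximal rank, a smooth map factors locally through its linearisation. -/
theorem exists_rank_factorization {f : V → W} {Ω : Set V} (hΩ : IsOpen Ω) (hne : Ω.Nonempty)
    (hf : ∀ v ∈ Ω, ContDiffAt ℝ ∞ f v) : ∃ z ∈ Ω, ∃ (R : Submodule ℝ W) (π : W →L[ℝ] R) (j : R → V),
      (∀ w : R, π w = w) ∧ (∀ᶠ y in 𝓝 (π (f z)), ContDiffAt ℝ ∞ j y) ∧ j (π (f z)) = z ∧
      (∀ᶠ v in 𝓝 z, f v = f (j (π (f v)))) ∧ ∀ᶠ y in 𝓝 (π (f z)), π (f (j y)) = y := by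
  let rk : V → ℕ := fun v => Module.finrank ℝ (LinearMap.range (fderiv ℝ f v : V →ₗ[ℝ] W))
  obtain ⟨z, hz, hmax⟩ : ∃ z ∈ Ω, ∀ v ∈ Ω, rk v ≤ rk z := by
    -- The rank is bounded by the dimension of `W`, so a maximum arises by minimising the corank
    -- among natural numbers.
    obtain ⟨z, hz, h1⟩ : ∃ z ∈ Ω, ∀ v ∈ Ω,
        Module.finrank ℝ W - rk z ≤ Module.finrank ℝ W - rk v :=
      ⟨_, Function.argminOn_mem (fun v => Module.finrank ℝ W - rk v) Ω hne,
        fun v hv => Function.argminOn_le (fun v => Module.finrank ℝ W - rk v) Ω hv⟩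
    refine ⟨z, hz, fun v hv => ?_⟩
    have h2 : rk v ≤ Module.finrank ℝ W := Submodule.finrank_le _
    have := h1 v hv
    omega
  set A := fderiv ℝ f z with hA
  let R : Submodule ℝ W := LinearMap.range (A : V →ₗ[ℝ] W)
  let K : Submodule ℝ V := LinearMap.ker (A : V →ₗ[ℝ] W)
  obtain ⟨π, hπ⟩ := Submodule.ClosedComplemented.of_finiteDimensional R
  obtain ⟨p, hp⟩ := Submodule.ClosedComplemented.of_finiteDimensional K
  -- Coordinates adapted to `A`: the component of `f` in the range of `A`, and the component of `v -
  -- z` in its kernel. The differential at `z` is injective, and the dimensions match by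
  -- rank-nullity.
  let Φ : V → R × K := fun v => (π (f v), p (v - z))
  have hΦz : Φ z = (π (f z), 0) := by simp [Φ]
  have hΦ : ∀ v ∈ Ω, ContDiffAt ℝ ∞ Φ v := fun v hv =>
    (π.contDiff.contDiffAt.comp v (hf v hv)).prodMk
      (p.contDiff.comp (contDiff_id.sub contDiff_const)).contDiffAt
  have hfd : ∀ v ∈ Ω, HasFDerivAt f (fderiv ℝ f v) v := fun v hv =>
    ((hf v hv).differentiableAt (by simp)).hasFDerivAt
  have hΦd : ∀ v ∈ Ω, HasFDerivAt Φ ((π.comp (fderiv ℝ f v)).prod p) v := fun v hv =>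
    (π.hasFDerivAt.comp v (hfd v hv)).prodMk (p.hasFDerivAt.comp v ((hasFDerivAt_id v).sub_const z))
  have hinj : ∀ v, fderiv ℝ Φ z v = 0 → v = 0 := by
    intro v hv
    rw [(hΦd z hz).fderiv] at hv
    have h1 : π (A v) = 0 := congrArg Prod.fst hv
    have h2 : p v = 0 := congrArg Prod.snd hv
    have h3 := congrArg Subtype.val (hπ ⟨A v, v, rfl⟩)
    simp only [h1] at h3
    have h4 := congrArg Subtype.val (hp ⟨v, h3.symm⟩)
    simp only [h2] at h4
    exact h4.symm
  have hdim : Module.finrank ℝ V = Module.finrank ℝ (R × K) := by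
    rw [Module.finrank_prod]
    exact (LinearMap.finrank_range_add_finrank_ker (A : V →ₗ[ℝ] W)).symm
  obtain ⟨g, hg, hgz, hgΦ, hΦg⟩ := exists_local_inverse
    (eventually_of_mem (hΩ.mem_nhds hz) hΦ) hinj hdim
  rw [hΦz] at hg hgz hΦg
  have hgc : Tendsto g (𝓝 (π (f z), 0)) (𝓝 z) := by
    have := hg.self_of_nhds.continuousAt
    rwa [ContinuousAt, hgz] at this
  have hgood : ∀ᶠ c in 𝓝 ((π (f z), 0) : R × K), ContDiffAt ℝ ∞ g c ∧ g c ∈ Ω ∧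
      ∀ᶠ c' in 𝓝 c, Φ (g c') = c' :=
    hg.and ((hgc.eventually (hΩ.mem_nhds hz)).and hΦg.eventually_nhds)
  rw [nhds_prod_eq] at hgood
  obtain ⟨B₁, hB₁, B₂, hB₂, hB⟩ := eventually_prod_iff.1 hgood
  obtain ⟨ε, hε, hεB⟩ := Metric.eventually_nhds_iff_ball.1 hB₂
  -- Maximality of the rank enters here. Where `Φ` has surjective differential, `π` maps the range
  -- of the derivative of `f` onto `R`, whose dimension is the largest possible, hence bijectively;
  -- so the kernels of the derivative and of its composite with `π` coincide.
  have hker : ∀ v ∈ Ω, Function.Surjective ((π.comp (fderiv ℝ f v)).prod p) →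
      ∀ w, π (fderiv ℝ f v w) = 0 → fderiv ℝ f v w = 0 := by
    intro v hv hs w hw
    let T := (LinearMap.range (fderiv ℝ f v : V →ₗ[ℝ] W))
    let πT : T →ₗ[ℝ] R := (π : W →ₗ[ℝ] R).comp T.subtype
    have hsT : Function.Surjective πT := fun r => by
      obtain ⟨w', hw'⟩ := hs (r, 0)
      exact ⟨⟨_, w', rfl⟩, congrArg Prod.fst hw'⟩
    have hle : Module.finrank ℝ R ≤ Module.finrank ℝ T :=
      LinearMap.finrank_le_finrank_of_surjective hsT
    have heq : Module.finrank ℝ T = Module.finrank ℝ R := le_antisymm (hmax v hv) hle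
    have hi := (LinearMap.injective_iff_surjective_of_finrank_eq_finrank heq).2 hsT
    exact congrArg Subtype.val
      ((injective_iff_map_eq_zero πT).1 hi ⟨fderiv ℝ f v w, w, rfl⟩ hw)
  -- In the coordinates `Φ`, moving along `K` keeps `π ∘ f` fixed, so by `hker` the derivative of
  -- `f` in that direction vanishes and `f` is constant on the ball.
  have hconst : ∀ y, B₁ y → ∀ k ∈ Metric.ball (0 : K) ε, f (g (y, k)) = f (g (y, 0)) := by
    intro y hy k hk
    have hd : ∀ k ∈ Metric.ball (0 : K) ε, HasFDerivAt (fun k => f (g (y, k)))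
        (0 : K →L[ℝ] W) k := by
      intro k hk
      obtain ⟨h1, h2, h3⟩ := hB hy (hεB k hk)
      have h4 := (h1.differentiableAt (by simp)).hasFDerivAt
      have h5 := ((hΦd _ h2).comp (y, k) h4).unique ((hasFDerivAt_id _).congr_of_eventuallyEq h3)
      have h6 := ((hfd _ h2).comp (y, k) h4).comp k
        ((hasFDerivAt_const y k).prodMk (hasFDerivAt_id k))
      refine h6.congr_fderiv (ContinuousLinearMap.ext fun κ => ?_) |>.congr_of_eventuallyEq .rfl
      have h7 : ∀ c, ((π.comp (fderiv ℝ f (g (y, k)))).prod p) (fderiv ℝ g (y, k) c) = c :=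
        fun c => congrArg (fun L => L c) h5
      exact (hker _ h2 (fun c => ⟨_, h7 c⟩) _ (congrArg Prod.fst (h7 (0, κ))))
    exact IsOpen.is_const_of_fderiv_eq_zero (𝕜 := ℝ) Metric.isOpen_ball
      (convex_ball (0 : K) ε).isPreconnected
      (fun k hk => (hd k hk).differentiableAt.differentiableWithinAt)
      (fun k hk => (hd k hk).fderiv) hk (Metric.mem_ball_self hε)
  have hΦc : Tendsto Φ (𝓝 z) (𝓝 (π (f z)) ×ˢ 𝓝 (0 : K)) := by
    rw [← nhds_prod_eq, ← hΦz]
    exact (hΦ z hz).continuousAt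
  have h0 : B₂ 0 := hB₂.self_of_nhds
  have hin : Continuous (fun y : R => (y, (0 : K))) := by fun_prop
  refine ⟨z, hz, R, π, fun y => g (y, 0), hπ, ?_, hgz, ?_, ?_⟩
  · filter_upwards [hB₁] with y hy
    exact (hB hy h0).1.comp y (contDiff_id.prodMk contDiff_const).contDiffAt
  · filter_upwards [hgΦ, hΦc.eventually (hB₁.prod_inl _), hΦc.eventually
      (tendsto_snd.eventually (Metric.ball_mem_nhds (0 : K) hε))] with v h1 h2 h3
    conv_lhs => rw [← h1]
    exact hconst _ h2 _ h3
  · filter_upwards [hB₁] with y hy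
    exact congrArg Prod.fst (hB hy h0).2.2.self_of_nhds

end LocalInverse

end JetGpd

/-! ### Smoothness near a point; sections of maps of manifolds. -/

namespace JetGpd

section EvSmooth

variable {E₁ H₁ M₁ E₂ H₂ M₂ E₃ H₃ M₃ : Type*}
  [NormedAddCommGroup E₁] [NormedSpace ℝ E₁] [TopologicalSpace H₁] [TopologicalSpace M₁]
  [ChartedSpace H₁ M₁] [NormedAddCommGroup E₂] [NormedSpace ℝ E₂] [TopologicalSpace H₂]
  [TopologicalSpace M₂] [ChartedSpace H₂ M₂] [NormedAddCommGroup E₃] [NormedSpace ℝ E₃]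
  [TopologicalSpace H₃] [TopologicalSpace M₃] [ChartedSpace H₃ M₃]
  {I₁ : ModelWithCorners ℝ E₁ H₁} {I₂ : ModelWithCorners ℝ E₂ H₂} {I₃ : ModelWithCorners ℝ E₃ H₃}

/-- `f` is smooth on a neighbourhood of `x`. -/
def EvSmooth (I₁ : ModelWithCorners ℝ E₁ H₁) (I₂ : ModelWithCorners ℝ E₂ H₂) (f : M₁ → M₂)
    (x : M₁) : Prop :=
  ∀ᶠ y in 𝓝 x, ContMDiffAt I₁ I₂ ∞ f y

namespace EvSmooth

variable {f : M₁ → M₂} {g : M₂ → M₃} {x : M₁}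

theorem contMDiffAt (h : EvSmooth I₁ I₂ f x) : ContMDiffAt I₁ I₂ ∞ f x := h.self_of_nhds

theorem continuousAt (h : EvSmooth I₁ I₂ f x) : ContinuousAt f x := h.contMDiffAt.continuousAt

theorem tendsto (h : EvSmooth I₁ I₂ f x) : Tendsto f (𝓝 x) (𝓝 (f x)) := h.continuousAt

theorem tendsto' (h : EvSmooth I₁ I₂ f x) {y : M₂} (e : f x = y) : Tendsto f (𝓝 x) (𝓝 y) :=
  e ▸ h.continuousAt

theorem eventually (h : EvSmooth I₁ I₂ f x) : ∀ᶠ y in 𝓝 x, EvSmooth I₁ I₂ f y :=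
  h.eventually_nhds

theorem comp (hg : EvSmooth I₂ I₃ g (f x)) (hf : EvSmooth I₁ I₂ f x) :
    EvSmooth I₁ I₃ (fun y => g (f y)) x := by
  filter_upwards [hf, hf.tendsto.eventually hg] with y h1 h2 using h2.comp y h1

theorem comp' {z : M₂} (hg : EvSmooth I₂ I₃ g z) (hf : EvSmooth I₁ I₂ f x) (e : f x = z) :
    EvSmooth I₁ I₃ (fun y => g (f y)) x :=
  (e ▸ hg : EvSmooth I₂ I₃ g (f x)).comp hf

theorem congr {f' : M₁ → M₂} (h : EvSmooth I₁ I₂ f x) (e : f' =ᶠ[𝓝 x] f) :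
    EvSmooth I₁ I₂ f' x := by
  filter_upwards [h, e.eventually_nhds] with y h1 h2 using h1.congr_of_eventuallyEq h2

theorem prodMk {g : M₁ → M₃} (hf : EvSmooth I₁ I₂ f x) (hg : EvSmooth I₁ I₃ g x) :
    EvSmooth I₁ (I₂.prod I₃) (fun y => (f y, g y)) x := by
  filter_upwards [hf, hg] with y h1 h2 using h1.prodMk h2

end EvSmooth

theorem _root_.ContMDiff.evSmooth {f : M₁ → M₂} (h : ContMDiff I₁ I₂ ∞ f) (x : M₁) :
    EvSmooth I₁ I₂ f x := Eventually.of_forall h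

theorem _root_.ContMDiffOn.evSmooth {f : M₁ → M₂} {s : Set M₁} (h : ContMDiffOn I₁ I₂ ∞ f s)
    (hs : IsOpen s) {x : M₁} (hx : x ∈ s) : EvSmooth I₁ I₂ f x :=
  eventually_of_mem (hs.mem_nhds hx) fun _ hy => h.contMDiffAt (hs.mem_nhds hy)

theorem evSmooth_id (x : M₁) : EvSmooth I₁ I₁ (fun y : M₁ => y) x := contMDiff_id.evSmooth x

theorem evSmooth_const (c : M₂) (x : M₁) : EvSmooth I₁ I₂ (fun _ : M₁ => c) x :=
  contMDiff_const.evSmooth x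

end EvSmooth

section Regular

variable {V W : Type*} [NormedAddCommGroup V] [NormedSpace ℝ V]
  [NormedAddCommGroup W] [NormedSpace ℝ W]
  {M N : Type*} [TopologicalSpace M] [ChartedSpace V M] [IsManifold 𝓘(ℝ, V) ∞ M]
  [TopologicalSpace N] [ChartedSpace W N] [IsManifold 𝓘(ℝ, W) ∞ N]

theorem evSmooth_chart (x y : M) (hy : y ∈ (chartAt V x).source) :
    EvSmooth 𝓘(ℝ, V) 𝓘(ℝ, V) (chartAt V x) y :=
  contMDiffOn_chart.evSmooth (chartAt V x).open_source hy

theorem evSmooth_chart_symm (x : M) (v : V) (hv : v ∈ (chartAt V x).target) :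
    EvSmooth 𝓘(ℝ, V) 𝓘(ℝ, V) (chartAt V x).symm v :=
  contMDiffOn_chart_symm.evSmooth (chartAt V x).open_target hv

theorem evSmooth_iff_contDiffAt {f : V → W} {x : V} :
    EvSmooth 𝓘(ℝ, V) 𝓘(ℝ, W) f x ↔ ∀ᶠ y in 𝓝 x, ContDiffAt ℝ ∞ f y := by
  simp only [EvSmooth, contMDiffAt_iff_contDiffAt]

variable [FiniteDimensional ℝ V] [FiniteDimensional ℝ W]

/-- The factorisation is read in charts. If `R` is everything, then `π` is the identity in the
target chart, and `j ∘ π` turns into a local section of `f`. -/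
theorem exists_rank_factorization_manifold {f : M → N} {Ω : Set M} (hΩ : IsOpen Ω)
    (hne : Ω.Nonempty) (hf : ∀ x ∈ Ω, EvSmooth 𝓘(ℝ, V) 𝓘(ℝ, W) f x) :
    ∃ x ∈ Ω, ∃ (R : Submodule ℝ W) (π : N → R) (j : R → M),
      EvSmooth 𝓘(ℝ, W) 𝓘(ℝ, R) π (f x) ∧ EvSmooth 𝓘(ℝ, R) 𝓘(ℝ, V) j (π (f x)) ∧
      j (π (f x)) = x ∧ (∀ᶠ v in 𝓝 x, f v = f (j (π (f v)))) ∧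
      (R = ⊤ → ∀ᶠ u in 𝓝 (f x), f (j (π u)) = u) := by
  obtain ⟨x₀, hx₀⟩ := hne
  let c := chartAt V x₀
  let d := chartAt W (f x₀)
  let Ω' : Set V := {v | v ∈ c.target ∧ c.symm v ∈ Ω ∧ f (c.symm v) ∈ d.source}
  have hcs : ∀ v ∈ c.target, EvSmooth 𝓘(ℝ, V) 𝓘(ℝ, V) c.symm v := fun v hv =>
    evSmooth_chart_symm x₀ v hv
  have hds : ∀ u ∈ d.source, EvSmooth 𝓘(ℝ, W) 𝓘(ℝ, W) d u := fun u hu =>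
    evSmooth_chart (f x₀) u hu
  have hΩ' : IsOpen Ω' := by
    refine isOpen_iff_mem_nhds.2 fun v hv => ?_
    have h1 := (hcs v hv.1).tendsto
    filter_upwards [c.open_target.mem_nhds hv.1, h1.eventually (hΩ.mem_nhds hv.2.1),
      ((hf _ hv.2.1).tendsto.comp h1).eventually (d.open_source.mem_nhds hv.2.2)] with
      w h1 h2 h3 using ⟨h1, h2, h3⟩
  have hx0c : c.symm (c x₀) = x₀ := c.left_inv (mem_chart_source V x₀)
  have hne' : Ω'.Nonempty := ⟨c x₀, mem_chart_target V x₀, by rwa [hx0c], by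
    rw [hx0c]; exact mem_chart_source W _⟩
  let F : V → W := fun v => d (f (c.symm v))
  have hF : ∀ v ∈ Ω', ContDiffAt ℝ ∞ F v := fun v hv => by
    have h1 : EvSmooth 𝓘(ℝ, V) 𝓘(ℝ, W) (fun v => f (c.symm v)) v :=
      (hf _ hv.2.1).comp (hcs v hv.1)
    have h2 : EvSmooth 𝓘(ℝ, V) 𝓘(ℝ, W) F v := (hds _ hv.2.2).comp' h1 rfl
    exact contMDiffAt_iff_contDiffAt.1 h2.contMDiffAt
  obtain ⟨z, hz, R, π, j, hπ, hj, hjz, hfac, hπj⟩ := exists_rank_factorization hΩ' hne' hF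
  have hzc : c (c.symm z) = z := c.right_inv hz.1
  have hcz : c.symm z ∈ c.source := c.map_target hz.1
  have hc : EvSmooth 𝓘(ℝ, V) 𝓘(ℝ, V) c (c.symm z) := evSmooth_chart x₀ _ hcz
  have hjt : Tendsto j (𝓝 (π (F z))) (𝓝 z) := by
    have := hj.self_of_nhds.continuousAt
    rwa [ContinuousAt, hjz] at this
  have hπs : EvSmooth 𝓘(ℝ, W) 𝓘(ℝ, R) (fun u => π (d u)) (f (c.symm z)) :=
    (π.contDiff.contMDiff.evSmooth _).comp (hds _ hz.2.2)
  refine ⟨c.symm z, hz.2.1, R, fun u => π (d u), fun y => c.symm (j y), hπs, ?_, ?_, ?_, ?_⟩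
  · exact (hcs z hz.1).comp' (evSmooth_iff_contDiffAt.2 hj) hjz
  · exact congrArg c.symm hjz
  · have h1 := hc.tendsto' hzc
    have h2 : Tendsto (fun v => π (d (f v))) (𝓝 (c.symm z)) (𝓝 (π (F z))) :=
      (hπs.comp (hf _ hz.2.1)).tendsto
    filter_upwards [h1.eventually hfac, c.open_source.mem_nhds hcz,
      h1.eventually (hΩ'.mem_nhds hz), h2.eventually (hjt.eventually (hΩ'.mem_nhds hz))]
      with v h3 h4 h5 h6
    simp only [F, c.left_inv h4] at h3 h5
    exact d.injOn h5.2.2 h6.2.2 h3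
  · intro hR
    have h2 := hπs.tendsto
    filter_upwards [h2.eventually hπj, h2.eventually (hjt.eventually (hΩ'.mem_nhds hz)),
      d.open_source.mem_nhds hz.2.2] with u h3 h4 h5
    refine d.injOn h4.2.2 h5 ?_
    have hinj : ∀ w : W, (π w : W) = w := fun w => by
      have := hπ ⟨w, hR ▸ Submodule.mem_top⟩
      exact congrArg Subtype.val this
    have := congrArg Subtype.val h3
    simp only [F, hinj] at this
    exact this

/-- A smooth map from a second countable manifold with large image, which looks everywhere the same
up to composition with smooth maps of the target, has a smooth local section somewhere. -/
theorem exists_local_section [SecondCountableTopology M] {f : M → N} {Ω : Set M} (hΩ : IsOpen Ω)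
    (hf : ∀ x ∈ Ω, EvSmooth 𝓘(ℝ, V) 𝓘(ℝ, W) f x) {u₀ : N} (hu₀ : f '' Ω ∈ 𝓝 u₀)
    (htr : ∀ x ∈ Ω, ∀ y ∈ Ω, ∃ (l : M → M) (γ : N → N), ContinuousAt l x ∧ l x = y ∧
      EvSmooth 𝓘(ℝ, W) 𝓘(ℝ, W) γ (f y) ∧ ∀ᶠ v in 𝓝 x, f v = γ (f (l v))) :
    ∃ x ∈ Ω, ∃ σ : N → M, EvSmooth 𝓘(ℝ, W) 𝓘(ℝ, V) σ (f x) ∧ σ (f x) = x ∧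
      ∀ᶠ u in 𝓝 (f x), f (σ u) = u := by
  have hne : Ω.Nonempty := image_nonempty.1 ⟨_, mem_of_mem_nhds hu₀⟩
  obtain ⟨y, hy, R, π, j, hπ, hj, hjy, hfac, htop⟩ :=
    exists_rank_factorization_manifold hΩ hne hf
  by_cases hR : R = ⊤
  · exact ⟨y, hy, fun u => j (π u), hj.comp hπ, hjy, htop hR⟩
  -- If the maximal rank were too small, `f` would factor near `y` through `R`. By `htr` every point
  -- then has a neighbourhood whose image has Hausdorff dimension at most `dim R`, and countably
  -- many of these cover `Ω₀`. Yet `f '' Ω` contains a neighbourhood of `u₀`, of dimension `dim W`.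
  -- Dimensions are measured in the chart `d`, which is why the domain is cut down to `Ω₀`.
  exfalso
  have hlt : Module.finrank ℝ R < Module.finrank ℝ W := Submodule.finrank_lt hR
  let d := chartAt W u₀
  let Ω₀ : Set M := Ω ∩ {x | f x ∈ d.source}
  have key : ∀ x ∈ Ω₀, ∃ A ∈ 𝓝 x, dimH (d '' (f '' A)) ≤ Module.finrank ℝ R := by
    rintro x ⟨hx, hxd⟩
    obtain ⟨l, γ, hl, hlx, hγ, hev⟩ := htr x hx y hy
    let h : R → W := fun r => d (γ (f (j r)))
    have e1 : f (j (π (f y))) = f y := by rw [hjy]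
    have e2 : γ (f y) = f x := by rw [← hlx]; exact hev.self_of_nhds.symm
    have hγf : EvSmooth 𝓘(ℝ, R) 𝓘(ℝ, W) (fun r => γ (f (j r))) (π (f y)) :=
      hγ.comp' ((hf y hy).comp' hj hjy) e1
    have hh : EvSmooth 𝓘(ℝ, R) 𝓘(ℝ, W) h (π (f y)) :=
      (evSmooth_chart u₀ (f x) hxd).comp' hγf (by rw [e1, e2])
    obtain ⟨ε, hε, hB⟩ := Metric.eventually_nhds_iff_ball.1 (evSmooth_iff_contDiffAt.1 hh)
    have hlt : Tendsto l (𝓝 x) (𝓝 y) := hlx ▸ hl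
    have hπf : Tendsto (fun v => π (f v)) (𝓝 y) (𝓝 (π (f y))) := (hπ.comp (hf y hy)).tendsto
    refine ⟨_, hev.and ((hlt.eventually hfac).and
      (hlt.eventually (hπf.eventually (Metric.ball_mem_nhds _ hε)))), ?_⟩
    have hsub : d '' (f '' {v | f v = γ (f (l v)) ∧ f (l v) = f (j (π (f (l v)))) ∧
        π (f (l v)) ∈ Metric.ball (π (f y)) ε}) ⊆ h '' Metric.ball (π (f y)) ε := by
      rintro _ ⟨_, ⟨v, ⟨h1, h2, h3⟩, rfl⟩, rfl⟩
      refine ⟨_, h3, ?_⟩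
      simp only [h]
      rw [← h2, ← h1]
    refine (dimH_mono hsub).trans (le_trans (ContDiffOn.dimH_image_le (fun r hr => ?_)
      (convex_ball (π (f y)) ε) Subset.rfl) ?_)
    · exact ((hB r hr).of_le (by simp)).contDiffWithinAt
    · exact (dimH_mono (subset_univ _)).trans (Real.dimH_univ_eq_finrank R).le
  choose! A hA hAd using key
  obtain ⟨t, ht, htc, hts⟩ := TopologicalSpace.countable_cover_nhdsWithin
    (f := A) (s := Ω₀) fun x hx => mem_nhdsWithin_of_mem_nhds (hA x hx)
  have hcov : d '' (f '' Ω ∩ d.source) ⊆ ⋃ x ∈ t, d '' (f '' A x) := by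
    rintro _ ⟨_, ⟨⟨v, hv, rfl⟩, hvd⟩, rfl⟩
    obtain ⟨x, hx, hvx⟩ := mem_iUnion₂.1 (hts ⟨hv, hvd⟩)
    exact mem_iUnion₂.2 ⟨x, hx, mem_image_of_mem _ (mem_image_of_mem _ hvx)⟩
  have hus : u₀ ∈ d.source := mem_chart_source W u₀
  have hnhds : d '' (f '' Ω ∩ d.source) ∈ 𝓝 (d u₀) := by
    rw [← d.map_nhds_eq hus]
    exact image_mem_map (inter_mem hu₀ (d.open_source.mem_nhds hus))
  have h1 := Real.dimH_of_mem_nhds hnhds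
  have h2 := (dimH_mono hcov).trans ((dimH_bUnion htc _).le.trans
    (iSup₂_le fun x hx => hAd x (ht hx)))
  rw [h1] at h2
  exact absurd (by exact_mod_cast h2) (not_le.2 hlt)

end Regular

end JetGpd

/-! ### Slices of submanifolds and images of retractions. -/

namespace JetGpd

section Submanifold

variable {V : Type*} [NormedAddCommGroup V] [NormedSpace ℝ V]
  {M : Type*} [TopologicalSpace M] [ChartedSpace V M]

/-- Near `z`, the set `S` is an embedded submanifold of dimension `d`: there is a parametrisation
`σ` with a smooth left inverse `e` defined on a neighbourhood of `z` in the ambient manifold. -/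
def HasSlice (S : Set M) (z : M) (d : ℕ) : Prop :=
  ∃ (e : M → EuclideanSpace ℝ (Fin d)) (σ : EuclideanSpace ℝ (Fin d) → M),
    EvSmooth 𝓘(ℝ, V) 𝓘(ℝ, EuclideanSpace ℝ (Fin d)) e z ∧
    EvSmooth 𝓘(ℝ, EuclideanSpace ℝ (Fin d)) 𝓘(ℝ, V) σ (e z) ∧ σ (e z) = z ∧
    (∀ᶠ w in 𝓝 z, w ∈ S → σ (e w) = w) ∧ ∀ᶠ a in 𝓝 (e z), σ a ∈ S ∧ e (σ a) = a

/-- A slice only tests points of `S`, so `α` and `β` need to be mutually inverse on `S` and not on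
the ambient manifold. -/
theorem HasSlice.transport {S : Set M} {z z' : M} {d : ℕ} (h : HasSlice (V := V) S z d)
    {α β : M → M} (hα : EvSmooth 𝓘(ℝ, V) 𝓘(ℝ, V) α z') (hβ : EvSmooth 𝓘(ℝ, V) 𝓘(ℝ, V) β z)
    (hαz : α z' = z) (hβz : β z = z') (hαS : ∀ᶠ w in 𝓝 z', w ∈ S → α w ∈ S ∧ β (α w) = w)
    (hβS : ∀ᶠ w in 𝓝 z, w ∈ S → β w ∈ S ∧ α (β w) = w) : HasSlice (V := V) S z' d := by
  obtain ⟨e, σ, he, hσ, hσe, h1, h2⟩ := h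
  have hσt := hσ.tendsto' hσe
  refine ⟨fun w => e (α w), fun a => β (σ a), he.comp' hα hαz, ?_, ?_, ?_, ?_⟩
  · dsimp only; rw [hαz]; exact hβ.comp' hσ hσe
  · dsimp only; rw [hαz, hσe, hβz]
  · filter_upwards [hαS, (hα.tendsto' hαz).eventually h1] with w h3 h4 hw
    rw [h4 (h3 hw).1, (h3 hw).2]
  · dsimp only
    rw [hαz]
    filter_upwards [h2, hσt.eventually hβS] with a h3 h4
    exact ⟨(h4 h3.1).1, by rw [(h4 h3.1).2, h3.2]⟩

section Retraction

variable [FiniteDimensional ℝ V]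

/-- A retraction is linearisable: its derivative `P` at `p` is a projection, and in the coordinates
`φ` the fixed points of `r` near `p` are precisely the range of `P`. -/
theorem exists_slice_of_retraction {r : V → V} {p : V} (hr : ∀ᶠ x in 𝓝 p, ContDiffAt ℝ ∞ r x)
    (hp : r p = p) (hrr : ∀ᶠ x in 𝓝 p, r (r x) = r x) :
    ∃ (d : ℕ) (e : V → EuclideanSpace ℝ (Fin d)) (σ : EuclideanSpace ℝ (Fin d) → V),
      (∀ᶠ x in 𝓝 p, ContDiffAt ℝ ∞ e x) ∧ (∀ᶠ a in 𝓝 (e p), ContDiffAt ℝ ∞ σ a) ∧ σ (e p) = p ∧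
      (∀ᶠ x in 𝓝 p, r x = x → σ (e x) = x) ∧ ∀ᶠ a in 𝓝 (e p), r (σ a) = σ a ∧ e (σ a) = a := by
  have hrp := hr.self_of_nhds
  have hrd : HasFDerivAt r (fderiv ℝ r p) p := (hrp.differentiableAt (by simp)).hasFDerivAt
  have hrt : Tendsto r (𝓝 p) (𝓝 p) := by
    have := hrp.continuousAt
    rwa [ContinuousAt, hp] at this
  set P := fderiv ℝ r p with hP
  have hPP : ∀ v, P (P v) = P v := fun v => by
    have h1 : HasFDerivAt (fun x => r (r x)) (P.comp P) p :=
      HasFDerivAt.comp p (g := r) (by rw [hp]; exact hrd) hrd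
    exact congrArg (fun L => L v) (h1.unique (hrd.congr_of_eventuallyEq hrr))
  -- The derivative of `φ` at `p` is `P² + (1 - P)² = 1`, so `φ` is a local chart.
  let φ : V → V := fun x => P (r x - p) + ((x - r x) - P (x - r x))
  have hφ : ∀ᶠ x in 𝓝 p, ContDiffAt ℝ ∞ φ x := by
    filter_upwards [hr] with x hx
    exact (P.contDiff.contDiffAt.comp x (hx.sub contDiffAt_const)).add
      ((contDiffAt_id.sub hx).sub (P.contDiff.contDiffAt.comp x (contDiffAt_id.sub hx)))
  have hφp : φ p = 0 := by simp [φ, hp]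
  have hφd : HasFDerivAt φ (P.comp P + ((.id ℝ V - P) - P.comp (.id ℝ V - P))) p := by
    refine HasFDerivAt.add (P.hasFDerivAt.comp p (hrd.sub_const p)) ?_
    have h1 : HasFDerivAt (fun x => x - r x) (.id ℝ V - P) p := (hasFDerivAt_id p).sub hrd
    exact h1.sub (P.hasFDerivAt.comp p h1)
  have hinj : ∀ v, fderiv ℝ φ p v = 0 → v = 0 := by
    intro v hv
    rw [hφd.fderiv] at hv
    simpa [hPP] using hv
  obtain ⟨g, hg, hg0, hgφ, hφg⟩ := exists_local_inverse hφ hinj rfl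
  rw [hφp] at hg hg0 hφg
  have hgt : Tendsto g (𝓝 0) (𝓝 p) := by
    have := hg.self_of_nhds.continuousAt
    rwa [ContinuousAt, hg0] at this
  let R : Submodule ℝ V := LinearMap.range (P : V →ₗ[ℝ] V)
  let T : R ≃L[ℝ] EuclideanSpace ℝ (Fin (Module.finrank ℝ R)) := toEuclidean
  let PR : V →L[ℝ] R := P.codRestrict R fun v => ⟨v, rfl⟩
  let e : V → EuclideanSpace ℝ (Fin (Module.finrank ℝ R)) := fun x => T (PR (r x - p))
  let ι : EuclideanSpace ℝ (Fin (Module.finrank ℝ R)) →L[ℝ] V :=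
    R.subtypeL.comp (T.symm : EuclideanSpace ℝ (Fin (Module.finrank ℝ R)) →L[ℝ] R)
  have hιe : ∀ x, ι (e x) = P (r x - p) := fun x => by
    change ((T.symm (T (PR (r x - p))) : R) : V) = _
    rw [T.symm_apply_apply]; rfl
  have hιinj : Function.Injective ι := Subtype.val_injective.comp T.symm.injective
  have hPι : ∀ a, P (ι a) = ι a := fun a => by
    obtain ⟨v, hv⟩ : ∃ v, P v = ι a := (T.symm a).2
    rw [← hv, hPP]
  have hep : e p = 0 := by simp [e, hp]
  have hιt : Tendsto ι (𝓝 (e p)) (𝓝 0) := by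
    have := ι.continuous.tendsto (e p)
    rwa [hep, map_zero, ← hep] at this
  refine ⟨_, e, fun a => g (ι a), ?_, ?_, ?_, ?_, ?_⟩
  · filter_upwards [hr] with x hx
    exact T.contDiff.contDiffAt.comp x
      (PR.contDiff.contDiffAt.comp x (hx.sub contDiffAt_const))
  · filter_upwards [hιt.eventually hg] with a ha
    exact ha.comp a ι.contDiff.contDiffAt
  · dsimp only; rw [hep, map_zero, hg0]
  · filter_upwards [hgφ] with x hx hrx
    rw [hιe]
    have : φ x = P (r x - p) := by simp [φ, hrx]
    rw [← this, hx]
  · have hιg := hgt.comp hιt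
    filter_upwards [hιt.eventually hφg, hιg.eventually hrr, hιg.eventually hgφ,
      hιg.eventually (hrt.eventually hgφ)] with a h1 h2 h3 h4
    simp only [Function.comp_apply] at h2 h3 h4
    set x := g (ι a)
    -- As `φ x` lies in the range of `P`, its component in the range of `1 - P` vanishes. Then `φ (r
    -- x) = φ x`, and local injectivity of `φ` gives `r x = x`.
    have h5 : (x - r x) - P (x - r x) = 0 := by
      have h6 := congrArg P h1
      simp only [φ, map_add, map_sub, hPP, hPι, sub_self, add_zero] at h6
      have h7 : φ x = P (r x - p) + ((x - r x) - P (x - r x)) := rfl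
      rw [h1, map_sub, h6] at h7
      simpa using h7
    have h6 : φ (r x) = φ x := by
      change P (r (r x) - p) + ((r x - r (r x)) - P (r x - r (r x))) =
        P (r x - p) + ((x - r x) - P (x - r x))
      rw [h5, h2]
      simp
    have h7 : r x = x := by rw [← h4, h6, h3]
    refine ⟨h7, hιinj ?_⟩
    have h8 : φ x = P (r x - p) + ((x - r x) - P (x - r x)) := rfl
    rw [hιe, ← h1, h8, h5, add_zero]

/-- The image of a smooth retraction is an embedded submanifold. -/
theorem HasSlice.of_retraction [IsManifold 𝓘(ℝ, V) ∞ M] {S : Set M} {z : M} {ρ : M → M}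
    (hρ : EvSmooth 𝓘(ℝ, V) 𝓘(ℝ, V) ρ z) (hz : ρ z = z) (hS : ∀ᶠ w in 𝓝 z, ρ w ∈ S)
    (hSρ : ∀ᶠ w in 𝓝 z, w ∈ S → ρ w = w) : ∃ d, HasSlice (V := V) S z d := by
  let c := chartAt V z
  have hzc : z ∈ c.source := mem_chart_source V z
  have hczt : c z ∈ c.target := mem_chart_target V z
  have hcz : c.symm (c z) = z := c.left_inv hzc
  have hc : EvSmooth 𝓘(ℝ, V) 𝓘(ℝ, V) c z := evSmooth_chart z z hzc
  have hcs : EvSmooth 𝓘(ℝ, V) 𝓘(ℝ, V) c.symm (c z) := evSmooth_chart_symm z _ hczt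
  have hcst := hcs.tendsto' hcz
  have hρt := hρ.tendsto' hz
  let r : V → V := fun v => c (ρ (c.symm v))
  have hr : EvSmooth 𝓘(ℝ, V) 𝓘(ℝ, V) r (c z) :=
    hc.comp' (hρ.comp' hcs hcz) (by rw [hcz, hz])
  have hrz : r (c z) = c z := by simp only [r, hcz, hz]
  have hrr : ∀ᶠ v in 𝓝 (c z), r (r v) = r v := by
    filter_upwards [hcst.eventually hS, hcst.eventually (hρt.eventually hSρ),
      hcst.eventually (hρt.eventually (c.open_source.mem_nhds hzc))] with v h1 h2 h3
    simp only [r]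
    rw [c.left_inv h3, h2 h1]
  obtain ⟨d, e, σ, he, hσ, hσe, h1, h2⟩ :=
    exists_slice_of_retraction (evSmooth_iff_contDiffAt.1 hr) hrz hrr
  have hσt : Tendsto σ (𝓝 (e (c z))) (𝓝 (c z)) := by
    have := hσ.self_of_nhds.continuousAt
    rwa [ContinuousAt, hσe] at this
  refine ⟨d, fun w => e (c w), fun a => c.symm (σ a),
    (evSmooth_iff_contDiffAt.2 he).comp' hc rfl,
    hcs.comp' (evSmooth_iff_contDiffAt.2 hσ) hσe, by dsimp only; rw [hσe, hcz], ?_, ?_⟩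
  · filter_upwards [hc.tendsto.eventually h1, hSρ, c.open_source.mem_nhds hzc] with w h3 h4 h5 hw
    rw [h3, c.left_inv h5]
    simp only [r]
    rw [c.left_inv h5, h4 hw]
  · filter_upwards [h2, hσt.eventually (hcst.eventually hS), hσt.eventually (c.open_target.mem_nhds
      hczt), hσt.eventually (hcst.eventually (hρt.eventually (c.open_source.mem_nhds hzc)))]
      with a h3 h4 h5 h6
    have h7 : ρ (c.symm (σ a)) = c.symm (σ a) := by
      have := congrArg c.symm h3.1
      simp only [r] at this
      rwa [c.left_inv h6] at this
    refine ⟨h7 ▸ h4, ?_⟩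
    rw [c.right_inv h5, h3.2]

end Retraction

end Submanifold

end JetGpd

/-! ### Manifold structures on subsets and on quotients. -/

namespace JetGpd

section Charts

variable {W : Type*} [NormedAddCommGroup W] [NormedSpace ℝ W] {Q : Type*} [TopologicalSpace Q]

/-- The charted space structure given by a chart around each point. -/
abbrev chartedSpaceOfCharts (c : Q → OpenPartialHomeomorph Q W) (hc : ∀ z, z ∈ (c z).source) :
    ChartedSpace W Q where
  atlas := range c
  chartAt := c
  mem_chart_source := hc
  chart_mem_atlas z := mem_range_self z

theorem isManifold_chartedSpaceOfCharts (c : Q → OpenPartialHomeomorph Q W)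
    (hc : ∀ z, z ∈ (c z).source)
    (h : ∀ z z', ∀ a ∈ (c z).target, (c z).symm a ∈ (c z').source →
      ContDiffAt ℝ ∞ (fun b => c z' ((c z).symm b)) a) :
    @IsManifold ℝ _ W _ _ W _ 𝓘(ℝ, W) ∞ Q _ (chartedSpaceOfCharts c hc) := by
  let _ := chartedSpaceOfCharts c hc
  refine isManifold_of_contDiffOn _ _ _ ?_
  rintro _ _ ⟨z, rfl⟩ ⟨z', rfl⟩
  intro a ha
  have ha' : a ∈ ((c z).symm.trans (c z')).source := by simpa using ha
  rw [OpenPartialHomeomorph.trans_source] at ha'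
  exact (h z z' a ha'.1 ha'.2).contDiffWithinAt

end Charts

section Submanifold

variable {V : Type*} [NormedAddCommGroup V] [NormedSpace ℝ V]
  {M : Type*} [TopologicalSpace M] [ChartedSpace V M]

/-- A subset with slices of constant dimension is a manifold, embedded in the ambient manifold. -/
theorem exists_subtype_manifold {S : Set M} {d : ℕ} (hS : ∀ z ∈ S, HasSlice (V := V) S z d) :
    ∃ (_ : ChartedSpace (EuclideanSpace ℝ (Fin d)) S)
      (_ : IsManifold 𝓘(ℝ, EuclideanSpace ℝ (Fin d)) ∞ S),
      ContMDiff 𝓘(ℝ, EuclideanSpace ℝ (Fin d)) 𝓘(ℝ, V) ∞ (Subtype.val : S → M) ∧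
      ∀ z : S, ∃ ρ : M → S, EvSmooth 𝓘(ℝ, V) 𝓘(ℝ, EuclideanSpace ℝ (Fin d)) ρ z ∧
        ∀ᶠ w in 𝓝 (z : M), w ∈ S → (ρ w : M) = w := by
  classical
  choose! e σ he hσ hσe hSσ hσS using hS
  have hO : ∀ z ∈ S, ∃ O, IsOpen O ∧ z ∈ O ∧ ∀ w ∈ O,
      ContMDiffAt 𝓘(ℝ, V) 𝓘(ℝ, EuclideanSpace ℝ (Fin d)) ∞ (e z) w ∧ (w ∈ S → σ z (e z w) = w) :=
    fun z hz => by
      obtain ⟨O, h1, h2, h3⟩ := eventually_nhds_iff.1 ((he z hz).and (hSσ z hz))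
      exact ⟨O, h2, h3, h1⟩
  choose! O hOo hzO hOe using hO
  have hT : ∀ z ∈ S, ∃ T, IsOpen T ∧ e z z ∈ T ∧ ∀ a ∈ T,
      ContMDiffAt 𝓘(ℝ, EuclideanSpace ℝ (Fin d)) 𝓘(ℝ, V) ∞ (σ z) a ∧
        (σ z a ∈ S ∧ e z (σ z a) = a) ∧ σ z a ∈ O z := fun z hz => by
    obtain ⟨T, h1, h2, h3⟩ := eventually_nhds_iff.1 ((hσ z hz).and ((hσS z hz).and
      (((hσ z hz).tendsto' (hσe z hz)).eventually ((hOo z hz).mem_nhds (hzO z hz)))))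
    exact ⟨T, h2, h3, h1⟩
  choose! T hTo hzT hTσ using hT
  have heO : ∀ z ∈ S, ContinuousOn (e z) (O z) := fun z hz w hw =>
    (hOe z hz w hw).1.continuousAt.continuousWithinAt
  let c : S → OpenPartialHomeomorph S (EuclideanSpace ℝ (Fin d)) := fun z =>
    { toFun := fun w => e z w
      -- The default `z` is never taken on the target `T z`, where `σ z` has values in `S`.
      invFun := fun a => if h : σ z a ∈ S then ⟨σ z a, h⟩ else z
      source := {w | (w : M) ∈ O z ∧ e z w ∈ T z}
      target := T z
      map_source' := fun w hw => hw.2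
      map_target' := fun a ha => by
        have h := hTσ z z.2 a ha
        rw [dif_pos h.2.1.1]
        exact ⟨h.2.2, by dsimp only; rwa [h.2.1.2]⟩
      left_inv' := fun w hw => by
        have h := (hOe z z.2 w hw.1).2 w.2
        rw [dif_pos (by rw [h]; exact w.2)]
        exact Subtype.ext h
      right_inv' := fun a ha => by
        have h := hTσ z z.2 a ha
        rw [dif_pos h.2.1.1]
        exact h.2.1.2
      open_source := ((heO z z.2).isOpen_inter_preimage (hOo z z.2) (hTo z z.2)).preimage
        continuous_subtype_val
      open_target := hTo z z.2
      continuousOn_toFun := (heO z z.2).comp continuous_subtype_val.continuousOn fun w hw => hw.1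
      continuousOn_invFun := by
        rw [Topology.IsInducing.subtypeVal.continuousOn_iff]
        refine ContinuousOn.congr (f := σ z)
          (fun a ha => (hTσ z z.2 a ha).1.continuousAt.continuousWithinAt) fun a ha => ?_
        simp only [Function.comp_apply]
        rw [dif_pos (hTσ z z.2 a ha).2.1.1] }
  have hc : ∀ z, z ∈ (c z).source := fun z => ⟨hzO z z.2, hzT z z.2⟩
  have hcs : ∀ z : S, ∀ a ∈ T z, ((c z).symm a : M) = σ z a := fun z a ha => by
    change ((if h : σ z a ∈ S then (⟨σ z a, h⟩ : S) else z : S) : M) = _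
    rw [dif_pos (hTσ z z.2 a ha).2.1.1]
  have hman := isManifold_chartedSpaceOfCharts c hc fun z z' a ha haz => by
    have h1 : EvSmooth 𝓘(ℝ, EuclideanSpace ℝ (Fin d)) 𝓘(ℝ, V) (σ z) a :=
      eventually_of_mem ((hTo z z.2).mem_nhds ha) fun b hb => (hTσ z z.2 b hb).1
    have h2 : σ z a ∈ O z' := by rw [← hcs z a ha]; exact haz.1
    have h3 : EvSmooth 𝓘(ℝ, V) 𝓘(ℝ, EuclideanSpace ℝ (Fin d)) (e z') (σ z a) :=
      eventually_of_mem ((hOo z' z'.2).mem_nhds h2) fun b hb => (hOe z' z'.2 b hb).1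
    have h4 := contMDiffAt_iff_contDiffAt.1 (h3.comp h1).contMDiffAt
    refine h4.congr_of_eventuallyEq ?_
    filter_upwards [(hTo z z.2).mem_nhds ha] with b hb
    exact congrArg (e z') (hcs z b hb)
  let _ := chartedSpaceOfCharts c hc
  -- The map `ρ` is defined and smooth on an ambient neighbourhood and fixes the points of `S`; it
  -- turns smoothness of maps into `M` with values in `S` into smoothness into the manifold `S`.
  refine ⟨chartedSpaceOfCharts c hc, hman, fun z => ?_, fun z => ⟨fun w => (c z).symm (e z w), ?_, ?_⟩⟩
  · have h1 : EvSmooth 𝓘(ℝ, EuclideanSpace ℝ (Fin d)) 𝓘(ℝ, EuclideanSpace ℝ (Fin d)) (c z) z :=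
      evSmooth_chart z z (mem_chart_source _ z)
    have h2 : EvSmooth 𝓘(ℝ, EuclideanSpace ℝ (Fin d)) 𝓘(ℝ, V) (fun w => σ z (c z w)) z :=
      (hσ z z.2).comp' h1 rfl
    refine (h2.congr ?_).contMDiffAt
    filter_upwards [(c z).open_source.mem_nhds (hc z)] with w hw
    exact ((hOe z z.2 w hw.1).2 w.2).symm
  · exact (evSmooth_chart_symm z (c z z) (mem_chart_target _ z)).comp' (he z z.2) rfl
  · filter_upwards [(he z z.2).tendsto.eventually ((hTo z z.2).mem_nhds (hzT z z.2)),
      (hOo z z.2).mem_nhds (hzO z z.2)] with w h1 h2 hw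
    rw [hcs z _ h1, (hOe z z.2 w h2).2 hw]

end Submanifold

section Quotient

variable {V : Type*} [NormedAddCommGroup V] [NormedSpace ℝ V]
  {M : Type*} [TopologicalSpace M] [ChartedSpace V M]
  {W : Type*} [NormedAddCommGroup W] [NormedSpace ℝ W]

/-- Equivalent points are related by local smooth maps preserving the equivalence classes. -/
def Setoid.HasMoves (V : Type*) [NormedAddCommGroup V] [NormedSpace ℝ V] {M : Type*}
    [TopologicalSpace M] [ChartedSpace V M] (r : Setoid M) : Prop :=
  ∀ g g' : M, r g g' → ∃ κ : M → M, EvSmooth 𝓘(ℝ, V) 𝓘(ℝ, V) κ g ∧ κ g = g' ∧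
    ∀ᶠ w in 𝓝 g, r w (κ w)

/-- Near `g`, there is a local slice `σ` for the equivalence relation, parametrised by `W`. -/
def Setoid.HasCrossSection (V W : Type*) [NormedAddCommGroup V] [NormedSpace ℝ V]
    [NormedAddCommGroup W] [NormedSpace ℝ W] {M : Type*}
    [TopologicalSpace M] [ChartedSpace V M] (r : Setoid M) (g : M) : Prop :=
  ∃ (e : M → W) (σ : W → M), EvSmooth 𝓘(ℝ, V) 𝓘(ℝ, W) e g ∧
    EvSmooth 𝓘(ℝ, W) 𝓘(ℝ, V) σ (e g) ∧ σ (e g) = g ∧ (∀ᶠ w in 𝓝 g, r (σ (e w)) w) ∧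
    ∃ T ∈ 𝓝 (e g), ∀ a ∈ T, ∀ b ∈ T, r (σ a) (σ b) → a = b

/-- The saturation of an open set is open: a move carrying `w` into the set carries a neighbourhood
of `w` into it as well. -/
theorem Setoid.HasMoves.isOpenQuotientMap {r : Setoid M} (hr : Setoid.HasMoves V r) :
    IsOpenQuotientMap (Quotient.mk r) := by
  refine ⟨Quotient.mk_surjective, continuous_quot_mk, fun O hO => ?_⟩
  rw [isOpen_coinduced, isOpen_iff_mem_nhds]
  rintro w ⟨w', hw', hww⟩
  obtain ⟨κ, h1, h2, h3⟩ := hr w w' (Quotient.exact hww.symm)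
  filter_upwards [(h1.tendsto' h2).eventually (hO.mem_nhds hw'), h3] with x h4 h5
  exact ⟨_, h4, (Quotient.sound h5).symm⟩

/-- The charts invert `a ↦ [σ a]`. A change of charts moves a point of one slice onto another slice
and reads off its parameter, so it is smooth. One representative with a cross section suffices for
each class, as moves reach the others. -/
theorem Setoid.HasMoves.exists_quotient_manifold {r : Setoid M} (hr : Setoid.HasMoves V r)
    (hs : ∀ g, ∃ g', r g g' ∧ Setoid.HasCrossSection V W r g') :
    ∃ (_ : ChartedSpace W (Quotient r)) (_ : IsManifold 𝓘(ℝ, W) ∞ (Quotient r)),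
      ContMDiff 𝓘(ℝ, V) 𝓘(ℝ, W) ∞ (Quotient.mk r) ∧
      ∀ g, ∃ η : Quotient r → M, EvSmooth 𝓘(ℝ, W) 𝓘(ℝ, V) η (Quotient.mk r g) ∧
        η (Quotient.mk r g) = g ∧ ∀ᶠ u in 𝓝 (Quotient.mk r g), Quotient.mk r (η u) = u := by
  have hs' : ∀ z : Quotient r, ∃ g', Quotient.mk r g' = z ∧ Setoid.HasCrossSection V W r g' := by
    intro z
    induction z using Quotient.ind with
    | _ g =>
      obtain ⟨g', h1, h2⟩ := hs g
      exact ⟨g', (Quotient.sound h1).symm, h2⟩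
  choose g hg e σ he hσ hσe hrσ T₀ hT₀ hT₀' using hs'
  have hT : ∀ z, ∃ T, IsOpen T ∧ e z (g z) ∈ T ∧ ∀ a ∈ T,
      EvSmooth 𝓘(ℝ, W) 𝓘(ℝ, V) (σ z) a ∧ EvSmooth 𝓘(ℝ, V) 𝓘(ℝ, W) (e z) (σ z a) ∧
      (∀ᶠ w in 𝓝 (σ z a), r (σ z (e z w)) w) ∧ e z (σ z a) = a ∧ a ∈ T₀ z := fun z => by
    have h1 := (hσ z).tendsto' (hσe z)
    have h2 : Tendsto (fun a => e z (σ z a)) (𝓝 (e z (g z))) (𝓝 (e z (g z))) :=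
      (he z).tendsto.comp h1
    -- The points `σ (e (σ a))` and `σ a` are equivalent, and the slice meets each class at most
    -- once.
    have h3 : ∀ᶠ a in 𝓝 (e z (g z)), e z (σ z a) = a := by
      filter_upwards [h1.eventually (hrσ z), h2.eventually (hT₀ z), hT₀ z] with a h3 h4 h5
      exact hT₀' z _ h4 _ h5 h3
    obtain ⟨T, h4, h5, h6⟩ := eventually_nhds_iff.1 ((hσ z).eventually.and
      ((h1.eventually (he z).eventually).and ((h1.eventually (hrσ z).eventually_nhds).and
        (h3.and (hT₀ z)))))
    exact ⟨T, h5, h6, h4⟩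
  choose T hTo hzT hTσ using hT
  have hinj : ∀ z, InjOn (fun a => Quotient.mk r (σ z a)) (T z) := fun z a ha b hb hab =>
    hT₀' z a (hTσ z a ha).2.2.2.2 b (hTσ z b hb).2.2.2.2 (Quotient.exact hab)
  -- Around an arbitrary point `w` of the class of `σ z a`, the smooth function `x ↦ e z (κ x)`
  -- gives the chart coordinate of the class of `x`.
  have hslide : ∀ z, ∀ a ∈ T z, ∀ w, r w (σ z a) → ∃ κ : M → M, EvSmooth 𝓘(ℝ, V) 𝓘(ℝ, V) κ w ∧
      κ w = σ z a ∧ EvSmooth 𝓘(ℝ, V) 𝓘(ℝ, W) (fun x => e z (κ x)) w ∧ e z (κ w) = a ∧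
      ∀ᶠ x in 𝓝 w, r x (σ z (e z (κ x))) := by
    intro z a ha w hw
    obtain ⟨κ, h1, h2, h3⟩ := hr w _ hw
    obtain ⟨-, h4, h5, h6, -⟩ := hTσ z a ha
    refine ⟨κ, h1, h2, h4.comp' h1 h2, by rw [h2, h6], ?_⟩
    filter_upwards [h3, (h1.tendsto' h2).eventually h5] with x h7 h8
    exact r.trans h7 (r.symm h8)
  let c' : ∀ z, OpenPartialHomeomorph W (Quotient r) := fun z =>
    OpenPartialHomeomorph.ofContinuousOpenRestrict
      ((hinj z).bijOn_image.toPartialEquiv _ _ _)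
      (fun a ha => (hr.isOpenQuotientMap.continuous.continuousAt.comp
        (hTσ z a ha).1.continuousAt).continuousWithinAt)
      (by
        intro A hA
        obtain ⟨B, hB, rfl⟩ := isOpen_induced_iff.1 hA
        rw [isOpen_coinduced, isOpen_iff_mem_nhds]
        rintro w ⟨⟨a, ha⟩, haB, hw⟩
        obtain ⟨κ, h1, h2, h3, h4, h5⟩ := hslide z a ha w (Quotient.exact hw.symm)
        filter_upwards [h5, (h3.tendsto' h4).eventually ((hTo z).mem_nhds ha),
          (h3.tendsto' h4).eventually (hB.mem_nhds haB)] with x h6 h7 h8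
        exact ⟨⟨_, h7⟩, h8, (Quotient.sound h6).symm⟩)
      (hTo z)
  let c := fun z => (c' z).symm
  have hct : ∀ z, (c z).target = T z := fun z => rfl
  have hcs : ∀ z a, (c z).symm a = Quotient.mk r (σ z a) := fun z a => rfl
  have hzg : ∀ z, Quotient.mk r (σ z (e z (g z))) = z := fun z => by rw [hσe, hg]
  have hc : ∀ z, z ∈ (c z).source := fun z => by
    have := (c z).map_target (hzT z)
    rwa [hcs, hzg] at this
  have hcz : ∀ z, c z z = e z (g z) := fun z => by
    have := (c z).right_inv (hzT z)
    rwa [hcs, hzg] at this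
  have hcσ : ∀ z, ∀ a ∈ T z, c z (Quotient.mk r (σ z a)) = a := fun z a ha => by
    have := (c z).right_inv (x := a) ha
    rwa [hcs] at this
  have hman := isManifold_chartedSpaceOfCharts c hc fun z z' a ha haz => by
    rw [hcs] at haz
    obtain ⟨h1, h2⟩ : c z' (Quotient.mk r (σ z a)) ∈ T z' ∧
      Quotient.mk r (σ z' (c z' (Quotient.mk r (σ z a)))) = Quotient.mk r (σ z a) :=
      ⟨(c z').map_source haz, (c z').left_inv haz⟩
    obtain ⟨κ, k1, k2, k3, k4, k5⟩ := hslide z' _ h1 (σ z a) (Quotient.exact h2.symm)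
    have hσa := (hTσ z a ha).1
    have k6 := k3.comp hσa
    refine (contMDiffAt_iff_contDiffAt.1 k6.contMDiffAt).congr_of_eventuallyEq ?_
    have k7 := k6.tendsto' k4
    filter_upwards [hσa.tendsto.eventually k5, k7.eventually ((hTo z').mem_nhds h1)] with b h3 h4
    rw [hcs, Quotient.sound h3]
    exact hcσ z' _ h4
  let _ := chartedSpaceOfCharts c hc
  refine ⟨chartedSpaceOfCharts c hc, hman, fun w => ?_, fun w => ?_⟩
  · set z := Quotient.mk r w with hz
    obtain ⟨κ, h1, h2, h3, h4, h5⟩ := hslide z _ (hzT z) w (Quotient.exact (by rw [hzg]))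
    have h6 : EvSmooth 𝓘(ℝ, W) 𝓘(ℝ, W) (c z).symm (e z (g z)) :=
      evSmooth_chart_symm z (e z (g z)) (hzT z)
    refine ((h6.comp' h3 h4).congr ?_).contMDiffAt
    filter_upwards [h5] with x h7
    rw [hcs]
    exact Quotient.sound h7
  · set z := Quotient.mk r w with hz
    obtain ⟨κ, h1, h2, h3⟩ := hr (g z) w (Quotient.exact (hg z))
    have h4 : EvSmooth 𝓘(ℝ, W) 𝓘(ℝ, W) (c z) z := evSmooth_chart z z (mem_chart_source _ z)
    have h5 : EvSmooth 𝓘(ℝ, W) 𝓘(ℝ, V) (fun u => σ z (c z u)) z := (hσ z).comp' h4 (hcz z)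
    have h6 : σ z (c z z) = g z := by rw [hcz, hσe]
    -- The slice gives a section through `g z`; the move `κ` makes it pass through the prescribed
    -- `w`.
    refine ⟨fun u => κ (σ z (c z u)), h1.comp' h5 h6, by dsimp only; rw [h6, h2], ?_⟩
    filter_upwards [(h5.tendsto' h6).eventually h3, (c z).open_source.mem_nhds (hc z)] with u h7 h8
    rw [← Quotient.sound h7]
    exact (c z).left_inv h8

end Quotient

end JetGpd

/-! ### Transitive Lie groupoids and their actions. -/

namespace JetGpd

/-- Any two points have diffeomorphic neighbourhoods. -/
theorem exists_local_translation {E : Type*} [NormedAddCommGroup E] [NormedSpace ℝ E]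
    {X : Type*} [TopologicalSpace X] [ChartedSpace E X] [IsManifold 𝓘(ℝ, E) ∞ X] (x y : X) :
    ∃ l l' : X → X, EvSmooth 𝓘(ℝ, E) 𝓘(ℝ, E) l x ∧ EvSmooth 𝓘(ℝ, E) 𝓘(ℝ, E) l' y ∧ l x = y ∧
      l' y = x ∧ (∀ᶠ z in 𝓝 x, l' (l z) = z) ∧ ∀ᶠ z in 𝓝 y, l (l' z) = z := by
  have key : ∀ x y : X, ∃ l : X → X, EvSmooth 𝓘(ℝ, E) 𝓘(ℝ, E) l x ∧ l x = y ∧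
      ∀ᶠ z in 𝓝 x, chartAt E y (l z) = chartAt E x z + (chartAt E y y - chartAt E x x) := by
    intro x y
    have h1 := evSmooth_chart (V := E) x x (mem_chart_source E x)
    have hP : ContDiff ℝ ∞ fun v : E => v + (chartAt E y y - chartAt E x x) := by fun_prop
    have h2 : EvSmooth 𝓘(ℝ, E) 𝓘(ℝ, E)
        (fun z => chartAt E x z + (chartAt E y y - chartAt E x x)) x :=
      (hP.contMDiff.evSmooth _).comp' h1 rfl
    have h3 : chartAt E x x + (chartAt E y y - chartAt E x x) = chartAt E y y := by abel
    refine ⟨fun z => (chartAt E y).symm (chartAt E x z + (chartAt E y y - chartAt E x x)),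
      (evSmooth_chart_symm y _ (mem_chart_target E y)).comp' h2 h3, ?_, ?_⟩
    · dsimp only
      rw [h3, (chartAt E y).left_inv (mem_chart_source E y)]
    · filter_upwards [(h2.tendsto' h3).eventually
        ((chartAt E y).open_target.mem_nhds (mem_chart_target E y))] with z hz
      exact (chartAt E y).right_inv hz
  obtain ⟨l, h1, h2, h3⟩ := key x y
  obtain ⟨l', k1, k2, k3⟩ := key y x
  have inv : ∀ {x y : X} {l l' : X → X}, EvSmooth 𝓘(ℝ, E) 𝓘(ℝ, E) l x → l x = y →
      EvSmooth 𝓘(ℝ, E) 𝓘(ℝ, E) l' y → l' y = x →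
      (∀ᶠ z in 𝓝 x, chartAt E y (l z) = chartAt E x z + (chartAt E y y - chartAt E x x)) →
      (∀ᶠ z in 𝓝 y, chartAt E x (l' z) = chartAt E y z + (chartAt E x x - chartAt E y y)) →
      ∀ᶠ z in 𝓝 x, l' (l z) = z := by
    intro x y l l' h1 h2 k1 k2 h3 k3
    have h4 := h1.tendsto' h2
    have h5 := (k1.tendsto' k2).comp h4
    have hx := (chartAt E x).open_source.mem_nhds (mem_chart_source E x)
    filter_upwards [h3, h4.eventually k3, h5.eventually hx, hx] with z e1 e2 e3 e4
    refine (chartAt E x).injOn e3 e4 ?_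
    simp only [Function.comp_apply, e2, e1]
    abel
  exact ⟨l, l', h1, k1, h2, k2, inv h1 h2 k1 k2 h3 k3, inv k1 k2 h1 h2 k3 h3⟩

/-- A transitive Lie groupoid with total space the manifold `M` over the manifold `X`. -/
structure LieGpd (E V X M : Type*) [NormedAddCommGroup E] [NormedSpace ℝ E]
    [NormedAddCommGroup V] [NormedSpace ℝ V] [TopologicalSpace X] [ChartedSpace E X]
    [TopologicalSpace M] [ChartedSpace V M] where
  src : M → X
  tgt : M → X
  one : X → M
  mul : M → M → M
  inv : M → M
  contMDiff_src : ContMDiff 𝓘(ℝ, V) 𝓘(ℝ, E) ∞ src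
  contMDiff_tgt : ContMDiff 𝓘(ℝ, V) 𝓘(ℝ, E) ∞ tgt
  contMDiff_one : ContMDiff 𝓘(ℝ, E) 𝓘(ℝ, V) ∞ one
  contMDiff_inv : ContMDiff 𝓘(ℝ, V) 𝓘(ℝ, V) ∞ inv
  contMDiffOn_mul : ContMDiffOn (𝓘(ℝ, V).prod 𝓘(ℝ, V)) 𝓘(ℝ, V) ∞
    (fun z : M × M => mul z.1 z.2) {z | src z.1 = tgt z.2}
  src_one : ∀ x, src (one x) = x
  tgt_one : ∀ x, tgt (one x) = x
  src_inv : ∀ g, src (inv g) = tgt g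
  tgt_inv : ∀ g, tgt (inv g) = src g
  src_mul : ∀ {g h}, src g = tgt h → src (mul g h) = src h
  tgt_mul : ∀ {g h}, src g = tgt h → tgt (mul g h) = tgt g
  mul_assoc : ∀ {f g h}, src f = tgt g → src g = tgt h → mul (mul f g) h = mul f (mul g h)
  mul_one : ∀ g, mul g (one (src g)) = g
  one_mul : ∀ g, mul (one (tgt g)) g = g
  inv_mul : ∀ g, mul (inv g) g = one (src g)
  mul_inv : ∀ g, mul g (inv g) = one (tgt g)
  exists_section : ∀ g, ∃ b : X × X → M, EvSmooth (𝓘(ℝ, E).prod 𝓘(ℝ, E)) 𝓘(ℝ, V) b (src g, tgt g) ∧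
    b (src g, tgt g) = g ∧ ∀ᶠ p in 𝓝 (src g, tgt g), src (b p) = p.1 ∧ tgt (b p) = p.2
  exists_mem : ∀ x y, ∃ g, src g = x ∧ tgt g = y

variable {E V X M W F : Type*} [NormedAddCommGroup E] [NormedSpace ℝ E]
    [NormedAddCommGroup V] [NormedSpace ℝ V] [TopologicalSpace X] [ChartedSpace E X]
    [TopologicalSpace M] [ChartedSpace V M] [NormedAddCommGroup W] [NormedSpace ℝ W]
    [TopologicalSpace F] [ChartedSpace W F]

/-- A smooth right action of a groupoid on a manifold over its base. -/
structure GpdAction (G : LieGpd E V X M) (W F : Type*) [NormedAddCommGroup W] [NormedSpace ℝ W]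
    [TopologicalSpace F] [ChartedSpace W F] where
  proj : F → X
  contMDiff_proj : ContMDiff 𝓘(ℝ, W) 𝓘(ℝ, E) ∞ proj
  act : F → M → F
  contMDiffOn_act : ContMDiffOn (𝓘(ℝ, W).prod 𝓘(ℝ, V)) 𝓘(ℝ, W) ∞
    (fun z : F × M => act z.1 z.2) {z | proj z.1 = G.tgt z.2}
  proj_act : ∀ {u g}, proj u = G.tgt g → proj (act u g) = G.src g
  act_mul : ∀ {u g h}, proj u = G.tgt g → G.src g = G.tgt h →
    act u (G.mul g h) = act (act u g) h
  act_one : ∀ u, act u (G.one (proj u)) = u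

/-- Products and actions are smooth only on a fibre product, which need not be open. Families with
values in the fibre product are nevertheless smooth in the full sense. -/
theorem EvSmooth.comp_of_mem {E₁ H₁ M₁ E₂ H₂ M₂ E₃ H₃ M₃ : Type*}
    [NormedAddCommGroup E₁] [NormedSpace ℝ E₁] [TopologicalSpace H₁] [TopologicalSpace M₁]
    [ChartedSpace H₁ M₁] [NormedAddCommGroup E₂] [NormedSpace ℝ E₂] [TopologicalSpace H₂]
    [TopologicalSpace M₂] [ChartedSpace H₂ M₂] [NormedAddCommGroup E₃] [NormedSpace ℝ E₃]
    [TopologicalSpace H₃] [TopologicalSpace M₃] [ChartedSpace H₃ M₃]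
    {I₁ : ModelWithCorners ℝ E₁ H₁} {I₂ : ModelWithCorners ℝ E₂ H₂} {I₃ : ModelWithCorners ℝ E₃ H₃}
    {g : M₂ → M₃} {f : M₁ → M₂} {x : M₁} {s : Set M₂} (hg : ContMDiffOn I₂ I₃ ∞ g s)
    (hf : EvSmooth I₁ I₂ f x) (hs : ∀ᶠ y in 𝓝 x, f y ∈ s) :
    EvSmooth I₁ I₃ (fun y => g (f y)) x := by
  filter_upwards [hf, hs.eventually_nhds] with y h1 h2
  have h3 := (hg (f y) h2.self_of_nhds).comp (s := {z | f z ∈ s}) y h1.contMDiffWithinAt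
    fun z hz => hz
  exact h3.contMDiffAt h2

namespace LieGpd

variable (G : LieGpd E V X M)

attribute [simp] src_one tgt_one src_inv tgt_inv

theorem continuous_src : Continuous G.src := G.contMDiff_src.continuous

theorem continuous_tgt : Continuous G.tgt := G.contMDiff_tgt.continuous

variable {G}

theorem inv_mul_cancel {g h : M} (H : G.src g = G.tgt h) : G.mul (G.inv g) (G.mul g h) = h := by
  rw [← G.mul_assoc (G.src_inv g) H, G.inv_mul, H, G.one_mul]

theorem mul_inv_cancel {g h : M} (H : G.tgt g = G.tgt h) : G.mul g (G.mul (G.inv g) h) = h := by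
  rw [← G.mul_assoc (G.tgt_inv g).symm (by rw [G.src_inv, H]), G.mul_inv, H, G.one_mul]

theorem mul_mul_inv {g h : M} (H : G.src g = G.tgt h) : G.mul (G.mul g h) (G.inv h) = g := by
  rw [G.mul_assoc H (G.tgt_inv h).symm, G.mul_inv, ← H, G.mul_one]

theorem mul_inv_mul {g h : M} (H : G.src g = G.src h) : G.mul (G.mul g (G.inv h)) h = g := by
  rw [G.mul_assoc (by rw [H, G.tgt_inv]) (G.src_inv h), G.inv_mul, ← H, G.mul_one]

theorem inv_inv (g : M) : G.inv (G.inv g) = g := by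
  have := G.mul_mul_inv (g := g) (h := G.inv g) (G.tgt_inv g).symm
  rw [G.mul_inv] at this
  have h2 := G.one_mul (G.inv (G.inv g))
  rw [G.tgt_inv, G.src_inv, this] at h2
  exact h2.symm

theorem inv_one (x : X) : G.inv (G.one x) = G.one x := by
  have h := G.mul_one (G.inv (G.one x))
  rw [G.src_inv, G.tgt_one] at h
  have h2 := G.inv_mul (G.one x)
  rw [G.src_one] at h2
  rw [← h, h2]

theorem eq_inv_of_mul_eq_one {g h : M} (H : G.src g = G.tgt h) (e : G.mul g h = G.one (G.tgt g)) :
    h = G.inv g := by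
  have h1 := G.inv_mul_cancel H
  have h2 := G.mul_one (G.inv g)
  rw [G.src_inv] at h2
  rw [← h1, e, h2]

theorem mul_inv_rev {g h : M} (H : G.src g = G.tgt h) :
    G.inv (G.mul g h) = G.mul (G.inv h) (G.inv g) := by
  have H1 : G.src (G.inv h) = G.tgt (G.inv g) := by rw [G.src_inv, G.tgt_inv, H]
  have H2 : G.src (G.mul g h) = G.tgt (G.mul (G.inv h) (G.inv g)) := by
    rw [G.src_mul H, G.tgt_mul H1, G.tgt_inv]
  refine (G.eq_inv_of_mul_eq_one H2 ?_).symm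
  rw [← G.mul_assoc (by rw [G.src_mul H, G.tgt_inv]) H1, G.mul_mul_inv H, G.mul_inv, G.tgt_mul H]

section Smooth

variable {E₁ H₁ M₁ : Type*} [NormedAddCommGroup E₁] [NormedSpace ℝ E₁] [TopologicalSpace H₁]
  [TopologicalSpace M₁] [ChartedSpace H₁ M₁] {I₁ : ModelWithCorners ℝ E₁ H₁} {x : M₁}
  {f g : M₁ → M}

theorem evSmooth_mul (hf : EvSmooth I₁ 𝓘(ℝ, V) f x) (hg : EvSmooth I₁ 𝓘(ℝ, V) g x)
    (h : ∀ᶠ y in 𝓝 x, G.src (f y) = G.tgt (g y)) :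
    EvSmooth I₁ 𝓘(ℝ, V) (fun y => G.mul (f y) (g y)) x :=
  EvSmooth.comp_of_mem G.contMDiffOn_mul (hf.prodMk hg) h

theorem evSmooth_inv (hf : EvSmooth I₁ 𝓘(ℝ, V) f x) :
    EvSmooth I₁ 𝓘(ℝ, V) (fun y => G.inv (f y)) x :=
  (G.contMDiff_inv.evSmooth _).comp hf

theorem evSmooth_src (hf : EvSmooth I₁ 𝓘(ℝ, V) f x) :
    EvSmooth I₁ 𝓘(ℝ, E) (fun y => G.src (f y)) x :=
  (G.contMDiff_src.evSmooth _).comp hf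

theorem evSmooth_tgt (hf : EvSmooth I₁ 𝓘(ℝ, V) f x) :
    EvSmooth I₁ 𝓘(ℝ, E) (fun y => G.tgt (f y)) x :=
  (G.contMDiff_tgt.evSmooth _).comp hf

end Smooth

/-- A smooth local family of arrows with given sources and targets. -/
theorem exists_section_comp (g : M) {l m : X → X} {x : X} (hl : EvSmooth 𝓘(ℝ, E) 𝓘(ℝ, E) l x)
    (hm : EvSmooth 𝓘(ℝ, E) 𝓘(ℝ, E) m x) (hlx : l x = G.src g) (hmx : m x = G.tgt g) :
    ∃ b : X → M, EvSmooth 𝓘(ℝ, E) 𝓘(ℝ, V) b x ∧ b x = g ∧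
      ∀ᶠ z in 𝓝 x, G.src (b z) = l z ∧ G.tgt (b z) = m z := by
  obtain ⟨b, h1, h2, h3⟩ := G.exists_section g
  have h4 : (l x, m x) = (G.src g, G.tgt g) := by rw [hlx, hmx]
  have h5 := hl.prodMk hm
  exact ⟨fun z => b (l z, m z), h1.comp' h5 h4, by dsimp only; rw [h4, h2],
    (h5.tendsto' h4).eventually h3⟩

theorem exists_section_from (g : M) : ∃ b : X → M, EvSmooth 𝓘(ℝ, E) 𝓘(ℝ, V) b (G.tgt g) ∧
    b (G.tgt g) = g ∧ ∀ᶠ z in 𝓝 (G.tgt g), G.src (b z) = G.src g ∧ G.tgt (b z) = z :=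
  exists_section_comp g (evSmooth_const _ _) (evSmooth_id _) rfl rfl

/-- A local bisection through a given arrow. -/
theorem exists_bisection [IsManifold 𝓘(ℝ, E) ∞ X] (g : M) : ∃ (b : X → M) (l l' : X → X),
    EvSmooth 𝓘(ℝ, E) 𝓘(ℝ, V) b (G.tgt g) ∧
    b (G.tgt g) = g ∧ (∀ᶠ z in 𝓝 (G.tgt g), G.src (b z) = l z ∧ G.tgt (b z) = z) ∧
    EvSmooth 𝓘(ℝ, E) 𝓘(ℝ, E) l (G.tgt g) ∧ EvSmooth 𝓘(ℝ, E) 𝓘(ℝ, E) l' (G.src g) ∧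
    l (G.tgt g) = G.src g ∧ l' (G.src g) = G.tgt g ∧ (∀ᶠ z in 𝓝 (G.tgt g), l' (l z) = z) ∧
    ∀ᶠ z in 𝓝 (G.src g), l (l' z) = z := by
  obtain ⟨l, l', h1, h2, h3, h4, h5, h6⟩ := exists_local_translation (E := E) (G.tgt g) (G.src g)
  obtain ⟨b, k1, k2, k3⟩ := exists_section_comp g h1 (evSmooth_id _) h3 rfl
  exact ⟨b, l, l', k1, k2, k3, h1, h2, h3, h4, h5, h6⟩

end LieGpd

namespace GpdAction

variable {G : LieGpd E V X M} (A : GpdAction G W F)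

variable {A} in
theorem evSmooth_act {E₁ H₁ M₁ : Type*} [NormedAddCommGroup E₁] [NormedSpace ℝ E₁]
    [TopologicalSpace H₁] [TopologicalSpace M₁] [ChartedSpace H₁ M₁] {I₁ : ModelWithCorners ℝ E₁ H₁}
    {x : M₁} {f : M₁ → F} {g : M₁ → M} (hf : EvSmooth I₁ 𝓘(ℝ, W) f x)
    (hg : EvSmooth I₁ 𝓘(ℝ, V) g x) (h : ∀ᶠ y in 𝓝 x, A.proj (f y) = G.tgt (g y)) :
    EvSmooth I₁ 𝓘(ℝ, W) (fun y => A.act (f y) (g y)) x :=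
  EvSmooth.comp_of_mem A.contMDiffOn_act (hf.prodMk hg) h

variable {A}

theorem act_act_inv {u : F} {g : M} (h : A.proj u = G.tgt g) :
    A.act (A.act u g) (G.inv g) = u := by
  rw [← A.act_mul h (G.tgt_inv g).symm, G.mul_inv, ← h, A.act_one]

theorem act_inv_act {u : F} {g : M} (h : A.proj u = G.src g) :
    A.act (A.act u (G.inv g)) g = u := by
  rw [← A.act_mul (by rw [h, G.tgt_inv]) (G.src_inv g), G.inv_mul, ← h, A.act_one]

variable (A) in
/-- Each isotropy group acts transitively on the fibre. -/
def IsHomogeneous : Prop :=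
  ∀ u v : F, A.proj u = A.proj v → ∃ g, G.src g = A.proj u ∧ G.tgt g = A.proj u ∧ A.act u g = v

/-- Any arrow between the base points brings `u` into the fibre of `v`, and homogeneity of that
fibre does the rest. -/
theorem IsHomogeneous.exists_act_eq (hA : A.IsHomogeneous) (u v : F) :
    ∃ g, G.tgt g = A.proj u ∧ G.src g = A.proj v ∧ A.act u g = v := by
  obtain ⟨g, hs, ht⟩ := G.exists_mem (A.proj v) (A.proj u)
  obtain ⟨h, h1, h2, h3⟩ := hA (A.act u g) v (by rw [A.proj_act ht.symm, hs])
  rw [A.proj_act ht.symm] at h1 h2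
  refine ⟨G.mul g h, ?_, ?_, ?_⟩
  · rw [G.tgt_mul h2.symm, ht]
  · rw [G.src_mul h2.symm, h1, hs]
  · rw [A.act_mul ht.symm h2.symm, h3]

end GpdAction

end JetGpd

/-! ### Orbit maps of homogeneous actions. -/

namespace JetGpd

namespace GpdAction

variable {E V X M W F : Type*} [NormedAddCommGroup E] [NormedSpace ℝ E]
    [NormedAddCommGroup V] [NormedSpace ℝ V] [TopologicalSpace X] [ChartedSpace E X]
    [TopologicalSpace M] [ChartedSpace V M] [NormedAddCommGroup W] [NormedSpace ℝ W]
    [TopologicalSpace F] [ChartedSpace W F] {G : LieGpd E V X M} {A : GpdAction G W F}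

theorem continuous_proj (A : GpdAction G W F) : Continuous A.proj := A.contMDiff_proj.continuous

variable [IsManifold 𝓘(ℝ, E) ∞ X]

/-- Local sections of the orbit map can be moved along the orbit. -/
theorem exists_orbit_section_move {u₀ : F} {p p₁ : M} (hp : G.tgt p = A.proj u₀)
    (hp₁ : G.tgt p₁ = A.proj u₀) (h : ∃ σ : F → M, EvSmooth 𝓘(ℝ, W) 𝓘(ℝ, V) σ (A.act u₀ p₁) ∧
      σ (A.act u₀ p₁) = p₁ ∧
      ∀ᶠ u in 𝓝 (A.act u₀ p₁), G.tgt (σ u) = A.proj u₀ ∧ A.act u₀ (σ u) = u) :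
    ∃ σ : F → M, EvSmooth 𝓘(ℝ, W) 𝓘(ℝ, V) σ (A.act u₀ p) ∧ σ (A.act u₀ p) = p ∧
      ∀ᶠ u in 𝓝 (A.act u₀ p), G.tgt (σ u) = A.proj u₀ ∧ A.act u₀ (σ u) = u := by
  obtain ⟨τ, hτ, hτp, hτu⟩ := h
  have hpp : G.src (G.inv p) = G.tgt p₁ := by rw [G.src_inv, hp, hp₁]
  have hct : G.tgt (G.mul (G.inv p) p₁) = G.src p := by rw [G.tgt_mul hpp, G.tgt_inv]
  -- Acting by the bisection `β` through `p⁻¹ p₁` carries `u₀ p` to `u₀ p₁`, so the section through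
  -- `p` is `u ↦ τ(u β) β⁻¹`.
  obtain ⟨β, l, l', hβ, hβc, hβz, -, -, -, -, -, -⟩ := G.exists_bisection (G.mul (G.inv p) p₁)
  rw [hct] at hβ hβc hβz
  have hup : A.proj (A.act u₀ p) = G.src p := A.proj_act hp.symm
  have hprojt : Tendsto A.proj (𝓝 (A.act u₀ p)) (𝓝 (G.src p)) := hup ▸ A.continuous_proj.tendsto _
  have hβπ : EvSmooth 𝓘(ℝ, W) 𝓘(ℝ, V) (fun u => β (A.proj u)) (A.act u₀ p) :=
    hβ.comp' (A.contMDiff_proj.evSmooth _) hup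
  have hz := hprojt.eventually hβz
  have hact : EvSmooth 𝓘(ℝ, W) 𝓘(ℝ, W) (fun u => A.act u (β (A.proj u))) (A.act u₀ p) :=
    evSmooth_act (evSmooth_id _) hβπ (hz.mono fun u hu => hu.2.symm)
  have e1 : A.act (A.act u₀ p) (β (A.proj (A.act u₀ p))) = A.act u₀ p₁ := by
    rw [hup, hβc, ← A.act_mul hp.symm hct.symm, G.mul_inv_cancel (hp.trans hp₁.symm)]
  have hτa := hτ.comp' hact e1
  have hev := (hact.tendsto' e1).eventually hτu
  have hsrc : ∀ᶠ u in 𝓝 (A.act u₀ p), G.src (τ (A.act u (β (A.proj u)))) =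
      G.src (β (A.proj u)) := by
    filter_upwards [hev, hz] with u h1 h2
    have h3 := A.proj_act (u := u₀) (g := τ (A.act u (β (A.proj u)))) h1.1.symm
    rw [h1.2, A.proj_act h2.2.symm] at h3
    exact h3.symm
  refine ⟨fun u => G.mul (τ (A.act u (β (A.proj u)))) (G.inv (β (A.proj u))),
    G.evSmooth_mul hτa (G.evSmooth_inv hβπ) ?_, ?_, ?_⟩
  · filter_upwards [hsrc] with u hu
    rw [hu, G.tgt_inv]
  · dsimp only
    rw [e1, hτp, hup, hβc, G.mul_inv_rev hpp, G.inv_inv,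
      G.mul_inv_cancel (hp₁.trans hp.symm)]
  · filter_upwards [hev, hz, hsrc] with u h1 h2 h3
    have h4 : G.src (τ (A.act u (β (A.proj u)))) = G.tgt (G.inv (β (A.proj u))) := by
      rw [h3, G.tgt_inv]
    refine ⟨by rw [G.tgt_mul h4, h1.1], ?_⟩
    rw [A.act_mul h1.1.symm h4, h1.2, act_act_inv h2.2.symm]

variable [FiniteDimensional ℝ V] [FiniteDimensional ℝ W] [IsManifold 𝓘(ℝ, V) ∞ M]
  [IsManifold 𝓘(ℝ, W) ∞ F] [SecondCountableTopology M]

/-- The orbit map of a homogeneous action is a submersion. -/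
theorem IsHomogeneous.exists_orbit_section (hA : A.IsHomogeneous) {u₀ : F} {p : M}
    (hp : G.tgt p = A.proj u₀) :
    ∃ σ : F → M, EvSmooth 𝓘(ℝ, W) 𝓘(ℝ, V) σ (A.act u₀ p) ∧ σ (A.act u₀ p) = p ∧
      ∀ᶠ u in 𝓝 (A.act u₀ p), G.tgt (σ u) = A.proj u₀ ∧ A.act u₀ (σ u) = u := by
  set x₀ := A.proj u₀ with hx₀
  obtain ⟨b, hb, hb0, hbz⟩ := G.exists_section_comp (G.one x₀) (x := x₀) (evSmooth_id x₀)
    (evSmooth_const x₀ x₀) (G.src_one x₀).symm (G.tgt_one x₀).symm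
  obtain ⟨U, hU, hUo, hx₀U⟩ := eventually_nhds_iff.1 (hb.eventually.and hbz)
  -- The arrows with target `x₀` have no manifold structure at this stage. The orbit map is
  -- therefore extended to the open set `Ω` of arrows, correcting their target to `x₀` by `b`; as `b
  -- x₀` is a unit, `f` is the orbit map on arrows with target `x₀` and remains onto.
  let f : M → F := fun g => A.act u₀ (G.mul (b (G.tgt g)) g)
  let Ω : Set M := G.tgt ⁻¹' U
  have hΩ : IsOpen Ω := hUo.preimage G.continuous_tgt
  have hbs : ∀ g ∈ Ω, G.src (b (G.tgt g)) = G.tgt g := fun g hg => (hU _ hg).2.1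
  have hbt : ∀ g ∈ Ω, G.tgt (G.mul (b (G.tgt g)) g) = x₀ := fun g hg => by
    rw [G.tgt_mul (hbs g hg), (hU _ hg).2.2]
  have hm : ∀ g ∈ Ω, EvSmooth 𝓘(ℝ, V) 𝓘(ℝ, V) (fun g => G.mul (b (G.tgt g)) g) g := fun g hg =>
    G.evSmooth_mul ((hU _ hg).1.comp (G.evSmooth_tgt (evSmooth_id g))) (evSmooth_id g)
      (eventually_of_mem (hΩ.mem_nhds hg) hbs)
  have hf : ∀ g ∈ Ω, EvSmooth 𝓘(ℝ, V) 𝓘(ℝ, W) f g := fun g hg =>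
    evSmooth_act (evSmooth_const u₀ g) (hm g hg)
      (eventually_of_mem (hΩ.mem_nhds hg) fun h hh => (hbt h hh).symm)
  have hfp : ∀ g ∈ Ω, A.proj (f g) = G.src g := fun g hg => by
    rw [A.proj_act (hbt g hg).symm, G.src_mul (hbs g hg)]
  have hsurj : ∀ v, ∃ g ∈ Ω, f g = v := fun v => by
    obtain ⟨g, h1, h2, h3⟩ := hA.exists_act_eq u₀ v
    refine ⟨g, by simpa only [Ω, mem_preimage, h1] using hx₀U, ?_⟩
    have : G.mul (b (G.tgt g)) g = g := by
      have h4 := G.one_mul g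
      rw [h1] at h4 ⊢
      rw [hb0, h4]
    simp only [f, this, h3]
  have himg : f '' Ω ∈ 𝓝 u₀ := by
    have : f '' Ω = univ := eq_univ_of_forall hsurj
    rw [this]
    exact univ_mem
  -- With `β` a bisection through `c⁻¹ c'`, the map `l h = b(t g')⁻¹ b(t h) h β(s h)` sends `g` to
  -- `g'`. The targets of its values are constant, so `f (l h) = f h · β(s h)`. Acting by `β⁻¹`
  -- undoes this; the bisection is recovered there from the base point of `f (l h)` through `l'`.
  obtain ⟨x, hx, σ, hσ, hσx, hσu⟩ := exists_local_section (V := V) (W := W) hΩ hf himg (by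
    intro g hg g' hg'
    set c := G.mul (b (G.tgt g)) g with hc
    set c' := G.mul (b (G.tgt g')) g' with hc'
    have hct : G.tgt c = x₀ := hbt g hg
    have hct' : G.tgt c' = x₀ := hbt g' hg'
    have hcs : G.src c = G.src g := G.src_mul (hbs g hg)
    have hcs' : G.src c' = G.src g' := G.src_mul (hbs g' hg')
    have hcc : G.src (G.inv c) = G.tgt c' := by rw [G.src_inv, hct, hct']
    have hkt : G.tgt (G.mul (G.inv c) c') = G.src g := by rw [G.tgt_mul hcc, G.tgt_inv, hcs]
    have hks : G.src (G.mul (G.inv c) c') = G.src g' := by rw [G.src_mul hcc, hcs']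
    obtain ⟨β, l, l', hβ, hβc, hβz, hl, hl', hll, hll', h1, h2⟩ :=
      G.exists_bisection (G.mul (G.inv c) c')
    rw [hkt] at hβ hβc hβz hl hll hll' h1
    rw [hks] at hl' hll hll' h2
    have hsg : Tendsto G.src (𝓝 g) (𝓝 (G.src g)) := G.continuous_src.tendsto g
    have hβs : EvSmooth 𝓘(ℝ, V) 𝓘(ℝ, V) (fun h => β (G.src h)) g :=
      hβ.comp' (G.evSmooth_src (evSmooth_id g)) rfl
    have hΩg := hΩ.mem_nhds hg
    have e1 : ∀ h ∈ Ω, G.src (β (G.src h)) = l (G.src h) ∧ G.tgt (β (G.src h)) = G.src h →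
        G.src (G.mul (b (G.tgt h)) h) = G.tgt (β (G.src h)) := fun h hh hh' => by
      rw [G.src_mul (hbs h hh), hh'.2]
    have hm1 : EvSmooth 𝓘(ℝ, V) 𝓘(ℝ, V)
        (fun h => G.mul (G.mul (b (G.tgt h)) h) (β (G.src h))) g := by
      refine G.evSmooth_mul (hm g hg) hβs ?_
      filter_upwards [hΩg, hsg.eventually hβz] with h k1 k2 using e1 h k1 k2
    have hbs' : G.src (G.inv (b (G.tgt g'))) = x₀ := by rw [G.src_inv, (hU _ hg').2.2]
    have hm2 : EvSmooth 𝓘(ℝ, V) 𝓘(ℝ, V) (fun h => G.mul (G.inv (b (G.tgt g')))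
        (G.mul (G.mul (b (G.tgt h)) h) (β (G.src h)))) g := by
      refine G.evSmooth_mul (evSmooth_const _ g) hm1 ?_
      filter_upwards [hΩg, hsg.eventually hβz] with h k1 k2
      rw [hbs', G.tgt_mul (e1 h k1 k2), hbt h k1]
    have hγ : EvSmooth 𝓘(ℝ, W) 𝓘(ℝ, V) (fun u => β (l' (A.proj u))) (f g') :=
      hβ.comp' (hl'.comp' (A.contMDiff_proj.evSmooth _) (hfp g' hg'))
        (by rw [hfp g' hg', hll'])
    have hpt : Tendsto A.proj (𝓝 (f g')) (𝓝 (G.src g')) :=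
      hfp g' hg' ▸ A.continuous_proj.tendsto _
    refine ⟨fun h => G.mul (G.inv (b (G.tgt g'))) (G.mul (G.mul (b (G.tgt h)) h) (β (G.src h))),
      fun u => A.act u (G.inv (β (l' (A.proj u)))), hm2.continuousAt, ?_,
      evSmooth_act (evSmooth_id _) (G.evSmooth_inv hγ) ?_, ?_⟩
    · dsimp only
      rw [hβc, ← hc, G.mul_inv_cancel (hct.trans hct'.symm), hc', G.inv_mul_cancel (hbs g' hg')]
    · filter_upwards [hpt.eventually h2, hpt.eventually ((hl'.tendsto' hll').eventually hβz)]
        with u k1 k2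
      rw [G.tgt_inv, k2.1, k1]
    · filter_upwards [hΩg, hsg.eventually hβz, hsg.eventually h1] with h k1 k2 k3
      have k4 := e1 h k1 k2
      have k5 : G.src (G.inv (b (G.tgt g'))) =
          G.tgt (G.mul (G.mul (b (G.tgt h)) h) (β (G.src h))) := by
        rw [hbs', G.tgt_mul k4, hbt h k1]
      have k6 : f (G.mul (G.inv (b (G.tgt g')))
          (G.mul (G.mul (b (G.tgt h)) h) (β (G.src h)))) = A.act (f h) (β (G.src h)) := by
        simp only [f]
        rw [G.tgt_mul k5, G.tgt_inv, hbs g' hg',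
          G.mul_inv_cancel ((hU _ hg').2.2.trans (by rw [G.tgt_mul k4, hbt h k1])),
          A.act_mul (hbt h k1).symm k4]
      have k7 : A.proj (f h) = G.tgt (β (G.src h)) := by rw [hfp h k1, k2.2]
      rw [k6, A.proj_act k7, k2.1, k3, act_act_inv k7])
  have hσt := hσ.tendsto' hσx
  have hΩσ := hσt.eventually (hΩ.mem_nhds hx)
  -- A section of `f` at the single point `x` gives a section of the orbit map at the corrected
  -- arrow `b(t x) x`, which is then moved to `p`.
  refine exists_orbit_section_move hp (hbt x hx) ⟨fun u => G.mul (b (G.tgt (σ u))) (σ u),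
    (hm x hx).comp' hσ hσx, by dsimp only; rw [show A.act u₀ _ = f x from rfl, hσx], ?_⟩
  filter_upwards [hσu, hΩσ] with u h1 h2
  exact ⟨hbt _ h2, h1⟩

end GpdAction

end JetGpd

/-! ### Sectioned subgroupoids are smooth bundles. -/

namespace JetGpd

section Subgroupoid

variable {E V X : Type*} {M : Type w} [NormedAddCommGroup E] [NormedSpace ℝ E]
    [NormedAddCommGroup V] [NormedSpace ℝ V] [TopologicalSpace X] [ChartedSpace E X]
    [TopologicalSpace M] [ChartedSpace V M] {G : LieGpd E V X M}

/-- A transitive subgroupoid such that the target map restricted to the source fibres has smooth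
local sections. -/
structure LieGpd.IsSectioned (G : LieGpd E V X M) (S : Set M) : Prop where
  one_mem : ∀ x, G.one x ∈ S
  mul_mem : ∀ g ∈ S, ∀ h ∈ S, G.src g = G.tgt h → G.mul g h ∈ S
  inv_mem : ∀ g ∈ S, G.inv g ∈ S
  exists_mem : ∀ x y, ∃ g ∈ S, G.src g = x ∧ G.tgt g = y
  exists_section : ∀ g ∈ S, ∃ σ : X → M, EvSmooth 𝓘(ℝ, E) 𝓘(ℝ, V) σ (G.src g) ∧ σ (G.src g) = g ∧
    ∀ᶠ z in 𝓝 (G.src g), σ z ∈ S ∧ G.src (σ z) = z ∧ G.tgt (σ z) = G.tgt g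

namespace LieGpd.IsSectioned

variable {S : Set M}

/-- Left multiplication by arrows of `S` from `t h` to `l (t h)`, routed through `x₀`, preserves
sources and `S`; the family built from `l'` inverts it. This moves neighbourhoods within a source
fibre. -/
theorem exists_move (hS : G.IsSectioned S) {x₀ : X} {a b : X} {κ₀ κ₁ : X → M} {l l' : X → X}
    (hκ₀ : EvSmooth 𝓘(ℝ, E) 𝓘(ℝ, V) κ₀ a) (hκ₁ : EvSmooth 𝓘(ℝ, E) 𝓘(ℝ, V) κ₁ b)
    (h₀ : ∀ᶠ z in 𝓝 a, κ₀ z ∈ S ∧ G.src (κ₀ z) = z ∧ G.tgt (κ₀ z) = x₀)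
    (h₁ : ∀ᶠ z in 𝓝 b, κ₁ z ∈ S ∧ G.src (κ₁ z) = z ∧ G.tgt (κ₁ z) = x₀)
    (hl : EvSmooth 𝓘(ℝ, E) 𝓘(ℝ, E) l a) (hla : l a = b) (hll : ∀ᶠ z in 𝓝 a, l' (l z) = z)
    {g : M} (hg : G.tgt g = a) :
    EvSmooth 𝓘(ℝ, V) 𝓘(ℝ, V)
      (fun h => G.mul (G.inv (κ₁ (l (G.tgt h)))) (G.mul (κ₀ (G.tgt h)) h)) g ∧
    ∀ᶠ h in 𝓝 g, G.src (G.mul (G.inv (κ₁ (l (G.tgt h)))) (G.mul (κ₀ (G.tgt h)) h)) = G.src h ∧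
      (h ∈ S → G.mul (G.inv (κ₁ (l (G.tgt h)))) (G.mul (κ₀ (G.tgt h)) h) ∈ S) ∧
      G.tgt (G.mul (G.inv (κ₁ (l (G.tgt h)))) (G.mul (κ₀ (G.tgt h)) h)) = l (G.tgt h) ∧
      G.mul (G.inv (κ₀ (l' (l (G.tgt h))))) (G.mul (κ₁ (l (G.tgt h)))
        (G.mul (G.inv (κ₁ (l (G.tgt h)))) (G.mul (κ₀ (G.tgt h)) h))) = h := by
  have ht : Tendsto G.tgt (𝓝 g) (𝓝 a) := hg ▸ G.continuous_tgt.tendsto g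
  have hlt := (hl.tendsto' hla).comp ht
  have e₀ := ht.eventually h₀
  have e₁ := hlt.eventually h₁
  have s₀ : EvSmooth 𝓘(ℝ, V) 𝓘(ℝ, V) (fun h => κ₀ (G.tgt h)) g :=
    hκ₀.comp' (G.evSmooth_tgt (evSmooth_id g)) hg
  have s₁ : EvSmooth 𝓘(ℝ, V) 𝓘(ℝ, V) (fun h => κ₁ (l (G.tgt h))) g :=
    hκ₁.comp' (hl.comp' (G.evSmooth_tgt (evSmooth_id g)) hg) (by rw [hg, hla])
  have c₀ : ∀ᶠ h in 𝓝 g, G.src (κ₀ (G.tgt h)) = G.tgt h := e₀.mono fun h hh => hh.2.1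
  have c₁ : ∀ᶠ h in 𝓝 g, G.src (G.inv (κ₁ (l (G.tgt h)))) = G.tgt (G.mul (κ₀ (G.tgt h)) h) := by
    filter_upwards [e₀, e₁] with h k₀ k₁
    rw [G.src_inv, G.tgt_mul k₀.2.1]
    exact k₁.2.2.trans k₀.2.2.symm
  refine ⟨G.evSmooth_mul (G.evSmooth_inv s₁) (G.evSmooth_mul s₀ (evSmooth_id g) c₀) c₁, ?_⟩
  filter_upwards [e₀, e₁, c₀, c₁, ht.eventually hll] with h k₀ k₁ k₂ k₃ k₄
  refine ⟨by rw [G.src_mul k₃, G.src_mul k₂], fun hh => hS.mul_mem _ (hS.inv_mem _ k₁.1) _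
    (hS.mul_mem _ k₀.1 _ hh k₂) k₃, ?_, ?_⟩
  · rw [G.tgt_mul k₃, G.tgt_inv]
    exact k₁.2.1
  · rw [G.mul_inv_cancel (by rw [← k₃, G.src_inv]), k₄, G.inv_mul_cancel k₂]

/-- Slices of a source fibre at the unit can be moved to all points of the fibre. -/
theorem hasSlice_of_one [IsManifold 𝓘(ℝ, E) ∞ X] (hS : G.IsSectioned S) {x₀ : X} {d : ℕ}
    (h1 : HasSlice (V := V) {g | g ∈ S ∧ G.src g = x₀} (G.one x₀) d) :
    ∀ z ∈ {g | g ∈ S ∧ G.src g = x₀}, HasSlice (V := V) {g | g ∈ S ∧ G.src g = x₀} z d := by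
  rintro z ⟨hz, hzx⟩
  obtain ⟨κ₀, s₀, v₀, e₀⟩ := hS.exists_section _ (hS.inv_mem z hz)
  obtain ⟨κ₁, s₁, v₁, e₁⟩ := hS.exists_section _ (hS.one_mem x₀)
  rw [G.src_inv] at s₀ v₀ e₀
  rw [G.src_one] at s₁ v₁ e₁
  rw [G.tgt_inv, hzx] at e₀
  rw [G.tgt_one] at e₁
  obtain ⟨l, l', sl, sl', ll, ll', i1, i2⟩ := exists_local_translation (E := E) (G.tgt z) x₀
  obtain ⟨sα, eα⟩ := hS.exists_move s₀ s₁ e₀ e₁ sl ll i1 rfl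
  obtain ⟨sβ, eβ⟩ := hS.exists_move s₁ s₀ e₁ e₀ sl' ll' i2 (G.tgt_one x₀)
  refine h1.transport (z' := z) sα sβ ?_ ?_ ?_ ?_
  · rw [ll, v₁, v₀, G.inv_one, G.inv_mul, hzx]
    simpa using G.one_mul (G.one x₀)
  · rw [G.tgt_one, ll', v₀, v₁, G.inv_inv]
    have h2 := G.one_mul (G.one x₀)
    rw [G.tgt_one] at h2
    rw [h2, ← hzx, G.mul_one]
  · filter_upwards [eα] with w hw h2
    refine ⟨⟨hw.2.1 h2.1, hw.1.trans h2.2⟩, ?_⟩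
    rw [hw.2.2.1, hw.2.2.2]
  · filter_upwards [eβ] with w hw h2
    refine ⟨⟨hw.2.1 h2.1, hw.1.trans h2.2⟩, ?_⟩
    rw [hw.2.2.1, hw.2.2.2]

/-- A subgroupoid with sections whose source fibres have slices is a smooth bundle. -/
theorem isSmoothBundle [T2Space M] [SecondCountableTopology M] (hS : G.IsSectioned S) {x₀ : X}
    {d : ℕ} (hd : ∀ z ∈ {g | g ∈ S ∧ G.src g = x₀},
      HasSlice (V := V) {g | g ∈ S ∧ G.src g = x₀} z d) :
    IsSmoothBundle (E := E) (V := V) S G.src := by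
  classical
  let Φ : Set M := {g | g ∈ S ∧ G.src g = x₀}
  obtain ⟨i1, i2, hval, hρ⟩ := exists_subtype_manifold (S := Φ) hd
  refine ⟨d, Φ, inferInstance, i1, i2, inferInstance, inferInstance, fun x => ?_⟩
  -- The arrow `σ z` of `S` runs from `z` to `x₀`. Hence `g ↦ (s g, g σ(s g)⁻¹)` trivialises `S`
  -- near `x`, with inverse `(z, w) ↦ w σ(z)`.
  obtain ⟨p, hp, hps, hpt⟩ := hS.exists_mem x x₀
  obtain ⟨σ, h1, h2, h3⟩ := hS.exists_section p hp
  rw [hps, hpt] at h3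
  rw [hps] at h1
  obtain ⟨U, hU, hUo, hxU⟩ := eventually_nhds_iff.1 (h1.eventually.and h3)
  have hsrc : ∀ g, G.src g ∈ U → G.src g = G.tgt (G.inv (σ (G.src g))) := fun g hg => by
    rw [G.tgt_inv, (hU _ hg).2.2.1]
  have hmem : ∀ g ∈ S, G.src g ∈ U → G.mul g (G.inv (σ (G.src g))) ∈ Φ := fun g hg hgU =>
    ⟨hS.mul_mem _ hg _ (hS.inv_mem _ (hU _ hgU).2.1) (hsrc g hgU), by
      rw [G.src_mul (hsrc g hgU), G.src_inv, (hU _ hgU).2.2.2]⟩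
  have hmul : ∀ (w : Φ) (z : X), z ∈ U → G.src (w : M) = G.tgt (σ z) := fun w z hz => by
    rw [w.2.2, (hU _ hz).2.2.2]
  -- The default unit occurs only outside the domain `S ∩ s⁻¹(U)` of the trivialisation.
  let e₂ : M → Φ := fun g => if h : G.mul g (G.inv (σ (G.src g))) ∈ Φ then ⟨_, h⟩ else
    ⟨G.one x₀, hS.one_mem x₀, G.src_one x₀⟩
  have he₂ : ∀ g ∈ S, G.src g ∈ U → (e₂ g : M) = G.mul g (G.inv (σ (G.src g))) :=
    fun g hg hgU => by simp only [e₂, dif_pos (hmem g hg hgU)]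
  refine ⟨U, { toFun := fun g => (G.src g, e₂ g)
               invFun := fun z => G.mul z.2 (σ z.1)
               source := S ∩ G.src ⁻¹' U
               target := U ×ˢ univ
               map_source' := fun g hg => ⟨hg.2, mem_univ _⟩
               map_target' := ?_
               left_inv' := ?_
               right_inv' := ?_ }, hUo, hxU, rfl, rfl, fun _ _ => rfl, ?_, ?_⟩
  · rintro ⟨z, w⟩ ⟨hz, -⟩
    refine ⟨hS.mul_mem _ w.2.1 _ (hU _ hz).2.1 (hmul w z hz), ?_⟩
    change G.src (G.mul w (σ z)) ∈ U
    rw [G.src_mul (hmul w z hz), (hU _ hz).2.2.1]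
    exact hz
  · rintro g ⟨hg, hgU⟩
    change G.mul (e₂ g) (σ (G.src g)) = g
    rw [he₂ g hg hgU, G.mul_inv_mul (hU _ hgU).2.2.1.symm]
  · rintro ⟨z, w⟩ ⟨hz, -⟩
    have h4 : G.src (G.mul w (σ z)) = z := by rw [G.src_mul (hmul w z hz), (hU _ hz).2.2.1]
    have h5 : G.mul w (σ z) ∈ S := hS.mul_mem _ w.2.1 _ (hU _ hz).2.1 (hmul w z hz)
    refine Prod.ext h4 (Subtype.ext ?_)
    change (e₂ (G.mul w (σ z)) : M) = w
    rw [he₂ _ h5 (by rw [h4]; exact hz), h4, G.mul_mul_inv (hmul w z hz)]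
  · rintro g ⟨hg, hgU⟩
    have s1 : EvSmooth 𝓘(ℝ, V) 𝓘(ℝ, V) (fun g => G.mul g (G.inv (σ (G.src g)))) g :=
      G.evSmooth_mul (evSmooth_id g)
        (G.evSmooth_inv ((hU _ hgU).1.comp (G.evSmooth_src (evSmooth_id g))))
        (eventually_of_mem ((hUo.preimage G.continuous_src).mem_nhds hgU) hsrc)
    obtain ⟨ρ, hρ1, hρ2⟩ := hρ ⟨_, hmem g hg hgU⟩
    have s2 := hρ1.comp' s1 rfl
    refine ContMDiffWithinAt.prodMk (G.contMDiff_src g).contMDiffWithinAt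
      (s2.contMDiffAt.contMDiffWithinAt.congr_of_eventuallyEq ?_ ?_)
    · filter_upwards [self_mem_nhdsWithin,
        mem_nhdsWithin_of_mem_nhds (s1.tendsto.eventually hρ2)] with g' h4 h5
      exact Subtype.ext ((he₂ g' h4.1 h4.2).trans (h5 (hmem g' h4.1 h4.2)).symm)
    · exact Subtype.ext ((he₂ g hg hgU).trans (hρ2.self_of_nhds (hmem g hg hgU)).symm)
  · rintro ⟨z, w⟩ ⟨hz, -⟩
    refine (G.evSmooth_mul ((hval.evSmooth w).comp' (contMDiff_snd.evSmooth (z, w)) rfl)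
      ((hU _ hz).1.comp' (contMDiff_fst.evSmooth (z, w)) rfl) ?_).contMDiffAt.contMDiffWithinAt
    filter_upwards [(hUo.preimage continuous_fst).mem_nhds hz] with a ha
    exact hmul a.2 a.1 ha

end LieGpd.IsSectioned

/-- No trivialisation is required over an empty base, but a typical fibre is; the empty set serves.
-/
theorem isSmoothBundle_of_isEmpty [IsEmpty X] (S : Set M) (p : M → X) :
    IsSmoothBundle (E := E) (V := V) S p := by
  obtain ⟨i1, i2, -⟩ := exists_subtype_manifold (V := V) (S := (∅ : Set M)) (d := 0)
    fun z hz => hz.elim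
  have : T2Space (∅ : Set M) := ⟨fun x => x.2.elim⟩
  have : SecondCountableTopology (∅ : Set M) := Finite.toSecondCountableTopology
  exact ⟨0, (∅ : Set M), inferInstance, i1, i2, inferInstance, inferInstance, isEmptyElim⟩

end Subgroupoid

/-! ### The stabiliser of a section of a homogeneous action. -/

section Stabilizer

variable {E V X W F : Type*} {M : Type w} [NormedAddCommGroup E] [NormedSpace ℝ E]
    [NormedAddCommGroup V] [NormedSpace ℝ V] [TopologicalSpace X] [ChartedSpace E X]
    [TopologicalSpace M] [ChartedSpace V M] [NormedAddCommGroup W] [NormedSpace ℝ W]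
    [TopologicalSpace F] [ChartedSpace W F] {G : LieGpd E V X M} {A : GpdAction G W F}
    [IsManifold 𝓘(ℝ, E) ∞ X] [FiniteDimensional ℝ V] [FiniteDimensional ℝ W]
    [IsManifold 𝓘(ℝ, V) ∞ M] [IsManifold 𝓘(ℝ, W) ∞ F] [SecondCountableTopology M]
    {ξ : X → F}

namespace GpdAction

/-- The arrows stabilising a section. -/
def stab (A : GpdAction G W F) (ξ : X → F) : Set M := {g | A.act (ξ (G.tgt g)) g = ξ (G.src g)}

/-- Let `σ` be a local section of the orbit map of `ξ(t g)` through `g`. Then `σ(ξ z)` is an arrow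
from `z` to `t g` taking `ξ(t g)` to `ξ z`, hence a smooth family in the stabiliser. -/
theorem isSectioned_stab (hA : A.IsHomogeneous) (hξ : ContMDiff 𝓘(ℝ, E) 𝓘(ℝ, W) ∞ ξ)
    (hp : ∀ x, A.proj (ξ x) = x) : G.IsSectioned (A.stab ξ) where
  one_mem x := by
    have := A.act_one (ξ x)
    rw [hp] at this
    simpa [stab] using this
  mul_mem g hg h hh H := by
    simp only [stab, mem_ofPred_eq] at *
    rw [G.tgt_mul H, G.src_mul H, A.act_mul (hp _) H, hg, H, hh]
  inv_mem g hg := by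
    simp only [stab, mem_ofPred_eq, G.tgt_inv, G.src_inv] at *
    rw [← hg, act_act_inv (hp _)]
  exists_mem x y := by
    obtain ⟨g, h1, h2, h3⟩ := hA.exists_act_eq (ξ y) (ξ x)
    rw [hp] at h1 h2
    exact ⟨g, by rw [stab, mem_ofPred_eq, h1, h2, h3], h2, h1⟩
  exists_section g hg := by
    obtain ⟨σ, h1, h2, h3⟩ := hA.exists_orbit_section (u₀ := ξ (G.tgt g)) (p := g) (hp _).symm
    have hg' : A.act (ξ (G.tgt g)) g = ξ (G.src g) := hg
    rw [hg'] at h1 h2 h3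
    refine ⟨fun z => σ (ξ z), h1.comp' (hξ.evSmooth _) rfl, h2, ?_⟩
    filter_upwards [(hξ.continuous.tendsto (G.src g)).eventually h3] with z hz
    rw [hp] at hz
    have hs : G.src (σ (ξ z)) = z := by
      rw [← A.proj_act (u := ξ (G.tgt g)) (by rw [hp, hz.1]), hz.2, hp]
    exact ⟨by rw [stab, mem_ofPred_eq, hs, hz.1, hz.2], hs, hz.1⟩

/-- A retraction onto the stabilisers with source `x₀`: correct the source of `g` to `x₀` (the map
`k`), measure by `v = ξ(t k) k` in the fibre over `x₀` how far `k` is from stabilising `ξ`, and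
cancel this by the arrow `τ(v)⁻¹`, where `ξ(x₀) τ(v) = v`. If `g` is already a stabiliser with
source `x₀`, then `v = ξ(x₀)` and the correction is a unit. -/
theorem exists_hasSlice_stab (hA : A.IsHomogeneous) (hξ : ContMDiff 𝓘(ℝ, E) 𝓘(ℝ, W) ∞ ξ)
    (hp : ∀ x, A.proj (ξ x) = x) (x₀ : X) :
    ∃ d, HasSlice (V := V) {g | g ∈ A.stab ξ ∧ G.src g = x₀} (G.one x₀) d := by
  obtain ⟨τ, hτ, hτ1, hτu⟩ := hA.exists_orbit_section (u₀ := ξ x₀) (p := G.one x₀)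
    (by rw [G.tgt_one, hp])
  have h1 : A.act (ξ x₀) (G.one x₀) = ξ x₀ := by
    have := A.act_one (ξ x₀)
    rwa [hp] at this
  rw [h1] at hτ hτ1 hτu
  rw [hp] at hτu
  obtain ⟨b, hb, hb1, hbz⟩ := G.exists_section_from (G.one x₀)
  rw [G.tgt_one] at hb hb1 hbz
  rw [G.src_one] at hbz
  have hs := G.continuous_src.tendsto (G.one x₀)
  rw [G.src_one] at hs
  let k : M → M := fun g => G.mul g (b (G.src g))
  have hk1 : k (G.one x₀) = G.one x₀ := by
    have := G.mul_one (G.one x₀)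
    rw [G.src_one] at this
    simp only [k]
    rw [G.src_one, hb1, this]
  have hk : EvSmooth 𝓘(ℝ, V) 𝓘(ℝ, V) k (G.one x₀) := by
    refine G.evSmooth_mul (evSmooth_id _) (hb.comp' (G.evSmooth_src (evSmooth_id _)) (G.src_one _))
      ?_
    filter_upwards [hs.eventually hbz] with g hg using hg.2.symm
  have hks : ∀ᶠ g in 𝓝 (G.one x₀), G.src (k g) = x₀ := by
    filter_upwards [hs.eventually hbz] with g hg
    rw [G.src_mul hg.2.symm, hg.1]
  let v : M → F := fun g => A.act (ξ (G.tgt (k g))) (k g)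
  have hv : EvSmooth 𝓘(ℝ, V) 𝓘(ℝ, W) v (G.one x₀) :=
    evSmooth_act ((hξ.evSmooth _).comp (G.evSmooth_tgt hk)) hk (Eventually.of_forall fun g => hp _)
  have hv1 : v (G.one x₀) = ξ x₀ := by simp only [v, hk1, G.tgt_one, h1]
  have hvp : ∀ g, A.proj (v g) = G.src (k g) := fun g => A.proj_act (hp _)
  have hτv := hτ.comp' hv hv1
  have hev := (hv.tendsto' hv1).eventually hτu
  have hst : ∀ᶠ g in 𝓝 (G.one x₀), G.src (k g) = G.tgt (G.inv (τ (v g))) := by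
    filter_upwards [hev] with g hg
    rw [G.tgt_inv, ← hvp, ← A.proj_act (u := ξ x₀) (by rw [hp, hg.1]), hg.2]
  refine HasSlice.of_retraction (ρ := fun g => G.mul (k g) (G.inv (τ (v g))))
    (G.evSmooth_mul hk (G.evSmooth_inv hτv) hst) ?_ ?_ ?_
  · rw [hv1, hτ1, hk1, G.mul_inv, G.tgt_one]
  · filter_upwards [hst, hev] with g h2 h3
    have h4 : G.src (G.mul (k g) (G.inv (τ (v g)))) = x₀ := by
      rw [G.src_mul h2, G.src_inv, h3.1]
    refine ⟨?_, h4⟩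
    rw [stab, mem_ofPred_eq, h4, G.tgt_mul h2, A.act_mul (hp _) h2]
    change A.act (v g) (G.inv (τ (v g))) = ξ x₀
    have h5 := act_act_inv (A := A) (u := ξ x₀) (g := τ (v g)) (by rw [hp, h3.1])
    rwa [h3.2] at h5
  · refine Eventually.of_forall fun g hg => ?_
    have h2 : k g = g := by
      simp only [k]
      rw [hg.2, hb1, ← hg.2, G.mul_one]
    have h3 : v g = ξ x₀ := by
      simp only [v, h2]
      rw [hg.1, hg.2]
    rw [h2, h3, hτ1, G.inv_one, ← hg.2, G.mul_one]

/-- The stabiliser of a section of a homogeneous bundle is a smooth subbundle. -/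
theorem isSmoothBundle_stab [T2Space M] (hA : A.IsHomogeneous)
    (hξ : ContMDiff 𝓘(ℝ, E) 𝓘(ℝ, W) ∞ ξ) (hp : ∀ x, A.proj (ξ x) = x) :
    IsSmoothBundle (E := E) (V := V) (A.stab ξ) G.src := by
  cases isEmpty_or_nonempty X with
  | inl h => exact isSmoothBundle_of_isEmpty _ _
  | inr h =>
    obtain ⟨x₀⟩ := h
    have hS := isSectioned_stab hA hξ hp
    obtain ⟨d, hd⟩ := exists_hasSlice_stab hA hξ hp x₀
    exact hS.isSmoothBundle (hS.hasSlice_of_one hd)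

end GpdAction

end Stabilizer

end JetGpd

/-! ### The Lie groupoid of jets; stabilisers in natural bundles. -/

namespace JetGpd

section JetLieGpd

variable (E : Type*) [NormedAddCommGroup E] [NormedSpace ℝ E] [FiniteDimensional ℝ E]
  (X : Type*) [TopologicalSpace X] [ChartedSpace E X] [IsManifold 𝓘(ℝ, E) ∞ X] (q : ℕ)

/-- The full jet groupoid as a Lie groupoid. -/
noncomputable def jetLieGpd : LieGpd E (JetModel E q) X (Jet E X q) where
  src := Jet.source
  tgt := Jet.target
  one := Jet.unit E q
  mul := Jet.comp
  inv := Jet.inv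
  contMDiff_src := Jet.contMDiff_source
  contMDiff_tgt := Jet.contMDiff_target
  contMDiff_one := Jet.contMDiff_unit
  contMDiff_inv := Jet.contMDiff_inv
  contMDiffOn_mul := Jet.contMDiffOn_comp
  src_one := Jet.source_unit
  tgt_one := Jet.target_unit
  src_inv := Jet.source_inv
  tgt_inv := Jet.target_inv
  src_mul := Jet.source_comp
  tgt_mul := Jet.target_comp
  mul_assoc := Jet.comp_assoc
  mul_one := Jet.comp_unit
  one_mul := Jet.unit_comp
  inv_mul := Jet.inv_comp
  mul_inv := Jet.comp_inv
  exists_section g := by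
    obtain ⟨O, b, hO, hg, hb, hbg, hbO⟩ := Jet.exists_section g
    exact ⟨b, hb.evSmooth hO hg, hbg, eventually_of_mem (hO.mem_nhds hg) hbO⟩
  exists_mem := Jet.exists_source_target (E := E) q

end JetLieGpd

section Stabilizer

variable {E : Type*} [NormedAddCommGroup E] [NormedSpace ℝ E] [FiniteDimensional ℝ E]
  {X : Type*} [TopologicalSpace X] [ChartedSpace E X] [IsManifold 𝓘(ℝ, E) ∞ X] {q : ℕ}
  {m : ℕ} {F : Type*} [TopologicalSpace F] [ChartedSpace (EuclideanSpace ℝ (Fin m)) F]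

namespace NaturalBundle

/-- The action of the full jet groupoid on a natural bundle. -/
noncomputable def gpdAction (B : NaturalBundle E X q m F) :
    GpdAction (jetLieGpd E X q) (EuclideanSpace ℝ (Fin m)) F where
  proj := B.proj
  contMDiff_proj := B.contMDiff_proj
  act := B.act
  contMDiffOn_act := B.contMDiffOn_act
  proj_act := B.proj_act _ _
  act_mul := B.act_comp _ _ _
  act_one := B.act_unit

variable [IsManifold 𝓘(ℝ, EuclideanSpace ℝ (Fin m)) ∞ F] [T2Space X] [SecondCountableTopology X]
  {B : NaturalBundle E X q m F} {ξ : X → F}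

theorem isJetGroupoid_stab (hB : B.IsHomogeneous) (hξ : B.IsSection ξ) :
    IsJetGroupoid (B.stab ξ) := by
  have hA : B.gpdAction.IsHomogeneous := hB
  have hS := GpdAction.isSectioned_stab hA hξ.1 hξ.2
  exact ⟨GpdAction.isSmoothBundle_stab hA hξ.1 hξ.2, hS.one_mem, hS.mul_mem, hS.inv_mem⟩

theorem isTransitive_stab (hB : B.IsHomogeneous) (hξ : B.IsSection ξ) :
    IsTransitive (B.stab ξ) := by
  have hA : B.gpdAction.IsHomogeneous := hB
  exact (GpdAction.isSectioned_stab hA hξ.1 hξ.2).exists_mem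

end NaturalBundle

end Stabilizer

end JetGpd

/-! ### Coordinates along the source fibres of a subbundle. -/

namespace JetGpd

/-- A complement of the range is parametrised by a Euclidean space depending only on the two
dimensions, so that one model serves the slices at all points. -/
theorem exists_complement_map {A V : Type*} [NormedAddCommGroup A] [NormedSpace ℝ A]
    [FiniteDimensional ℝ A] [NormedAddCommGroup V] [NormedSpace ℝ V] [FiniteDimensional ℝ V]
    (L : A →L[ℝ] V) (hL : Function.Injective L) :
    ∃ ι : EuclideanSpace ℝ (Fin (Module.finrank ℝ V - Module.finrank ℝ A)) →L[ℝ] V,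
      (∀ a c, L a + ι c = 0 → a = 0 ∧ c = 0) ∧
      Module.finrank ℝ A + (Module.finrank ℝ V - Module.finrank ℝ A) = Module.finrank ℝ V := by
  obtain ⟨C, hC⟩ := (LinearMap.range (L : A →ₗ[ℝ] V)).exists_isCompl
  have h1 : Module.finrank ℝ (LinearMap.range (L : A →ₗ[ℝ] V)) = Module.finrank ℝ A :=
    LinearMap.finrank_range_of_inj hL
  have h2 := Submodule.finrank_add_eq_of_isCompl hC
  rw [h1] at h2
  have h3 : Module.finrank ℝ (EuclideanSpace ℝ (Fin (Module.finrank ℝ V - Module.finrank ℝ A))) =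
      Module.finrank ℝ C := by rw [finrank_euclideanSpace_fin]; omega
  let T := ContinuousLinearEquiv.ofFinrankEq h3
  refine ⟨C.subtypeL.comp (T : _ →L[ℝ] C), fun a c h => ?_, by omega⟩
  have h4 : L a = -(T c : V) := eq_neg_of_add_eq_zero_left h
  have h5 : L a ∈ LinearMap.range (L : A →ₗ[ℝ] V) ⊓ C :=
    ⟨⟨a, rfl⟩, h4 ▸ C.neg_mem (T c).2⟩
  rw [hC.inf_eq_bot, Submodule.mem_bot] at h5
  refine ⟨hL (by rw [h5, map_zero]), T.injective (Subtype.ext ?_)⟩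
  rw [h5] at h4
  simpa using h4.symm

section Coordinates

variable {E V X : Type*} {M : Type w} [NormedAddCommGroup E] [NormedSpace ℝ E]
    [NormedAddCommGroup V] [NormedSpace ℝ V] [TopologicalSpace X] [ChartedSpace E X]
    [TopologicalSpace M] [ChartedSpace V M] {G : LieGpd E V X M} {S : Set M}

/-- In a trivialisation around the source of `g`, the fibre coordinate of `g` is held constant. -/
theorem IsSmoothBundle.exists_section (hS : IsSmoothBundle (E := E) (V := V) S G.src) :
    ∀ g ∈ S, ∃ γ : X → M, EvSmooth 𝓘(ℝ, E) 𝓘(ℝ, V) γ (G.src g) ∧ γ (G.src g) = g ∧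
      ∀ᶠ z in 𝓝 (G.src g), γ z ∈ S ∧ G.src (γ z) = z := by
  intro g hg
  obtain ⟨d, Φ, _, _, _, _, _, h⟩ := hS
  obtain ⟨U, e, hU, hgU, hes, het, hep, -, he'⟩ := h (G.src g)
  have hge : g ∈ e.source := hes ▸ ⟨hg, hgU⟩
  have hmem : ∀ᶠ z in 𝓝 (G.src g), (z, (e g).2) ∈ e.target := by
    filter_upwards [hU.mem_nhds hgU] with z hz
    rw [het]
    exact ⟨hz, mem_univ _⟩
  refine ⟨fun z => e.symm (z, (e g).2), EvSmooth.comp_of_mem he'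
    ((evSmooth_id _).prodMk (evSmooth_const _ _)) hmem, ?_, ?_⟩
  · have : (G.src g, (e g).2) = e g := Prod.ext (hep g hge).symm rfl
    dsimp only
    rw [this, e.left_inv hge]
  · filter_upwards [hmem] with z hz
    have h1 := e.map_target hz
    refine ⟨(hes ▸ h1 : e.symm (z, (e g).2) ∈ S ∩ G.src ⁻¹' U).1, ?_⟩
    rw [← hep _ h1, e.right_inv hz]

/-- Local coordinates along the source fibres of a subbundle, centred at the units. -/
theorem IsSmoothBundle.exists_coords (hS : IsSmoothBundle (E := E) (V := V) S G.src)
    (h1 : ∀ x, G.one x ∈ S) : ∃ d : ℕ, ∀ y : X, ∃ (κ : X × EuclideanSpace ℝ (Fin d) → M)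
      (ε : M → EuclideanSpace ℝ (Fin d)),
      EvSmooth (𝓘(ℝ, E).prod 𝓘(ℝ, EuclideanSpace ℝ (Fin d))) 𝓘(ℝ, V) κ (y, 0) ∧
      ContMDiffWithinAt 𝓘(ℝ, V) 𝓘(ℝ, EuclideanSpace ℝ (Fin d)) ∞ ε S (G.one y) ∧
      ε (G.one y) = 0 ∧
      (∀ᶠ p in 𝓝 (y, 0), κ p ∈ S ∧ G.src (κ p) = p.1 ∧ ε (κ p) = p.2) ∧
      (∀ᶠ z in 𝓝 y, κ (z, 0) = G.one z) ∧ ∀ᶠ ρ in 𝓝[S] (G.one y), κ (G.src ρ, ε ρ) = ρ := by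
  obtain ⟨d, Φ, _, _, _, _, _, h⟩ := hS
  refine ⟨d, fun y => ?_⟩
  obtain ⟨U, e, hU, hyU, hes, het, hep, he, he'⟩ := h y
  have hes' : ∀ ρ, ρ ∈ e.source ↔ ρ ∈ S ∧ G.src ρ ∈ U := fun ρ => by rw [hes]; rfl
  have het' : ∀ p, p ∈ e.target ↔ p.1 ∈ U := fun p => by rw [het]; simp
  have h1e : ∀ z ∈ U, G.one z ∈ e.source := fun z hz => by
    rw [hes', G.src_one]
    exact ⟨h1 z, hz⟩
  let c := chartAt (EuclideanSpace ℝ (Fin d)) (e (G.one y)).2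
  have hcs : (e (G.one y)).2 ∈ c.source := mem_chart_source _ _
  have hct : c (e (G.one y)).2 ∈ c.target := mem_chart_target _ _
  -- The fibre coordinate of the unit at `z`; shifting by it places all nearby units at parameter
  -- zero.
  let a₀ : X → EuclideanSpace ℝ (Fin d) := fun z => c (e (G.one z)).2
  have hs1 : EvSmooth 𝓘(ℝ, E) 𝓘(ℝ, EuclideanSpace ℝ (Fin d)) (fun z => (e (G.one z)).2) y :=
    (contMDiff_snd.evSmooth (e (G.one y))).comp' (EvSmooth.comp_of_mem he
      (G.contMDiff_one.evSmooth y) (eventually_of_mem (hU.mem_nhds hyU) h1e)) rfl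
  have ha₀ : EvSmooth 𝓘(ℝ, E) 𝓘(ℝ, EuclideanSpace ℝ (Fin d)) a₀ y :=
    (evSmooth_chart _ _ hcs).comp' hs1 rfl
  have hfst : EvSmooth (𝓘(ℝ, E).prod 𝓘(ℝ, EuclideanSpace ℝ (Fin d))) 𝓘(ℝ, E)
    (Prod.fst : X × EuclideanSpace ℝ (Fin d) → X) (y, 0) := contMDiff_fst.evSmooth _
  have hsum : EvSmooth (𝓘(ℝ, E).prod 𝓘(ℝ, EuclideanSpace ℝ (Fin d)))
      𝓘(ℝ, EuclideanSpace ℝ (Fin d)) (fun p : X × EuclideanSpace ℝ (Fin d) => a₀ p.1 + p.2)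
      (y, 0) := by
    have h2 := ha₀.comp' hfst rfl
    have h3 : EvSmooth (𝓘(ℝ, E).prod 𝓘(ℝ, EuclideanSpace ℝ (Fin d)))
      𝓘(ℝ, EuclideanSpace ℝ (Fin d)) (Prod.snd : X × EuclideanSpace ℝ (Fin d) → _) (y, 0) :=
      contMDiff_snd.evSmooth _
    filter_upwards [h2, h3] with p h4 h5 using h4.add h5
  have hsum0 : a₀ (y, (0 : EuclideanSpace ℝ (Fin d))).1 + (y, (0 : EuclideanSpace ℝ (Fin d))).2 =
      c (e (G.one y)).2 := add_zero _
  have hcsum := (evSmooth_chart_symm (e (G.one y)).2 _ hct).comp' hsum hsum0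
  have hUf : ∀ᶠ p : X × EuclideanSpace ℝ (Fin d) in 𝓝 (y, 0), p.1 ∈ U :=
    (hU.preimage continuous_fst).mem_nhds hyU
  let κ : X × EuclideanSpace ℝ (Fin d) → M := fun p => e.symm (p.1, c.symm (a₀ p.1 + p.2))
  let ε : M → EuclideanSpace ℝ (Fin d) := fun ρ => c (e ρ).2 - a₀ (G.src ρ)
  have hsrc := G.continuous_src.tendsto (G.one y)
  rw [G.src_one] at hsrc
  have hnS : 𝓝[S] (G.one y) = 𝓝[e.source] (G.one y) := by
    rw [hes]
    exact (nhdsWithin_inter_of_mem' (mem_nhdsWithin_of_mem_nhds (hsrc (hU.mem_nhds hyU)))).symm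
  have he2 : ContMDiffWithinAt 𝓘(ℝ, V) 𝓘(ℝ, EuclideanSpace ℝ (Fin d)) ∞ (fun ρ => (e ρ).2) S
      (G.one y) := by
    refine ContMDiffWithinAt.mono_of_mem_nhdsWithin
      (contMDiff_snd.contMDiffAt.comp_contMDiffWithinAt _ (he _ (h1e y hyU))) ?_
    rw [hnS]
    exact self_mem_nhdsWithin
  refine ⟨κ, ε, EvSmooth.comp_of_mem he' (hfst.prodMk hcsum)
    (hUf.mono fun p hp => (het' _).2 hp), ?_, ?_, ?_, ?_, ?_⟩
  · refine ContMDiffWithinAt.sub ?_ ?_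
    · exact (evSmooth_chart _ _ hcs).contMDiffAt.comp_contMDiffWithinAt (G.one y) he2
    · exact ((ha₀.comp' (G.evSmooth_src (evSmooth_id _))
        (G.src_one y)).contMDiffAt).contMDiffWithinAt
  · simp [ε, a₀, G.src_one]
  · filter_upwards [hUf, (hsum.tendsto' hsum0).eventually (c.open_target.mem_nhds hct)] with p h2 h3
    have h4 : (p.1, c.symm (a₀ p.1 + p.2)) ∈ e.target := (het' _).2 h2
    have h5 : κ p ∈ e.source := e.map_target h4
    have h6 : e (κ p) = (p.1, c.symm (a₀ p.1 + p.2)) := e.right_inv h4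
    have h7 : G.src (κ p) = p.1 := by rw [← hep _ h5, h6]
    refine ⟨((hes' _).1 h5).1, h7, ?_⟩
    simp only [ε]
    rw [h6, h7, c.right_inv h3, add_sub_cancel_left]
  · filter_upwards [hU.mem_nhds hyU, hs1.tendsto.eventually (c.open_source.mem_nhds hcs)]
      with z h2 h3
    have h4 : (z, (e (G.one z)).2) = e (G.one z) :=
      Prod.ext (by rw [hep _ (h1e z h2), G.src_one]) rfl
    change e.symm (z, c.symm (c (e (G.one z)).2 + 0)) = _
    rw [add_zero, c.left_inv h3, h4, e.left_inv (h1e z h2)]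
  · have h2 : Tendsto (fun ρ => (e ρ).2) (𝓝[S] (G.one y)) (𝓝 (e (G.one y)).2) :=
      he2.continuousWithinAt
    have h3 : ∀ᶠ ρ in 𝓝[S] (G.one y), ρ ∈ e.source := by rw [hnS]; exact self_mem_nhdsWithin
    filter_upwards [h2.eventually (c.open_source.mem_nhds hcs), h3] with ρ h4 h5
    have h6 : (G.src ρ, (e ρ).2) = e ρ := Prod.ext (hep ρ h5).symm rfl
    change e.symm (G.src ρ, c.symm (a₀ (G.src ρ) + (c (e ρ).2 - a₀ (G.src ρ)))) = ρ
    rw [add_sub_cancel, c.left_inv h4, h6, e.left_inv h5]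

end Coordinates

end JetGpd

/-! ### Arrows modulo a subgroupoid: moves and cross sections. -/

namespace JetGpd

namespace LieGpd

variable {E V X : Type*} {M : Type w} [NormedAddCommGroup E] [NormedSpace ℝ E]
    [NormedAddCommGroup V] [NormedSpace ℝ V] [TopologicalSpace X] [ChartedSpace E X]
    [TopologicalSpace M] [ChartedSpace V M] {G : LieGpd E V X M} {S : Set M}

/-- A subset closed under the groupoid operations. -/
structure IsSubgroupoid (G : LieGpd E V X M) (S : Set M) : Prop where
  one_mem : ∀ x, G.one x ∈ S
  mul_mem : ∀ g ∈ S, ∀ h ∈ S, G.src g = G.tgt h → G.mul g h ∈ S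
  inv_mem : ∀ g ∈ S, G.inv g ∈ S

/-- The arrows up to composition from the left with arrows of a subgroupoid. -/
def IsSubgroupoid.setoid (hS : G.IsSubgroupoid S) : Setoid M where
  r g g' := ∃ ρ ∈ S, G.src ρ = G.tgt g ∧ g' = G.mul ρ g
  iseqv :=
    { refl := fun g => ⟨_, hS.one_mem _, G.src_one _, (G.one_mul g).symm⟩
      symm := by
        rintro g _ ⟨ρ, hρ, h, rfl⟩
        exact ⟨_, hS.inv_mem ρ hρ, by rw [G.src_inv, G.tgt_mul h], (G.inv_mul_cancel h).symm⟩
      trans := by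
        rintro g _ _ ⟨ρ, hρ, h, rfl⟩ ⟨ρ', hρ', h', rfl⟩
        rw [G.tgt_mul h] at h'
        exact ⟨_, hS.mul_mem _ hρ' _ hρ h', by rw [G.src_mul h', h], (G.mul_assoc h' h).symm⟩ }

/-- If `g' = ρ g`, a smooth family of arrows of `S` through `ρ`, indexed by the source, moves a
neighbourhood of `g` by left multiplication. -/
theorem IsSubgroupoid.hasMoves (hS : G.IsSubgroupoid S)
    (hB : IsSmoothBundle (E := E) (V := V) S G.src) : Setoid.HasMoves V hS.setoid := by
  rintro g _ ⟨ρ, hρ, h, rfl⟩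
  obtain ⟨γ, h1, h2, h3⟩ := hB.exists_section ρ hρ
  rw [h] at h1 h2 h3
  have h4 := (G.continuous_tgt.tendsto g).eventually h3
  refine ⟨fun w => G.mul (γ (G.tgt w)) w, G.evSmooth_mul (h1.comp' (G.evSmooth_tgt (evSmooth_id g))
    rfl) (evSmooth_id g) (h4.mono fun w hw => hw.2), by dsimp only; rw [h2], ?_⟩
  filter_upwards [h4] with w hw using ⟨_, hw.1, hw.2, rfl⟩

variable [IsManifold 𝓘(ℝ, V) ∞ M] [FiniteDimensional ℝ V]

/-- Near `g` the class is the immersed family `κ(t g, a) g`. A linear complement to its tangent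
space in a chart gives the slice `ν`, and `Θ(a, c) = κ(t ν(c), a) ν(c)` is a local diffeomorphism
straightening the classes; `e` is its second coordinate. Uniqueness on the slice rests on `S` being
embedded near the units. -/
theorem IsSubgroupoid.exists_hasCrossSection (hS : G.IsSubgroupoid S)
    (hB : IsSmoothBundle (E := E) (V := V) S G.src) :
    ∃ m : ℕ, ∀ g, Setoid.HasCrossSection V (EuclideanSpace ℝ (Fin m)) hS.setoid g := by
  obtain ⟨d, hd⟩ := hB.exists_coords hS.one_mem
  refine ⟨Module.finrank ℝ V - Module.finrank ℝ (EuclideanSpace ℝ (Fin d)), fun g => ?_⟩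
  let A := EuclideanSpace ℝ (Fin d)
  let C := EuclideanSpace ℝ (Fin (Module.finrank ℝ V - Module.finrank ℝ A))
  obtain ⟨κ, ε, hκ, hε, hε1, hκS, hκ1, hκε⟩ := hd (G.tgt g)
  let φ := chartAt V g
  have hφs : g ∈ φ.source := mem_chart_source V g
  have hφt : φ g ∈ φ.target := mem_chart_target V g
  have hφg : φ.symm (φ g) = g := φ.left_inv hφs
  have hφ : EvSmooth 𝓘(ℝ, V) 𝓘(ℝ, V) φ g := evSmooth_chart g g hφs
  have hφ' : EvSmooth 𝓘(ℝ, V) 𝓘(ℝ, V) φ.symm (φ g) := evSmooth_chart_symm g _ hφt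
  have hκy : κ (G.tgt g, 0) = G.one (G.tgt g) := hκ1.self_of_nhds
  have hκg : G.mul (κ (G.tgt g, 0)) g = g := by rw [hκy, G.one_mul]
  -- the orbit directions
  have hpair : EvSmooth 𝓘(ℝ, A) (𝓘(ℝ, E).prod 𝓘(ℝ, A)) (fun a : A => (G.tgt g, a)) 0 :=
    (evSmooth_const _ _).prodMk (evSmooth_id _)
  have hκa := hpair.tendsto.eventually hκS
  have hm1 : EvSmooth 𝓘(ℝ, A) 𝓘(ℝ, V) (fun a : A => G.mul (κ (G.tgt g, a)) g) 0 :=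
    G.evSmooth_mul (hκ.comp' hpair rfl) (evSmooth_const g _) (hκa.mono fun a ha => ha.2.1)
  let Θ₁ : A → V := fun a => φ (G.mul (κ (G.tgt g, a)) g)
  have hΘ₁ : EvSmooth 𝓘(ℝ, A) 𝓘(ℝ, V) Θ₁ 0 := hφ.comp' hm1 hκg
  have hΘ₁0 : Θ₁ 0 = φ g := congrArg φ hκg
  have hΘ₁d : HasFDerivAt Θ₁ (fderiv ℝ Θ₁ 0) 0 :=
    ((contMDiffAt_iff_contDiffAt.1 hΘ₁.contMDiffAt).differentiableAt (by simp)).hasFDerivAt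
  -- The orbit parametrisation has the left inverse `k`, which recovers `a` from `v g⁻¹`. As `ε` is
  -- smooth only along `S`, this `k` is differentiable only within `s`; `Θ₁` takes values in `s`, so
  -- the chain rule still applies.
  have hL : Function.Injective (fderiv ℝ Θ₁ 0) := by
    let s : Set V := {v | G.src (φ.symm v) = G.src g ∧ G.mul (φ.symm v) (G.inv g) ∈ S}
    let k : V → A := fun v => ε (G.mul (φ.symm v) (G.inv g))
    have hk1 : ContMDiffWithinAt 𝓘(ℝ, V) (𝓘(ℝ, V).prod 𝓘(ℝ, V)) ∞
        (fun v => (φ.symm v, G.inv g)) s (φ g) :=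
      (hφ'.contMDiffAt.prodMk contMDiffAt_const).contMDiffWithinAt
    have hk2 : ContMDiffWithinAt 𝓘(ℝ, V) 𝓘(ℝ, V) ∞ (fun v => G.mul (φ.symm v) (G.inv g)) s
        (φ g) := by
      refine (G.contMDiffOn_mul (φ.symm (φ g), G.inv g) ?_).comp (φ g) hk1 fun v hv => ?_
      · change G.src (φ.symm (φ g)) = G.tgt (G.inv g)
        rw [hφg, G.tgt_inv]
      · change G.src (φ.symm v) = G.tgt (G.inv g)
        rw [hv.1, G.tgt_inv]
    have e1 : G.one (G.tgt g) = G.mul (φ.symm (φ g)) (G.inv g) := by rw [hφg, G.mul_inv]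
    have hk : ContMDiffWithinAt 𝓘(ℝ, V) 𝓘(ℝ, A) ∞ k s (φ g) :=
      (e1 ▸ hε : ContMDiffWithinAt 𝓘(ℝ, V) 𝓘(ℝ, A) ∞ ε S (G.mul (φ.symm (φ g)) (G.inv g))).comp
        (φ g) hk2 fun v hv => hv.2
    have hkd := ((contMDiffWithinAt_iff_contDiffWithinAt.1 hk).differentiableWithinAt
      (by simp)).hasFDerivWithinAt
    have hΘs : ∀ᶠ a in 𝓝 (0 : A), Θ₁ a ∈ s ∧ k (Θ₁ a) = a := by
      filter_upwards [hκa, (hm1.tendsto' hκg).eventually (φ.open_source.mem_nhds hφs)] with a h1 h2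
      have h3 : φ.symm (Θ₁ a) = G.mul (κ (G.tgt g, a)) g := φ.left_inv h2
      have h4 : G.mul (φ.symm (Θ₁ a)) (G.inv g) = κ (G.tgt g, a) := by
        rw [h3, G.mul_mul_inv h1.2.1]
      refine ⟨⟨by rw [h3, G.src_mul h1.2.1], by rw [h4]; exact h1.1⟩, ?_⟩
      simp only [k]
      rw [h4, h1.2.2]
    rw [← hΘ₁0] at hkd
    have h5 := hkd.comp_hasFDerivAt (0 : A) hΘ₁d (hΘs.mono fun a ha => ha.1)
    have h6 := h5.unique ((hasFDerivAt_id (0 : A)).congr_of_eventuallyEq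
      (hΘs.mono fun a ha => ha.2))
    refine (injective_iff_map_eq_zero _).2 fun a ha => ?_
    have h7 := congrArg (fun L : A →L[ℝ] A => L a) h6
    simpa [ha] using h7.symm
  obtain ⟨ι, hι, hdim⟩ := exists_complement_map _ hL
  -- the slice
  let ν : C → M := fun c => φ.symm (φ g + ι c)
  have hν0 : ν 0 = g := by simp only [ν, map_zero, add_zero, hφg]
  have hιs : ContDiff ℝ ∞ (fun c : C => φ g + ι c) := contDiff_const.add ι.contDiff
  have hν : EvSmooth 𝓘(ℝ, C) 𝓘(ℝ, V) ν 0 :=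
    hφ'.comp' (hιs.contMDiff.evSmooth 0) (by simp)
  have hφν : ∀ᶠ c in 𝓝 (0 : C), φ (ν c) = φ g + ι c := by
    have h1 : Tendsto (fun c : C => φ g + ι c) (𝓝 0) (𝓝 (φ g)) := by
      have := hιs.continuous.tendsto 0
      rwa [map_zero, add_zero] at this
    filter_upwards [h1.eventually (φ.open_target.mem_nhds hφt)] with c hc using φ.right_inv hc
  have hfst : EvSmooth 𝓘(ℝ, A × C) 𝓘(ℝ, A) (Prod.fst : A × C → A) 0 :=
    contDiff_fst.contMDiff.evSmooth _
  have hsnd : EvSmooth 𝓘(ℝ, A × C) 𝓘(ℝ, C) (Prod.snd : A × C → C) 0 :=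
    contDiff_snd.contMDiff.evSmooth _
  have hνs : EvSmooth 𝓘(ℝ, A × C) 𝓘(ℝ, V) (fun p : A × C => ν p.2) 0 := hν.comp' hsnd rfl
  have hpt : EvSmooth 𝓘(ℝ, A × C) (𝓘(ℝ, E).prod 𝓘(ℝ, A))
    (fun p : A × C => (G.tgt (ν p.2), p.1)) 0 := (G.evSmooth_tgt hνs).prodMk hfst
  have hpt0 : (G.tgt (ν (0 : A × C).2), (0 : A × C).1) = (G.tgt g, 0) := by
    change (G.tgt (ν 0), (0 : A)) = _
    rw [hν0]
  have hκp := (hpt.tendsto' hpt0).eventually hκS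
  -- Along `c = 0` this is the orbit parametrisation of `g`, and along `a = 0` it is the slice, so
  -- its differential at zero is the injective map `(a, c) ↦ L a + ι c`, with `L` the derivative of
  -- the orbit parametrisation.
  let Θ : A × C → M := fun p => G.mul (κ (G.tgt (ν p.2), p.1)) (ν p.2)
  have hΘ : EvSmooth 𝓘(ℝ, A × C) 𝓘(ℝ, V) Θ 0 :=
    G.evSmooth_mul (hκ.comp' hpt hpt0) hνs (hκp.mono fun p hp => hp.2.1)
  have hΘ0 : Θ 0 = g := by
    change G.mul (κ (G.tgt (ν 0), 0)) (ν 0) = g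
    rw [hν0, hκg]
  have hΘr : ∀ᶠ c in 𝓝 (0 : C), Θ (0, c) = ν c := by
    have h1 := (G.evSmooth_tgt hν).tendsto' (congrArg G.tgt hν0)
    filter_upwards [h1.eventually hκ1] with c hc
    simp only [Θ]
    rw [hc, G.one_mul]
  let Ψ : A × C → V := fun p => φ (Θ p)
  have hΨ : EvSmooth 𝓘(ℝ, A × C) 𝓘(ℝ, V) Ψ 0 := hφ.comp' hΘ hΘ0
  have hΨ0 : Ψ 0 = φ g := congrArg φ hΘ0
  have hΨd : HasFDerivAt Ψ (fderiv ℝ Ψ 0) 0 :=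
    ((contMDiffAt_iff_contDiffAt.1 hΨ.contMDiffAt).differentiableAt (by simp)).hasFDerivAt
  have hinj : ∀ p, fderiv ℝ Ψ 0 p = 0 → p = 0 := by
    rintro ⟨a, c⟩ hp
    have h1 : HasFDerivAt (fun a : A => Ψ (a, 0)) _ (0 : A) :=
      HasFDerivAt.comp (0 : A) (f := fun a : A => (a, (0 : C))) hΨd
        (hasFDerivAt_prodMk_left (𝕜 := ℝ) (0 : A) (0 : C))
    have h2 : HasFDerivAt (fun c : C => Ψ (0, c)) _ (0 : C) :=
      HasFDerivAt.comp (0 : C) (f := fun c : C => ((0 : A), c)) hΨd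
        (hasFDerivAt_prodMk_right (𝕜 := ℝ) (0 : A) (0 : C))
    have h3 : (fun a : A => Ψ (a, 0)) = Θ₁ := by
      funext a
      simp only [Ψ, Θ, Θ₁, hν0]
    rw [h3] at h1
    have h4 : (fun c : C => Ψ (0, c)) =ᶠ[𝓝 0] fun c => φ g + ι c := by
      filter_upwards [hΘr, hφν] with c h5 h6
      simp only [Ψ]
      rw [h5, h6]
    have h5 := h1.unique hΘ₁d
    have h6 := h2.unique ((ι.hasFDerivAt.const_add (φ g)).congr_of_eventuallyEq h4)
    have h7 : fderiv ℝ Ψ 0 (a, 0) = fderiv ℝ Θ₁ 0 a := congrArg (fun L : A →L[ℝ] V => L a) h5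
    have h8 : fderiv ℝ Ψ 0 (0, c) = ι c := congrArg (fun L : C →L[ℝ] V => L c) h6
    have h9 : ((a, c) : A × C) = (a, 0) + (0, c) := by simp
    rw [h9, map_add, h7, h8] at hp
    obtain ⟨rfl, rfl⟩ := hι a c hp
    rfl
  have hfin : Module.finrank ℝ (A × C) = Module.finrank ℝ V := by
    rw [Module.finrank_prod, finrank_euclideanSpace_fin (𝕜 := ℝ) (n := _ - _)]
    exact hdim
  obtain ⟨γ, hγ, hγ0, hγΨ, hΨγ⟩ :=
    exists_local_inverse (evSmooth_iff_contDiffAt.1 hΨ) hinj hfin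
  rw [hΨ0] at hγ hγ0 hΨγ
  have hγs := evSmooth_iff_contDiffAt.2 hγ
  have hγφ : EvSmooth 𝓘(ℝ, V) 𝓘(ℝ, A × C) (fun w => γ (φ w)) g := hγs.comp' hφ rfl
  have he : EvSmooth 𝓘(ℝ, V) 𝓘(ℝ, C) (fun w => (γ (φ w)).2) g := hsnd.comp' hγφ hγ0
  have he0 : (γ (φ g)).2 = 0 := by rw [hγ0]; rfl
  refine ⟨fun w => (γ (φ w)).2, ν, he, ?_, ?_, ?_, ?_⟩
  · dsimp only
    rw [he0]
    exact hν
  · dsimp only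
    rw [he0, hν0]
  · have h1 := hγφ.tendsto' hγ0
    filter_upwards [hφ.tendsto.eventually hΨγ, h1.eventually hκp, φ.open_source.mem_nhds hφs,
      h1.eventually ((hΘ.tendsto' hΘ0).eventually (φ.open_source.mem_nhds hφs))] with w h2 h3 h4 h5
    exact ⟨_, h3.1, h3.2.1, (φ.injOn h5 h4 h2).symm⟩
  · dsimp only
    rw [he0]
    let P : Set (C × C) := {p | G.src (ν p.1) = G.src (ν p.2) ∧ G.mul (ν p.2) (G.inv (ν p.1)) ∈ S}
    have hf1 : Tendsto (Prod.fst : C × C → C) (𝓝 (0, 0)) (𝓝 0) := continuous_fst.tendsto _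
    have hf2 : Tendsto (Prod.snd : C × C → C) (𝓝 (0, 0)) (𝓝 0) := continuous_snd.tendsto _
    have hνt := hν.tendsto' hν0
    -- If `ν(p.1)` and `ν(p.2)` are equivalent, the arrow joining them is `ν(p.2) ν(p.1)⁻¹ ∈ S`. It
    -- approaches a unit as both parameters tend to zero, and `ε` is then continuous along `S`.
    have hD : Tendsto (fun p : C × C => G.mul (ν p.2) (G.inv (ν p.1))) (𝓝[P] (0, 0))
        (𝓝[S] (G.one (G.tgt g))) := by
      refine tendsto_nhdsWithin_iff.2 ⟨?_, eventually_of_mem self_mem_nhdsWithin fun p hp => hp.2⟩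
      have h1 := (G.contMDiffOn_mul (g, G.inv g) (G.tgt_inv g).symm).continuousWithinAt
      have h2 : Tendsto (fun p : C × C => (ν p.2, G.inv (ν p.1))) (𝓝[P] (0, 0))
          (𝓝[{z : M × M | G.src z.1 = G.tgt z.2}] (g, G.inv g)) := by
        refine tendsto_nhdsWithin_iff.2 ⟨Tendsto.mono_left ?_ nhdsWithin_le_nhds,
          eventually_of_mem self_mem_nhdsWithin fun p hp => ?_⟩
        · exact (hνt.comp hf2).prodMk_nhds
            ((G.contMDiff_inv.continuous.tendsto g).comp (hνt.comp hf1))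
        · change G.src (ν p.2) = G.tgt (G.inv (ν p.1))
          rw [G.tgt_inv, hp.1]
      have h3 := h1.tendsto.comp h2
      dsimp only at h3
      rwa [G.mul_inv] at h3
    have hεD : Tendsto (fun p : C × C => ε (G.mul (ν p.2) (G.inv (ν p.1)))) (𝓝[P] (0, 0))
        (𝓝 0) := by
      have := hε.continuousWithinAt.tendsto.comp hD
      rwa [hε1] at this
    have h1 : Tendsto (fun p : C × C => (ε (G.mul (ν p.2) (G.inv (ν p.1))), p.1)) (𝓝[P] (0, 0))
        (𝓝 (0 : A × C)) := hεD.prodMk_nhds (hf1.mono_left nhdsWithin_le_nhds)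
    have h2 : Tendsto (fun p : C × C => ((0 : A), p.2)) (𝓝[P] (0, 0)) (𝓝 (0 : A × C)) :=
      tendsto_const_nhds.prodMk_nhds (hf2.mono_left nhdsWithin_le_nhds)
    -- The joining arrow `D` is recovered from its coordinate `ε D`, whence `Θ(ε D, p.1) = ν(p.2) =
    -- Θ(0, p.2)`; injectivity of `Θ` near zero gives `p.1 = p.2`.
    have h3 : ∀ᶠ p in 𝓝[P] ((0, 0) : C × C), p.1 = p.2 := by
      filter_upwards [hD.eventually hκε, h1.eventually hγΨ, h2.eventually hγΨ,
        (hf2.mono_left nhdsWithin_le_nhds).eventually hΘr, self_mem_nhdsWithin] with p k1 k2 k3 k4 k5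
      have k6 : G.src (ν p.2) = G.tgt (G.inv (ν p.1)) := by rw [G.tgt_inv, k5.1]
      have k7 : Θ (ε (G.mul (ν p.2) (G.inv (ν p.1))), p.1) = Θ (0, p.2) := by
        rw [k4]
        simp only [Θ]
        rw [G.src_mul k6, G.src_inv] at k1
        rw [k1, G.mul_inv_mul k5.1.symm]
      have k8 := k3.symm.trans ((congrArg (fun w => γ (φ w)) k7).symm.trans k2)
      exact (congrArg Prod.snd k8).symm
    rw [eventually_nhdsWithin_iff, nhds_prod_eq] at h3
    obtain ⟨T, hT, hTP⟩ := mem_prod_self_iff.1 h3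
    refine ⟨T, hT, fun a ha b hb hab => hTP (mk_mem_prod ha hb) ?_⟩
    obtain ⟨ρ, hρ, hρ1, hρ2⟩ := hab
    refine ⟨by rw [hρ2, G.src_mul hρ1], ?_⟩
    change G.mul (ν b) (G.inv (ν a)) ∈ S
    rw [hρ2, G.mul_mul_inv hρ1]
    exact hρ

end LieGpd

end JetGpd

/-! ### Homogeneous actions: Hausdorffness and local triviality. -/

namespace JetGpd

namespace GpdAction

section Homogeneous

variable {E V X M W : Type*} {F : Type w} [NormedAddCommGroup E] [NormedSpace ℝ E]
    [NormedAddCommGroup V] [NormedSpace ℝ V] [TopologicalSpace X] [ChartedSpace E X]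
    [TopologicalSpace M] [ChartedSpace V M] [NormedAddCommGroup W] [NormedSpace ℝ W]
    [TopologicalSpace F] [ChartedSpace W F] {G : LieGpd E V X M} {A : GpdAction G W F}
    [IsManifold 𝓘(ℝ, E) ∞ X] [FiniteDimensional ℝ W] [IsManifold 𝓘(ℝ, W) ∞ F]

/-- The total space of a homogeneous action is automatically Hausdorff. -/
theorem IsHomogeneous.t2Space [FiniteDimensional ℝ V] [IsManifold 𝓘(ℝ, V) ∞ M]
    [SecondCountableTopology M] [T2Space X] (hA : A.IsHomogeneous) : T2Space F := by
  refine t2_iff_nhds.2 fun {u v} h => ?_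
  have hl : 𝓝 u ⊓ 𝓝 v ≤ 𝓝 u := inf_le_left
  have hr : 𝓝 u ⊓ 𝓝 v ≤ 𝓝 v := inf_le_right
  have hproj : A.proj v = A.proj u :=
    tendsto_nhds_unique ((A.continuous_proj.tendsto v).mono_left hr)
      ((A.continuous_proj.tendsto u).mono_left hl)
  -- For `w` near `u`, the arrow `τ w` is close to a unit and `u τ(w) = w`, so `w τ(w)⁻¹ = u`. If
  -- `w` approaches `v` as well, the left side tends to `v` by continuity of the action. Thus the
  -- constant `u` converges to `v`, and points are closed because `F` has charts.
  obtain ⟨τ, h1, h2, h3⟩ := hA.exists_orbit_section (u₀ := u) (p := G.one (A.proj u))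
    (G.tgt_one _)
  rw [A.act_one] at h1 h2 h3
  have ht : Tendsto (fun w => G.inv (τ w)) (𝓝 u) (𝓝 (G.one (A.proj v))) := by
    rw [hproj, ← G.inv_one]
    exact (G.contMDiff_inv.continuous.tendsto _).comp (h1.tendsto' h2)
  have hs : ∀ᶠ w in 𝓝 u, A.proj w = G.tgt (G.inv (τ w)) := by
    filter_upwards [h3] with w hw
    rw [G.tgt_inv, ← A.proj_act hw.1.symm, hw.2]
  have hpair : Tendsto (fun w => (w, G.inv (τ w))) (𝓝 u ⊓ 𝓝 v)
      (𝓝[{z : F × M | A.proj z.1 = G.tgt z.2}] (v, G.one (A.proj v))) :=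
    tendsto_nhdsWithin_iff.2 ⟨(tendsto_id.mono_left hr).prodMk_nhds (ht.mono_left hl),
      hs.filter_mono hl⟩
  have hact := (A.contMDiffOn_act (v, G.one (A.proj v))
    (G.tgt_one _).symm).continuousWithinAt.tendsto.comp hpair
  dsimp only at hact
  rw [A.act_one] at hact
  have hconst : Tendsto (fun _ : F => u) (𝓝 u ⊓ 𝓝 v) (𝓝 v) := by
    refine hact.congr' (hl ?_)
    filter_upwards [h3] with w hw
    change A.act w (G.inv (τ w)) = u
    have h4 := act_act_inv (A := A) hw.1.symm
    rwa [hw.2] at h4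
  have : T1Space F := ChartedSpace.t1Space W F
  exact tendsto_const_nhds_iff.1 hconst

/-- Acting by a smooth family of arrows from `π(u₀)` to the variable base point, with the unit at
`π(u₀)`, retracts a neighbourhood of `u₀` onto the fibre. -/
theorem exists_hasSlice_fiber (u₀ : F) :
    ∃ d, HasSlice (V := W) {u | A.proj u = A.proj u₀} u₀ d := by
  obtain ⟨b, h1, h2, h3⟩ := G.exists_section_from (G.one (A.proj u₀))
  rw [G.tgt_one] at h1 h2 h3
  rw [G.src_one] at h3
  have hp := (A.continuous_proj.tendsto u₀).eventually h3
  refine HasSlice.of_retraction (ρ := fun u => A.act u (b (A.proj u)))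
    (evSmooth_act (evSmooth_id _) (h1.comp' (A.contMDiff_proj.evSmooth _) rfl)
      (hp.mono fun u hu => hu.2.symm)) ?_ ?_ ?_
  · rw [h2, A.act_one]
  · filter_upwards [hp] with u hu
    exact (A.proj_act hu.2.symm).trans hu.1
  · refine Eventually.of_forall fun u (hu : A.proj u = A.proj u₀) => ?_
    rw [hu, h2, ← hu, A.act_one]

/-- An isotropy arrow carries `z` to `u₀`; extended to a bisection, it acts on a neighbourhood in
`F` and transports the slice. -/
theorem IsHomogeneous.hasSlice_fiber (hA : A.IsHomogeneous) {u₀ : F} {d : ℕ}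
    (hd : HasSlice (V := W) {u | A.proj u = A.proj u₀} u₀ d) :
    ∀ z ∈ {u | A.proj u = A.proj u₀}, HasSlice (V := W) {u | A.proj u = A.proj u₀} z d := by
  intro z (hz : A.proj z = A.proj u₀)
  obtain ⟨g, hgs, hgt, hgz⟩ := hA z u₀ hz
  obtain ⟨β, l, l', hβ, hβg, hβz, hl, hl', hll, hll', i1, i2⟩ := G.exists_bisection g
  rw [hgt, hz] at hβ hβg hβz hl hll hll' i1
  rw [hgs, hz] at hl' hll hll' i2
  have hpz := A.continuous_proj.tendsto z
  rw [hz] at hpz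
  have hpu := A.continuous_proj.tendsto u₀
  have eβ := hpz.eventually hβz
  have eβ' := ((hl'.tendsto' hll').comp hpu).eventually hβz
  have sβ : EvSmooth 𝓘(ℝ, W) 𝓘(ℝ, V) (fun u => β (A.proj u)) z :=
    hβ.comp' (A.contMDiff_proj.evSmooth _) hz
  have sβ' : EvSmooth 𝓘(ℝ, W) 𝓘(ℝ, V) (fun u => β (l' (A.proj u))) u₀ :=
    hβ.comp' (hl'.comp' (A.contMDiff_proj.evSmooth _) rfl) hll'
  have tβ' : ∀ᶠ u in 𝓝 u₀, A.proj u = G.tgt (G.inv (β (l' (A.proj u)))) := by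
    filter_upwards [eβ', hpu.eventually i2] with u h1 h2
    simp only [Function.comp_apply] at h1
    rw [G.tgt_inv, h1.1, h2]
  refine hd.transport (z' := z)
    (evSmooth_act (evSmooth_id _) sβ (eβ.mono fun u hu => hu.2.symm))
    (evSmooth_act (evSmooth_id _) (G.evSmooth_inv sβ') tβ') ?_ ?_ ?_ ?_
  · rw [hz, hβg, hgz]
  · rw [hll', hβg, ← hgz, act_act_inv hgt.symm]
  · filter_upwards [eβ] with w hw h0
    have h0' : A.proj w = A.proj u₀ := h0
    have h1 : A.proj (A.act w (β (A.proj w))) = A.proj u₀ := by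
      rw [A.proj_act hw.2.symm, hw.1, h0', hll]
    refine ⟨h1, ?_⟩
    rw [h1, hll', h0', hβg]
    exact act_act_inv (by rw [h0', hgt, hz])
  · filter_upwards [tβ'] with w hw h0
    have h0' : A.proj w = A.proj u₀ := h0
    rw [h0', hll', hβg] at hw ⊢
    have h1 : A.proj (A.act w (G.inv g)) = A.proj u₀ := by
      rw [A.proj_act (h0'.trans hw), G.src_inv, hgt, hz]
    refine ⟨h1, ?_⟩
    rw [h1, hβg]
    exact act_inv_act (by rw [h0', hw, G.tgt_inv])

/-- A homogeneous action is a smooth fibre bundle. -/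
theorem IsHomogeneous.isSmoothBundle [T2Space F] [SecondCountableTopology F]
    (hA : A.IsHomogeneous) (u₀ : F) : IsSmoothBundle (E := E) (V := W) univ A.proj := by
  classical
  obtain ⟨d, hd⟩ := A.exists_hasSlice_fiber u₀
  obtain ⟨x₀, hx₀⟩ : ∃ x₀, x₀ = A.proj u₀ := ⟨_, rfl⟩
  replace hd := hA.hasSlice_fiber hd
  rw [← hx₀] at hd
  let Φ : Set F := {u | A.proj u = x₀}
  obtain ⟨i1, i2, hval, hρ⟩ := exists_subtype_manifold (S := Φ) hd
  refine ⟨d, Φ, inferInstance, i1, i2, inferInstance, inferInstance, fun x => ?_⟩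
  -- The arrow `b z` runs from `x₀` to `z`, so `u ↦ (π u, u b(π u))` trivialises the projection near
  -- `x`, with inverse `(z, w) ↦ w b(z)⁻¹`.
  obtain ⟨p, hps, hpt⟩ := G.exists_mem x₀ x
  obtain ⟨b, h1, h2, h3⟩ := G.exists_section_from p
  rw [hps, hpt] at h3
  rw [hpt] at h1
  obtain ⟨U, hU, hUo, hxU⟩ := eventually_nhds_iff.1 (h1.eventually.and h3)
  have hmem : ∀ u, A.proj u ∈ U → A.act u (b (A.proj u)) ∈ Φ := fun u hu =>
    (A.proj_act (hU _ hu).2.2.symm).trans (hU _ hu).2.1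
  have htgt : ∀ (w : Φ) (z : X), z ∈ U → A.proj (w : F) = G.tgt (G.inv (b z)) := fun w z hz => by
    rw [G.tgt_inv, (hU _ hz).2.1]
    exact w.2
  have hprj : ∀ (w : Φ) (z : X), z ∈ U → A.proj (A.act w (G.inv (b z))) = z := fun w z hz => by
    rw [A.proj_act (htgt w z hz), G.src_inv, (hU _ hz).2.2]
  let e₂ : F → Φ := fun u => if h : A.act u (b (A.proj u)) ∈ Φ then ⟨_, h⟩ else ⟨u₀, hx₀.symm⟩
  have he₂ : ∀ u, A.proj u ∈ U → (e₂ u : F) = A.act u (b (A.proj u)) :=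
    fun u hu => by simp only [e₂, dif_pos (hmem u hu)]
  refine ⟨U, { toFun := fun u => (A.proj u, e₂ u)
               invFun := fun z => A.act z.2 (G.inv (b z.1))
               source := univ ∩ A.proj ⁻¹' U
               target := U ×ˢ univ
               map_source' := fun g hg => ⟨hg.2, mem_univ _⟩
               map_target' := ?_
               left_inv' := ?_
               right_inv' := ?_ }, hUo, hxU, rfl, rfl, fun _ _ => rfl, ?_, ?_⟩
  · rintro ⟨z, w⟩ ⟨hz, -⟩
    refine ⟨mem_univ _, ?_⟩
    change A.proj (A.act w (G.inv (b z))) ∈ U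
    rw [hprj w z hz]
    exact hz
  · rintro u ⟨-, hu⟩
    change A.act (e₂ u) (G.inv (b (A.proj u))) = u
    rw [he₂ u hu, act_act_inv (hU _ hu).2.2.symm]
  · rintro ⟨z, w⟩ ⟨hz, -⟩
    have h4 := hprj w z hz
    refine Prod.ext h4 (Subtype.ext ?_)
    change (e₂ (A.act w (G.inv (b z))) : F) = w
    rw [he₂ _ (by rw [h4]; exact hz), h4, act_inv_act (by rw [htgt w z hz, G.tgt_inv])]
  · rintro u ⟨-, hu⟩
    have s1 : EvSmooth 𝓘(ℝ, W) 𝓘(ℝ, W) (fun u => A.act u (b (A.proj u))) u :=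
      evSmooth_act (evSmooth_id u) ((hU _ hu).1.comp' (A.contMDiff_proj.evSmooth _) rfl)
        (eventually_of_mem ((hUo.preimage A.continuous_proj).mem_nhds hu)
          fun v hv => (hU _ hv).2.2.symm)
    obtain ⟨ρ, hρ1, hρ2⟩ := hρ ⟨_, hmem u hu⟩
    have s2 := hρ1.comp' s1 rfl
    refine ContMDiffWithinAt.prodMk (A.contMDiff_proj u).contMDiffWithinAt
      (s2.contMDiffAt.contMDiffWithinAt.congr_of_eventuallyEq ?_ ?_)
    · filter_upwards [self_mem_nhdsWithin,
        mem_nhdsWithin_of_mem_nhds (s1.tendsto.eventually hρ2)] with u' h4 h5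
      exact Subtype.ext ((he₂ u' h4.2).trans (h5 (hmem u' h4.2)).symm)
    · exact Subtype.ext ((he₂ u hu).trans (hρ2.self_of_nhds (hmem u hu)).symm)
  · rintro ⟨z, w⟩ ⟨hz, -⟩
    refine (evSmooth_act ((hval.evSmooth w).comp' (contMDiff_snd.evSmooth (z, w)) rfl)
      (G.evSmooth_inv ((hU _ hz).1.comp' (contMDiff_fst.evSmooth (z, w)) rfl))
      ?_).contMDiffAt.contMDiffWithinAt
    filter_upwards [(hUo.preimage continuous_fst).mem_nhds hz] with a ha
    exact htgt a.2 a.1 ha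

end Homogeneous

end GpdAction

end JetGpd

/-! ### The right action on arrows modulo a subgroupoid. -/

namespace JetGpd

namespace LieGpd

section QuotientAction

variable {E V X M W : Type*} [NormedAddCommGroup E] [NormedSpace ℝ E]
    [NormedAddCommGroup V] [NormedSpace ℝ V] [TopologicalSpace X] [ChartedSpace E X]
    [TopologicalSpace M] [ChartedSpace V M] [NormedAddCommGroup W] [NormedSpace ℝ W]
    {G : LieGpd E V X M} {S : Set M}

namespace IsSubgroupoid

variable (hS : G.IsSubgroupoid S)

/-- The class of an arrow modulo a subgroupoid. -/
def toQuotient (g : M) : Quotient hS.setoid := Quotient.mk _ g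

theorem toQuotient_eq_iff {g g' : M} : hS.toQuotient g = hS.toQuotient g' ↔
    ∃ ρ ∈ S, G.src ρ = G.tgt g ∧ g' = G.mul ρ g :=
  Quotient.eq (r := hS.setoid)

theorem toQuotient_mul {ρ g : M} (hρ : ρ ∈ S) (h : G.src ρ = G.tgt g) :
    hS.toQuotient (G.mul ρ g) = hS.toQuotient g :=
  (hS.toQuotient_eq_iff.2 ⟨ρ, hρ, h, rfl⟩).symm

/-- The source of a class of arrows. -/
def quotientProj : Quotient hS.setoid → X :=
  Quotient.lift G.src fun g g' h => by
    obtain ⟨ρ, -, h1, rfl⟩ : ∃ ρ ∈ S, G.src ρ = G.tgt g ∧ g' = G.mul ρ g := h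
    exact (G.src_mul h1).symm

theorem quotientProj_toQuotient (g : M) : hS.quotientProj (hS.toQuotient g) = G.src g := rfl

/-- Composition of a class of arrows with an arrow from the right. -/
noncomputable def quotientAct (u : Quotient hS.setoid) (g : M) : Quotient hS.setoid :=
  hS.toQuotient (G.mul u.out g)

/-- Right multiplication commutes with left multiplication by `S`, so the representative chosen by
`Quotient.out` is immaterial. -/
theorem quotientAct_toQuotient {h g : M} (H : G.src h = G.tgt g) :
    hS.quotientAct (hS.toQuotient h) g = hS.toQuotient (G.mul h g) := by
  obtain ⟨ρ, hρ, h1, h2⟩ := hS.toQuotient_eq_iff.1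
    (Quotient.out_eq (hS.toQuotient h)).symm
  have h3 : hS.quotientAct (hS.toQuotient h) g = hS.toQuotient (G.mul (G.mul ρ h) g) := by
    rw [← h2]; rfl
  rw [h3, G.mul_assoc h1 H, hS.toQuotient_mul hρ (by rw [h1, G.tgt_mul H])]

variable [ChartedSpace W (Quotient hS.setoid)]

/-- The smooth action of a Lie groupoid on its quotient by a subgroupoid. -/
noncomputable def quotientAction (hmk : ContMDiff 𝓘(ℝ, V) 𝓘(ℝ, W) ∞ hS.toQuotient)
    (hη : ∀ g, ∃ η : Quotient hS.setoid → M, EvSmooth 𝓘(ℝ, W) 𝓘(ℝ, V) η (hS.toQuotient g) ∧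
      η (hS.toQuotient g) = g ∧ ∀ᶠ u in 𝓝 (hS.toQuotient g), hS.toQuotient (η u) = u) :
    GpdAction G W (Quotient hS.setoid) where
  proj := hS.quotientProj
  contMDiff_proj u := by
    induction u using Quotient.ind with
    | _ g =>
      obtain ⟨η, h1, h2, h3⟩ := hη g
      refine (EvSmooth.congr (G.evSmooth_src h1) ?_).contMDiffAt
      filter_upwards [h3] with u hu
      rw [← hS.quotientProj_toQuotient, hu]
  act := hS.quotientAct
  contMDiffOn_act := by
    rintro ⟨u, g⟩ H
    induction u using Quotient.ind with
    | _ h =>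
      obtain ⟨η, h1, h2, h3⟩ := hη h
      change G.src h = G.tgt g at H
      have hηp : ∀ᶠ u in 𝓝 (hS.toQuotient h), G.src (η u) = hS.quotientProj u := by
        filter_upwards [h3] with u hu
        rw [← hS.quotientProj_toQuotient, hu]
      let s : Set (Quotient hS.setoid × M) := {z | hS.quotientProj z.1 = G.tgt z.2}
      have hf : Tendsto Prod.fst (𝓝[s] (hS.toQuotient h, g)) (𝓝 (hS.toQuotient h)) :=
        (continuous_fst.tendsto _).mono_left nhdsWithin_le_nhds
      -- Close to the base point, `u` and its smooth representative `η u` have the same source.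
      -- Composability can thus be tested on `η u`, and the action becomes the class of `η(u) g`.
      let s' : Set (Quotient hS.setoid × M) := {z | G.src (η z.1) = G.tgt z.2}
      have hss : s' ∈ 𝓝[s] (hS.toQuotient h, g) := by
        filter_upwards [hf.eventually hηp, self_mem_nhdsWithin] with z h4 h5
        exact h4.trans h5
      have hmul : ContMDiffWithinAt (𝓘(ℝ, W).prod 𝓘(ℝ, V)) 𝓘(ℝ, V) ∞
          (fun z : Quotient hS.setoid × M => G.mul (η z.1) z.2) s' (hS.toQuotient h, g) := by
        have h4 : ContMDiffAt (𝓘(ℝ, W).prod 𝓘(ℝ, V)) (𝓘(ℝ, V).prod 𝓘(ℝ, V)) ∞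
            (fun z : Quotient hS.setoid × M => (η z.1, z.2)) (hS.toQuotient h, g) :=
          (h1.contMDiffAt.comp (hS.toQuotient h, g) contMDiffAt_fst).prodMk contMDiffAt_snd
        refine (G.contMDiffOn_mul (η (hS.toQuotient h), g) ?_).comp (hS.toQuotient h, g)
          h4.contMDiffWithinAt fun z hz => hz
        change G.src (η (hS.toQuotient h)) = G.tgt g
        rw [h2, H]
      have h5 := (hmk.contMDiffAt.comp_contMDiffWithinAt _ hmul).mono_of_mem_nhdsWithin hss
      refine h5.congr_of_eventuallyEq ?_ ?_
      · filter_upwards [hss, hf.eventually h3] with z h6 h7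
        change hS.quotientAct z.1 z.2 = hS.toQuotient (G.mul (η z.1) z.2)
        rw [← hS.quotientAct_toQuotient h6, h7]
      · change hS.quotientAct (hS.toQuotient h) g = hS.toQuotient (G.mul (η (hS.toQuotient h)) g)
        rw [h2, hS.quotientAct_toQuotient H]
  proj_act := by
    intro u g H
    induction u using Quotient.ind with
    | _ h =>
      change G.src h = G.tgt g at H
      change hS.quotientProj (hS.quotientAct (hS.toQuotient h) g) = _
      rw [hS.quotientAct_toQuotient H, hS.quotientProj_toQuotient, G.src_mul H]
  act_mul := by
    intro u g k H H'
    induction u using Quotient.ind with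
    | _ h =>
      change G.src h = G.tgt g at H
      change hS.quotientAct (hS.toQuotient h) (G.mul g k) =
        hS.quotientAct (hS.quotientAct (hS.toQuotient h) g) k
      rw [hS.quotientAct_toQuotient H, hS.quotientAct_toQuotient (by rw [G.tgt_mul H', H]),
        hS.quotientAct_toQuotient (by rw [G.src_mul H, H']), G.mul_assoc H H']
  act_one u := by
    induction u using Quotient.ind with
    | _ h =>
      change hS.quotientAct (hS.toQuotient h) (G.one (G.src h)) = hS.toQuotient h
      rw [hS.quotientAct_toQuotient (G.tgt_one _).symm, G.mul_one]

/-- Transitivity of `S` replaces `g` by an equivalent `ρ g` with the target of `h`; then `(ρ g)⁻¹ h`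
carries its class to that of `h`. -/
theorem isHomogeneous_quotientAction (hT : ∀ x y, ∃ g ∈ S, G.src g = x ∧ G.tgt g = y)
    (hmk : ContMDiff 𝓘(ℝ, V) 𝓘(ℝ, W) ∞ hS.toQuotient)
    (hη : ∀ g, ∃ η : Quotient hS.setoid → M, EvSmooth 𝓘(ℝ, W) 𝓘(ℝ, V) η (hS.toQuotient g) ∧
      η (hS.toQuotient g) = g ∧ ∀ᶠ u in 𝓝 (hS.toQuotient g), hS.toQuotient (η u) = u) :
    (hS.quotientAction hmk hη).IsHomogeneous := by
  intro u v huv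
  induction u using Quotient.ind with
  | _ g =>
    induction v using Quotient.ind with
    | _ h =>
      change G.src g = G.src h at huv
      obtain ⟨ρ, hρ, h1, h2⟩ := hT (G.tgt g) (G.tgt h)
      have h3 : G.src (G.inv (G.mul ρ g)) = G.tgt h := by rw [G.src_inv, G.tgt_mul h1, h2]
      have h4 : G.tgt (G.mul (G.inv (G.mul ρ g)) h) = G.src g := by
        rw [G.tgt_mul h3, G.tgt_inv, G.src_mul h1]
      refine ⟨G.mul (G.inv (G.mul ρ g)) h, ?_, h4, ?_⟩
      · change _ = G.src g
        rw [G.src_mul h3, huv]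
      · change hS.quotientAct (hS.toQuotient g) _ = hS.toQuotient h
        rw [← hS.toQuotient_mul hρ h1, hS.quotientAct_toQuotient (by rw [G.src_mul h1, h4]),
          G.mul_inv_cancel (by rw [← h3, G.src_inv])]

/-- This identifies the stabiliser of `x ↦ [1_x]`: the left side is `[g]`, and `1 = ρ g` with `ρ ∈
S` means `g = ρ⁻¹ ∈ S`. -/
theorem quotientAct_one_eq_iff (g : M) :
    hS.quotientAct (hS.toQuotient (G.one (G.tgt g))) g = hS.toQuotient (G.one (G.src g)) ↔
      g ∈ S := by
  rw [hS.quotientAct_toQuotient (G.src_one _), G.one_mul, hS.toQuotient_eq_iff]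
  constructor
  · rintro ⟨ρ, hρ, h1, h2⟩
    have h3 : g = G.inv ρ := by
      refine G.eq_inv_of_mul_eq_one h1 ?_
      rw [← h2, ← G.tgt_mul h1, ← h2, G.tgt_one]
    rw [h3]
    exact hS.inv_mem ρ hρ
  · exact fun hg => ⟨G.inv g, hS.inv_mem g hg, G.src_inv g, (G.inv_mul g).symm⟩

end IsSubgroupoid

end QuotientAction

end LieGpd

end JetGpd

/-! ### The associated bundle and the converse. -/

namespace JetGpd

namespace LieGpd.IsSubgroupoid

variable {E V X M W : Type*} [NormedAddCommGroup E] [NormedSpace ℝ E]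
    [NormedAddCommGroup V] [NormedSpace ℝ V] [TopologicalSpace X] [ChartedSpace E X]
    [TopologicalSpace M] [ChartedSpace V M] [NormedAddCommGroup W] [NormedSpace ℝ W]
    {G : LieGpd E V X M} {S : Set M} (hS : G.IsSubgroupoid S)
    [ChartedSpace W (Quotient hS.setoid)] [IsManifold 𝓘(ℝ, W) ∞ (Quotient hS.setoid)]
    [FiniteDimensional ℝ V] [FiniteDimensional ℝ W] [IsManifold 𝓘(ℝ, E) ∞ X]
    [IsManifold 𝓘(ℝ, V) ∞ M] [SecondCountableTopology M]

/-- On arrows with target `y₀`, the orbit map of `[1_{y₀}]` is `g ↦ [g]`. If `τ` is a local section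
of it through `h p`, then `u ↦ (h⁻¹ τ(u), h)` is a local section through `(p, h)`. -/
theorem isSubmersionOn_toQuotient_mul (hmk : ContMDiff 𝓘(ℝ, V) 𝓘(ℝ, W) ∞ hS.toQuotient)
    (hη : ∀ g, ∃ η : Quotient hS.setoid → M, EvSmooth 𝓘(ℝ, W) 𝓘(ℝ, V) η (hS.toQuotient g) ∧
      η (hS.toQuotient g) = g ∧ ∀ᶠ u in 𝓝 (hS.toQuotient g), hS.toQuotient (η u) = u)
    (hA : (hS.quotientAction hmk hη).IsHomogeneous) (y₀ : X) :
    IsSubmersionOn (W := W) (𝓘(ℝ, V).prod 𝓘(ℝ, V))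
      (fun z : M × M => hS.toQuotient (G.mul z.2 z.1))
      {z | G.tgt z.1 = y₀ ∧ G.src z.2 = y₀ ∧ G.tgt z.2 = y₀} := by
  have hone : ∀ g, G.tgt g = y₀ → (hS.quotientAction hmk hη).act (hS.toQuotient (G.one y₀)) g =
      hS.toQuotient g := by
    rintro g rfl
    refine (hS.quotientAct_toQuotient (G.src_one _)).trans ?_
    rw [G.one_mul]
  refine ⟨hmk.comp_contMDiffOn (G.contMDiffOn_mul.comp
    (contMDiffOn_snd.prodMk contMDiffOn_fst) fun z hz => hz.2.1.trans hz.1.symm), ?_⟩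
  rintro ⟨p, h⟩ ⟨hp, hs, ht⟩
  dsimp only at hp hs ht
  have hhp : G.src h = G.tgt p := hs.trans hp.symm
  have htgt : G.tgt (G.mul h p) = y₀ := (G.tgt_mul hhp).trans ht
  obtain ⟨τ, h1, h2, h3⟩ := hA.exists_orbit_section (u₀ := hS.toQuotient (G.one y₀))
    (p := G.mul h p) (htgt.trans (G.src_one y₀).symm)
  rw [hone _ htgt] at h1 h2 h3
  obtain ⟨O, hO, hOo, hpO⟩ := eventually_nhds_iff.1 (h1.and h3)
  have hτt : ∀ u ∈ O, G.tgt (τ u) = y₀ := fun u hu => (hO u hu).2.1.trans (G.src_one y₀)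
  have hτs : ∀ u ∈ O, G.src (G.inv h) = G.tgt (τ u) := fun u hu => by
    rw [G.src_inv, ht, hτt u hu]
  refine ⟨O, fun u => (G.mul (G.inv h) (τ u), h), hOo, hpO, ?_, fun u hu => ⟨?_, hs, ht⟩, ?_,
    fun u hu => ?_⟩
  · have h4 : ContMDiffOn 𝓘(ℝ, W) 𝓘(ℝ, V) ∞ τ O := fun u hu => (hO u hu).1.contMDiffWithinAt
    exact (G.contMDiffOn_mul.comp (contMDiffOn_const.prodMk h4) hτs).prodMk contMDiffOn_const
  · change G.tgt (G.mul (G.inv h) (τ u)) = y₀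
    rw [G.tgt_mul (hτs u hu), G.tgt_inv, hs]
  · dsimp only
    rw [h2, G.inv_mul_cancel hhp]
  · dsimp only
    rw [G.mul_inv_cancel (ht.trans (hτt u hu).symm), ← hone _ (hτt u hu)]
    exact (hO u hu).2.2

end LieGpd.IsSubgroupoid

section Converse

variable {E : Type*} [NormedAddCommGroup E] [NormedSpace ℝ E] [FiniteDimensional ℝ E]
  {X : Type*} [TopologicalSpace X] [ChartedSpace E X] [IsManifold 𝓘(ℝ, E) ∞ X] {q : ℕ}
  {R : Set (Jet E X q)}

theorem IsJetGroupoid.isSubgroupoid (hR : IsJetGroupoid R) : (jetLieGpd E X q).IsSubgroupoid R :=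
  ⟨hR.unit_mem, hR.comp_mem, hR.inv_mem⟩

/-- The map from the associated bundle to the jets modulo a jet groupoid, `[p, [h]] ↦ [h p]`. -/
noncomputable def associatedMap (hR : IsJetGroupoid R) (y₀ : X) :
    AssociatedBundle R y₀ → Quotient hR.isSubgroupoid.setoid :=
  Quot.lift (fun a => Quot.lift
      (fun h : Isotropy (E := E) q y₀ => hR.isSubgroupoid.toQuotient (h.1.comp a.1.1)) (by
        rintro ⟨h, hs, ht⟩ ⟨h', hs', ht'⟩ ⟨r, hr, h1, h2, h3⟩
        have h3' : h' = r.comp h := h3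
        subst h3'
        have h4 : r.source = h.target := h1.trans ht.symm
        have h5 : h.source = a.1.1.target := hs.trans a.1.2.symm
        dsimp only
        rw [Jet.comp_assoc h4 h5]
        exact (hR.isSubgroupoid.toQuotient_mul hr
          (show r.source = (h.comp a.1.1).target by rw [Jet.target_comp h5, h4])).symm) a.2) (by
    rintro ⟨p, v⟩ ⟨p', v'⟩ ⟨c, h, h', h1, h2, h3, h4⟩
    dsimp only at h2 h3 h4
    subst h2 h4
    change hR.isSubgroupoid.toQuotient (h.1.comp p.1) =
      hR.isSubgroupoid.toQuotient (h'.1.comp p'.1)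
    rw [h1, h3, Jet.comp_assoc (h'.2.1.trans c.2.2.symm) (c.2.1.trans p.2.symm)])

theorem associatedMap_mk (hR : IsJetGroupoid R) {y₀ : X} (p : Principal (E := E) q y₀)
    (h : Isotropy (E := E) q y₀) : associatedMap hR y₀ (Quot.mk _ (p, Quot.mk _ h)) =
      hR.isSubgroupoid.toQuotient (h.1.comp p.1) := rfl

/-- A normal form: taking `c = h` in the defining relation gives `[p, [h]] = [h p, [1]]`. -/
theorem associatedBundle_mk_eq (y₀ : X) (p : Principal (E := E) q y₀)
    (h : Isotropy (E := E) q y₀) :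
    (Quot.mk _ (p, Quot.mk _ h) : AssociatedBundle R y₀) =
      Quot.mk _ (⟨h.1.comp p.1, (Jet.target_comp (h.2.1.trans p.2.symm)).trans h.2.2⟩,
        Quot.mk _ ⟨Jet.unit E q y₀, rfl, rfl⟩) := by
  refine Quot.sound ⟨h, h, ⟨Jet.unit E q y₀, rfl, rfl⟩, ?_, rfl, rfl, rfl⟩
  have := Jet.unit_comp h.1
  rw [h.2.2] at this
  exact this.symm

/-- In normal form, equal images mean `h' p' = ρ h p` with `ρ ∈ R`, and `ρ` is forced into the
isotropy at `y₀`. Then `[1] = [ρ]` as cosets, and the relation with `c = ρ` identifies the two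
classes. Surjectivity holds because `R` joins every target to `y₀`. -/
theorem associatedMap_bijective (hR : IsJetGroupoid R) (hT : IsTransitive R) (y₀ : X) :
    Function.Bijective (associatedMap hR y₀) := by
  constructor
  · intro a b hab
    induction a using Quot.ind with
    | _ a =>
    induction b using Quot.ind with
    | _ b =>
    obtain ⟨p, v⟩ := a
    obtain ⟨p', v'⟩ := b
    induction v using Quot.ind with
    | _ h =>
    induction v' using Quot.ind with
    | _ h' =>
    rw [associatedMap_mk, associatedMap_mk] at hab
    obtain ⟨ρ, hρ, h1, h2⟩ := hR.isSubgroupoid.toQuotient_eq_iff.1 hab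
    change ρ.source = (h.1.comp p.1).target at h1
    change h'.1.comp p'.1 = ρ.comp (h.1.comp p.1) at h2
    have k : (h.1.comp p.1).target = y₀ := (Jet.target_comp (h.2.1.trans p.2.symm)).trans h.2.2
    have k' : (h'.1.comp p'.1).target = y₀ :=
      (Jet.target_comp (h'.2.1.trans p'.2.symm)).trans h'.2.2
    have hρs : ρ.source = y₀ := h1.trans k
    have hρt : ρ.target = y₀ := by
      rw [← Jet.target_comp h1, ← h2, k']
    rw [associatedBundle_mk_eq, associatedBundle_mk_eq]
    refine Quot.sound ⟨⟨ρ, hρs, hρt⟩, ⟨ρ, hρs, hρt⟩, ⟨Jet.unit E q y₀, rfl, rfl⟩, ?_, ?_, h2, rfl⟩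
    · have := Jet.unit_comp ρ
      rw [hρt] at this
      exact this.symm
    · refine Quot.sound ⟨ρ, hρ, hρs, hρt, ?_⟩
      have := Jet.comp_unit ρ
      rw [hρs] at this
      exact this.symm
  · intro u
    induction u using Quotient.ind with
    | _ g =>
    obtain ⟨ρ, hρ, h1, h2⟩ := hT g.target y₀
    have h3 : (ρ.comp g).target = y₀ := (Jet.target_comp h1).trans h2
    refine ⟨Quot.mk _ (⟨ρ.comp g, h3⟩, Quot.mk _ ⟨Jet.unit E q y₀, rfl, rfl⟩), ?_⟩
    have h4 := Jet.unit_comp (ρ.comp g)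
    rw [h3] at h4
    change hR.isSubgroupoid.toQuotient ((Jet.unit E q y₀).comp (ρ.comp g)) =
      hR.isSubgroupoid.toQuotient g
    rw [h4]
    exact hR.isSubgroupoid.toQuotient_mul hρ h1

/-- The charts of the quotient come first, as the action must be smooth before homogeneity can yield
Hausdorffness; both are needed for the bundle structure. Second countability passes down along the
open quotient map. -/
theorem IsJetGroupoid.exists_naturalBundle [T2Space X] [SecondCountableTopology X]
    (hR : IsJetGroupoid R) (hT : IsTransitive R) (y₀ : X) :
    ∃ (m : ℕ) (_ : ChartedSpace (EuclideanSpace ℝ (Fin m)) (Quotient hR.isSubgroupoid.setoid))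
      (_ : IsManifold 𝓘(ℝ, EuclideanSpace ℝ (Fin m)) ∞ (Quotient hR.isSubgroupoid.setoid))
      (_ : T2Space (Quotient hR.isSubgroupoid.setoid))
      (_ : SecondCountableTopology (Quotient hR.isSubgroupoid.setoid))
      (B : NaturalBundle E X q m (Quotient hR.isSubgroupoid.setoid))
      (ξ₀ : X → Quotient hR.isSubgroupoid.setoid),
      B.IsHomogeneous ∧ B.IsSection ξ₀ ∧ B.stab ξ₀ = R ∧ B.IsAssociated R y₀ := by
  set hS := hR.isSubgroupoid with hSdef
  obtain ⟨m, hm⟩ := hS.exists_hasCrossSection hR.isSmoothBundle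
  have hmoves := hS.hasMoves hR.isSmoothBundle
  obtain ⟨i1, i2, hmk, hη⟩ := hmoves.exists_quotient_manifold
    (W := EuclideanSpace ℝ (Fin m)) fun g => ⟨g, hS.setoid.refl g, hm g⟩
  let A := hS.quotientAction hmk hη
  have hA : A.IsHomogeneous := hS.isHomogeneous_quotientAction hT hmk hη
  have i3 : T2Space (Quotient hS.setoid) := hA.t2Space
  have i4 : SecondCountableTopology (Quotient hS.setoid) :=
    hmoves.isOpenQuotientMap.isQuotientMap.secondCountableTopology
      hmoves.isOpenQuotientMap.isOpenMap
  let B : NaturalBundle E X q m (Quotient hS.setoid) :=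
    { proj := A.proj
      contMDiff_proj := A.contMDiff_proj
      isSmoothBundle := hA.isSmoothBundle (hS.toQuotient (Jet.unit E q y₀))
      act := A.act
      contMDiffOn_act := A.contMDiffOn_act
      proj_act := fun u g h => A.proj_act h
      act_comp := fun u g h H H' => A.act_mul H H'
      act_unit := A.act_one }
  refine ⟨m, i1, i2, i3, i4, B, fun x => hS.toQuotient (Jet.unit E q x), hA,
    ⟨hmk.comp Jet.contMDiff_unit, fun x => rfl⟩, Set.ext fun g => hS.quotientAct_one_eq_iff g,
    Equiv.ofBijective _ (associatedMap_bijective hR hT y₀),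
    fun z => hS.toQuotient (z.2.comp z.1), fun p h => rfl, hS.isSubmersionOn_toQuotient_mul hmk hη hA y₀, ?_, ?_⟩
  · intro p v
    induction v using Quot.ind with
    | _ h => exact Jet.source_comp (h.2.1.trans p.2.symm)
  · intro p p' v g H H'
    induction v using Quot.ind with
    | _ h =>
      have h1 : h.1.source = p.1.target := h.2.1.trans p.2.symm
      refine (hS.quotientAct_toQuotient (h := h.1.comp p.1) (g := g)
        ((Jet.source_comp h1).trans H)).trans ?_
      change hS.toQuotient ((h.1.comp p.1).comp g) = hS.toQuotient (h.1.comp p'.1)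
      rw [H', Jet.comp_assoc h1 H]

end Converse

end JetGpd

theorem mainTheorem2 (n q : ℕ) (X : Type u) [TopologicalSpace X]
    [ChartedSpace (EuclideanSpace ℝ (Fin n)) X]
    [IsManifold 𝓘(ℝ, EuclideanSpace ℝ (Fin n)) ∞ X] [T2Space X] [SecondCountableTopology X] :
    (∀ (m : ℕ) (F : Type v) [TopologicalSpace F] [ChartedSpace (EuclideanSpace ℝ (Fin m)) F]
        [IsManifold 𝓘(ℝ, EuclideanSpace ℝ (Fin m)) ∞ F] [T2Space F] [SecondCountableTopology F]
        (B : JetGpd.NaturalBundle (EuclideanSpace ℝ (Fin n)) X q m F),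
        B.IsHomogeneous → ∀ ξ : X → F, B.IsSection ξ →
          JetGpd.IsJetGroupoid (B.stab ξ) ∧ JetGpd.IsTransitive (B.stab ξ)) ∧
    (∀ R : Set (JetGpd.Jet (EuclideanSpace ℝ (Fin n)) X q),
        JetGpd.IsJetGroupoid R → JetGpd.IsTransitive R → ∀ y₀ : X,
          ∃ (m : ℕ) (F : Type u) (_ : TopologicalSpace F)
            (_ : ChartedSpace (EuclideanSpace ℝ (Fin m)) F)
            (_ : IsManifold 𝓘(ℝ, EuclideanSpace ℝ (Fin m)) ∞ F) (_ : T2Space F)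
            (_ : SecondCountableTopology F)
            (B : JetGpd.NaturalBundle (EuclideanSpace ℝ (Fin n)) X q m F) (ξ₀ : X → F),
            B.IsHomogeneous ∧ B.IsSection ξ₀ ∧ B.stab ξ₀ = R ∧ B.IsAssociated R y₀) := by
  refine ⟨fun m F _ _ _ _ _ B hB ξ hξ => ⟨JetGpd.NaturalBundle.isJetGroupoid_stab hB hξ,
    JetGpd.NaturalBundle.isTransitive_stab hB hξ⟩, fun R hR hT y₀ => ?_⟩
  obtain ⟨m, i1, i2, i3, i4, B, ξ₀, h⟩ := hR.exists_naturalBundle hT y₀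
  exact ⟨m, _, _, i1, i2, i3, i4, B, ξ₀, h⟩
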